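/- Let $T>0$, $\alpha\in(1/2,1]$, and let $f:\mathbb{R}\to\mathbb{R}$ be a non-negative continuous function with $$\lim_{t\to0^+}\frac{f(t)}{t}=+\infty.$$ Notation. For $0<\beta<1$, ${}_0D_t^{-\beta}w(t)=\frac1{\Gamma(\beta)}\int_0^t(t-s)^{\beta-1}w(s)\,ds$ and ${}_tD_T^{-\beta}w(t)=\frac1{\Gamma(\beta)}\int_t^T(s-t)^{\beta-1}w(s)\,ds$ are the left and right Riemann–Liouville integrals, and for $\beta=0$ both are the identity. For absolutely continuous $u$ on $[0,T]$, the left and right Caputo derivatives of order $\alpha$ are ${}_0^cD_t^{\alpha}u={}_0D_t^{\alpha-1}u'$ and ${}_t^cD_T^{\alpha}u=-{}_tD_T^{\alpha-1}u'$. The space $E_0^\alpha$ is the closure of $\{g\in C^\infty([0,T],\mathbb{R}): g(0)=g(T)=0\}$ with respect to the norm $\big(\int_0^T|{}_0^cD_t^\alpha u|^2dt+\int_0^T|u|^2dt\big)^{1/2}$. For $\mu>0$ consider the problem $$\frac{d}{dt}\Big({}_0D_t^{\alpha-1}({}_0^cD_t^\alpha u(t))-{}_tD_T^{\alpha-1}({}_t^cD_T^\alpha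 u(t))\Big)+\mu f(u(t))=0\ \text{ for a.e. }t\in[0,T],\qquad u(0)=u(T)=0;\tag{$F_f^\mu$}$$ a solution is an absolutely continuous function $u$ on $[0,T]$ such that the map in the large parentheses is differentiable in the classical sense at almost every $t\in[0,T]$ and $(F_f^\mu)$ holds. Put $$J_\mu(u)=-\int_0^T{}_0^cD_t^\alpha u(t)\cdot{}_t^cD_T^\alpha u(t)\,dt-\mu\int_0^T\Big(\int_0^{u(t)}f(s)\,ds\Big)dt,$$ $$\Lambda=\left(0,\ \frac{\Gamma(\alpha)^2\,|\cos(\pi\alpha)|\,(2\alpha-1)}{T^{2\alpha}}\ \sup_{\gamma>0}\frac{\gamma^2}{\int_0^\gamma f(s)\,ds}\right),$$ where the supremum may be $+\infty$, in which case $\Lambda=(0,+\infty)$. Then one can choose, for every $\mu\in\Lambda$, a non-trivial solution $u_\mu\in E_0^\alpha$ of $(F_f^\mu)$, with ${}_0^cD_t^\alpha u_\mu,\ {}_t^cD_T^\alpha u_\mu\in L^2(0,T)$, in such a way that $$\lim_{\mu\to0^+}\int_0^T|{}_0^cD_t^\alpha u_\mu(t)|^2\,dt=0,$$ and the function $\mu\mapsto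 J_\mu(u_\mu)$ is negative and strictly decreasing on $\Lambda$. -/

import Mathlib

open MeasureTheory Filter Topology Set
open scoped ContDiff

namespace FracBVP

/-- Left Riemann–Liouville fractional integral `ₐD_t^{-β} u (t)` of order `β ≥ 0` with base point
`a`; the integral of order `0` is the identity. -/
noncomputable def rlLeft (β a : ℝ) (u : ℝ → ℝ) (t : ℝ) : ℝ :=
  if β = 0 then u t else (1 / Real.Gamma β) * ∫ s in a..t, (t - s) ^ (β - 1) * u s

/-- Right Riemann–Liouville fractional integral `ₜD_b^{-β} u (t)` of order `β ≥ 0` with base point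
`b`; the integral of order `0` is the identity. -/
noncomputable def rlRight (β b : ℝ) (u : ℝ → ℝ) (t : ℝ) : ℝ :=
  if β = 0 then u t else (1 / Real.Gamma β) * ∫ s in t..b, (s - t) ^ (β - 1) * u s

/-- The integral defining `rlLeft β a u t` exists. -/
def RLLeftDefined (β a : ℝ) (u : ℝ → ℝ) (t : ℝ) : Prop :=
  β = 0 ∨ IntervalIntegrable (fun s => (t - s) ^ (β - 1) * u s) volume a t

/-- The integral defining `rlRight β b u t` exists. -/
def RLRightDefined (β b : ℝ) (u : ℝ → ℝ) (t : ℝ) : Prop :=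
  β = 0 ∨ IntervalIntegrable (fun s => (s - t) ^ (β - 1) * u s) volume t b

/-- Left Caputo derivative of order `α ∈ (0, 1]` of an absolutely continuous function `u`:
`(1 / Γ(1 - α)) ∫ₐᵗ (t - s)^{-α} u'(s) ds` if `α < 1`, and `u'(t)` if `α = 1`. -/
noncomputable def caputoLeft (α a : ℝ) (u : ℝ → ℝ) (t : ℝ) : ℝ :=
  rlLeft (1 - α) a (deriv u) t

/-- Right Caputo derivative of order `α ∈ (0, 1]` of an absolutely continuous function `u`:
`-(1 / Γ(1 - α)) ∫ₜᵇ (s - t)^{-α} u'(s) ds` if `α < 1`, and `-u'(t)` if `α = 1`. -/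
noncomputable def caputoRight (α b : ℝ) (u : ℝ → ℝ) (t : ℝ) : ℝ :=
  -rlRight (1 - α) b (deriv u) t

/-- `C_0^∞([0, T])`: smooth functions on the closed interval vanishing at both end points. -/
def SmoothZero (T : ℝ) (g : ℝ → ℝ) : Prop :=
  ContDiffOn ℝ ∞ g (Icc 0 T) ∧ g 0 = 0 ∧ g T = 0

/-- `u ∈ L²(0, T)` is a limit of functions `g n ∈ C_0^∞([0, T])` for the norm
`(∫ |ᶜ₀D_t^α g|² + ∫ |g|²)^{1/2}`, and `φ ∈ L²(0, T)` is the limit of the derivatives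
`ᶜ₀D_t^α (g n)`. -/
def HasFracDeriv (α T : ℝ) (u φ : ℝ → ℝ) : Prop :=
  MemLp u 2 (volume.restrict (Icc 0 T)) ∧ MemLp φ 2 (volume.restrict (Icc 0 T)) ∧
    ∃ g : ℕ → ℝ → ℝ, (∀ n, SmoothZero T (g n)) ∧
      Tendsto (fun n => eLpNorm (fun t => g n t - u t) 2 (volume.restrict (Icc 0 T)))
        atTop (𝓝 0) ∧
      Tendsto (fun n => eLpNorm (fun t => caputoLeft α 0 (g n) t - φ t) 2
        (volume.restrict (Icc 0 T))) atTop (𝓝 0)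

/-- The fractional derivative space `E_0^α`, the closure of `C_0^∞([0, T])` for the norm
`(∫ |ᶜ₀D_t^α u|² + ∫ |u|²)^{1/2}`. -/
def fracSpace (α T : ℝ) : Set (ℝ → ℝ) :=
  {u | ∃ φ : ℝ → ℝ, HasFracDeriv α T u φ}

/-- The map `t ↦ ₀D_t^{α-1}(ᶜ₀D_t^α u) (t) - ₜD_T^{α-1}(ᶜₜD_T^α u) (t)`. -/
noncomputable def fracFlux (α T : ℝ) (u : ℝ → ℝ) (t : ℝ) : ℝ :=
  rlLeft (1 - α) 0 (caputoLeft α 0 u) t - rlRight (1 - α) T (caputoRight α T u) t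

/-- Both integrals in `fracFlux α T u t` exist. -/
def FracFluxDefined (α T : ℝ) (u : ℝ → ℝ) (t : ℝ) : Prop :=
  RLLeftDefined (1 - α) 0 (caputoLeft α 0 u) t ∧
    RLRightDefined (1 - α) T (caputoRight α T u) t

/-- `u` is a solution of `(fracFlux u)' + μ f(u) = 0` a.e. on `[0, T]`, `u(0) = u(T) = 0`: it is
absolutely continuous, and at almost every `t` the flux exists near `t`, is differentiable at `t`
in the classical sense, and satisfies the equation. -/
structure IsSolution (α T μ : ℝ) (f u : ℝ → ℝ) : Prop where
  absCont : AbsolutelyContinuousOnInterval u 0 T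
  left_zero : u 0 = 0
  right_zero : u T = 0
  equation : ∀ᵐ t ∂(volume.restrict (Icc 0 T)),
    (∀ᶠ s in 𝓝 t, FracFluxDefined α T u s) ∧
      ∃ d : ℝ, HasDerivAt (fracFlux α T u) d t ∧ d + μ * f (u t) = 0

/-- The energy
`J_μ(u) = -∫₀ᵀ ᶜ₀D_t^α u · ᶜₜD_T^α u dt - μ ∫₀ᵀ (∫₀^{u(t)} f(s) ds) dt`. -/
noncomputable def energy (α T μ : ℝ) (f u : ℝ → ℝ) : ℝ :=
  -(∫ t in (0 : ℝ)..T, caputoLeft α 0 u t * caputoRight α T u t)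
    - μ * ∫ t in (0 : ℝ)..T, ∫ s in (0 : ℝ)..(u t), f s

/-- The parameter interval
`Λ = (0, Γ(α)² |cos(πα)| (2α - 1) / T^{2α} · sup_{γ > 0} γ² / ∫₀^γ f)`; the supremum is taken in
`[0, ∞]`, so that `Λ = (0, ∞)` if it is infinite. -/
noncomputable def paramInterval (α T : ℝ) (f : ℝ → ℝ) : Set ℝ :=
  {μ | 0 < μ ∧ ENNReal.ofReal μ <
    ENNReal.ofReal
        (Real.Gamma α ^ 2 * |Real.cos (Real.pi * α)| * (2 * α - 1) / T ^ (2 * α)) *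
      ⨆ (γ : ℝ) (_ : 0 < γ), ENNReal.ofReal (γ ^ 2 / ∫ s in (0 : ℝ)..γ, f s)}

end FracBVP

/-! Put b = 1 - α, κ = |cos πα| = cos πb, v = u'. For α < 1 the flux of u is the Riesz potential
I₊^{2b} v + I₋^{2b} v on (0, T) (`fracFlux_eq`), where I₊ and I₋ are the left and right fractional
integrals; for α = 1 it is 2u'. The proof rests on an explicit inverse of this operator. The
potential factors as 2κ t^b I₊^b s^{-2b} I₋^b y^b v (`riesz_factorization`), because a Möbius
substitution evaluates the kernel of the composition. The matching Green operator is G h = x^α I₋^α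
τ^{-2α} I₊^α y^α h: the function u = G h vanishes at 0 and T, has a derivative in L², and its flux
is a constant minus 2κ ∫₀ᵗ h (`riesz_greenDeriv`, `fracFlux_greenPrimitive`). The delicate point is
to differentiate G h; this goes through a Marchaud derivative and uses α > 1/2. Moreover G = A A*
with A ψ = x^α I₋^α τ^{-α} ψ on L²(0, T), and |A ψ| ≤ √E ‖ψ‖ pointwise, where E is `embConst`. With
F the primitive of f, the variational problem becomes that of J(ψ) = κ‖ψ‖² - μ ∫ F(Aψ) on L². If μ
F(γ) ≤ C γ² with C = κ/(E T), which is `radiusConst`, then J ≥ 0 on the sphere of radius γ/√E. Since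
F is superquadratic at 0+, J is negative somewhere in the ball. A minimum over the ball exists by
weak compactness and is therefore interior, and its Euler–Lagrange equation says exactly that u = Aψ
equals G(μ f(u)/(2κ)) (`exists_solution`). For each μ the smallest admissible γ is used. It is
nondecreasing in μ, so the balls are nested; a minimiser for a smaller μ competes for a larger one,
where its energy is strictly lower. As μ → 0+ the radii stay bounded, so h = μ f(u)/(2κ) is O(μ) and
the L² norm of the fractional derivative tends to 0. -/

namespace FracBVP

/-! ### Riemann–Liouville kernels and their convolution law. -/

/-- The Riemann–Liouville kernel `x ↦ x^{a-1} / Γ(a)` on `(0, ∞)`, extended by zero. -/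
noncomputable def rlKernel (a x : ℝ) : ℝ :=
  if 0 < x then x ^ (a - 1) / Real.Gamma a else 0

lemma rlKernel_of_pos (a : ℝ) {x : ℝ} (hx : 0 < x) :
    rlKernel a x = x ^ (a - 1) / Real.Gamma a := if_pos hx

lemma rlKernel_of_nonpos (a : ℝ) {x : ℝ} (hx : x ≤ 0) : rlKernel a x = 0 := if_neg hx.not_gt

lemma rlKernel_nonneg {a : ℝ} (ha : 0 < a) (x : ℝ) : 0 ≤ rlKernel a x := by
  unfold rlKernel
  split_ifs with h
  · exact div_nonneg (Real.rpow_nonneg h.le _) (Real.Gamma_pos_of_pos ha).le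
  · exact le_rfl

@[fun_prop]
lemma measurable_rlKernel (a : ℝ) : Measurable (rlKernel a) := by
  unfold rlKernel
  exact Measurable.ite measurableSet_Ioi (by fun_prop) measurable_const

lemma rlKernel_one {x : ℝ} (hx : 0 < x) : rlKernel 1 x = 1 := by
  simp [rlKernel_of_pos _ hx]

lemma mul_rlKernel {a : ℝ} (ha : 0 < a) (x : ℝ) : x * rlKernel a x = a * rlKernel (a + 1) x := by
  rcases le_or_gt x 0 with hx | hx
  · simp [rlKernel_of_nonpos _ hx]
  · rw [rlKernel_of_pos _ hx, rlKernel_of_pos _ hx, Real.Gamma_add_one ha.ne']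
    have := (Real.Gamma_pos_of_pos ha).ne'
    rw [show a + 1 - 1 = (a - 1) + 1 by ring, Real.rpow_add_one hx.ne']
    field_simp

lemma rlKernel_mono {a : ℝ} (ha : 1 ≤ a) {x y : ℝ} (hxy : x ≤ y) :
    rlKernel a x ≤ rlKernel a y := by
  rcases le_or_gt x 0 with hx | hx
  · rw [rlKernel_of_nonpos _ hx]
    exact rlKernel_nonneg (by linarith) _
  · rw [rlKernel_of_pos _ hx, rlKernel_of_pos _ (hx.trans_le hxy)]
    have := Real.Gamma_pos_of_pos (show 0 < a by linarith)
    gcongr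

lemma rlKernel_anti {a : ℝ} (ha : 0 < a) (ha1 : a ≤ 1) {x y : ℝ} (hx : 0 < x) (hxy : x ≤ y) :
    rlKernel a y ≤ rlKernel a x := by
  rw [rlKernel_of_pos _ hx, rlKernel_of_pos _ (hx.trans_le hxy)]
  have := Real.Gamma_pos_of_pos ha
  gcongr ?_ / _
  exact Real.rpow_le_rpow_of_nonpos hx hxy (by linarith)

lemma integral_beta {a b : ℝ} (ha : 0 < a) (hb : 0 < b) :
    IntegrableOn (fun x : ℝ => x ^ (a - 1) * (1 - x) ^ (b - 1)) (Ioo 0 1) ∧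
      ∫ x in Ioo (0 : ℝ) 1, x ^ (a - 1) * (1 - x) ^ (b - 1) =
        Real.Gamma a * Real.Gamma b / Real.Gamma (a + b) := by
  have hc := Complex.betaIntegral_convergent (u := (a : ℂ)) (v := (b : ℂ)) (by simpa) (by simpa)
  have hv := Complex.betaIntegral_eq_Gamma_mul_div (a : ℂ) (b : ℂ) (by simpa) (by simpa)
  have hEq : EqOn (fun x : ℝ => (x : ℂ) ^ ((a : ℂ) - 1) * (1 - (x : ℂ)) ^ ((b : ℂ) - 1))
      (fun x : ℝ => ((x ^ (a - 1) * (1 - x) ^ (b - 1) : ℝ) : ℂ)) (Ioo 0 1) := by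
    intro x hx
    simp only [Complex.ofReal_mul]
    rw [Complex.ofReal_cpow hx.1.le, Complex.ofReal_cpow (by linarith [hx.2])]
    push_cast
    rfl
  rw [intervalIntegrable_iff_integrableOn_Ioo_of_le zero_le_one] at hc
  have hi : IntegrableOn (fun x : ℝ => ((x ^ (a - 1) * (1 - x) ^ (b - 1) : ℝ) : ℂ)) (Ioo 0 1) :=
    hc.congr_fun hEq measurableSet_Ioo
  refine ⟨by simpa [IntegrableOn] using hi.re, ?_⟩
  rw [Complex.betaIntegral, intervalIntegral.integral_of_le zero_le_one,
    integral_Ioc_eq_integral_Ioo, setIntegral_congr_fun measurableSet_Ioo hEq,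
    integral_complex_ofReal] at hv
  rw [Complex.Gamma_ofReal, Complex.Gamma_ofReal, ← Complex.ofReal_add, Complex.Gamma_ofReal] at hv
  exact_mod_cast hv

lemma rlKernel_scale {a : ℝ} {x : ℝ} (hx : 0 < x) (y : ℝ) :
    rlKernel a (x * y) = x ^ (a - 1) * rlKernel a y := by
  rcases le_or_gt y 0 with hy | hy
  · rw [rlKernel_of_nonpos _ hy, rlKernel_of_nonpos _ (by nlinarith), mul_zero]
  · rw [rlKernel_of_pos _ hy, rlKernel_of_pos _ (by positivity), Real.mul_rpow hx.le hy.le]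
    ring

/-- Rescaling s = x r reduces the convolution to x = 1, where it is a Beta integral. -/
lemma rlKernel_conv_zero {a b : ℝ} (ha : 0 < a) (hb : 0 < b) (x : ℝ) :
    Integrable (fun s => rlKernel a (x - s) * rlKernel b s) ∧
      ∫ s, rlKernel a (x - s) * rlKernel b s = rlKernel (a + b) x := by
  rcases le_or_gt x 0 with hx | hx
  · have : (fun s => rlKernel a (x - s) * rlKernel b s) = fun _ => 0 := by
      ext s
      rcases le_or_gt s 0 with hs | hs
      · rw [rlKernel_of_nonpos b hs, mul_zero]
      · rw [rlKernel_of_nonpos a (by linarith), zero_mul]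
    rw [this, rlKernel_of_nonpos _ hx]
    simp
  have key : (fun s => rlKernel a (1 - s) * rlKernel b s) =
      (Ioo (0 : ℝ) 1).indicator (fun s => (Real.Gamma a * Real.Gamma b)⁻¹ *
        (s ^ (b - 1) * (1 - s) ^ (a - 1))) := by
    ext s
    by_cases hs : s ∈ Ioo (0 : ℝ) 1
    · rw [indicator_of_mem hs, rlKernel_of_pos _ hs.1, rlKernel_of_pos _ (by linarith [hs.2])]
      field_simp
    · rw [indicator_of_notMem hs]
      by_cases h0 : 0 < s
      · rw [rlKernel_of_nonpos a (by rw [mem_Ioo] at hs; grind), zero_mul]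
      · rw [rlKernel_of_nonpos b (not_lt.1 h0), mul_zero]
  have hone : Integrable (fun s => rlKernel a (1 - s) * rlKernel b s) ∧
      ∫ s, rlKernel a (1 - s) * rlKernel b s = rlKernel (a + b) 1 := by
    rw [key, integrable_indicator_iff measurableSet_Ioo, integral_indicator measurableSet_Ioo]
    obtain ⟨h1, h2⟩ := integral_beta hb ha
    refine ⟨h1.const_mul _, ?_⟩
    rw [integral_const_mul, h2, rlKernel_of_pos _ one_pos, Real.one_rpow, add_comm b a]
    have := (Real.Gamma_pos_of_pos ha).ne'
    have := (Real.Gamma_pos_of_pos hb).ne'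
    field_simp
  have hsc : (fun s => rlKernel a (x - s) * rlKernel b s) =
      fun s => x ^ (a + b - 2) * (fun r => rlKernel a (1 - r) * rlKernel b r) (x⁻¹ * s) := by
    ext s
    have e1 : x - s = x * (1 - x⁻¹ * s) := by field_simp
    have e2 : rlKernel b s = rlKernel b (x * (x⁻¹ * s)) := by
      congr 1; field_simp
    rw [e1, e2, rlKernel_scale hx, rlKernel_scale hx,
      show a + b - 2 = (a - 1) + (b - 1) by ring, Real.rpow_add hx]
    ring
  rw [hsc]
  refine ⟨((integrable_comp_mul_left_iff _ (inv_ne_zero hx.ne')).2 hone.1).const_mul _, ?_⟩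
  rw [integral_const_mul, Measure.integral_comp_mul_left (fun r => rlKernel a (1 - r) * rlKernel b r),
    hone.2, inv_inv, abs_of_pos hx, smul_eq_mul]
  have : rlKernel (a + b) x = rlKernel (a + b) (x * 1) := by rw [mul_one]
  rw [this, rlKernel_scale hx, show a + b - 1 = a + b - 2 + 1 by ring, Real.rpow_add_one hx.ne']
  ring

lemma rlKernel_conv {a b : ℝ} (ha : 0 < a) (hb : 0 < b) (t r : ℝ) :
    Integrable (fun s => rlKernel a (t - s) * rlKernel b (s - r)) ∧
      ∫ s, rlKernel a (t - s) * rlKernel b (s - r) = rlKernel (a + b) (t - r) := by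
  obtain ⟨h1, h2⟩ := rlKernel_conv_zero ha hb (t - r)
  have e : (fun s => rlKernel a (t - s) * rlKernel b (s - r)) =
      fun s => (fun s => rlKernel a (t - r - s) * rlKernel b s) (s - r) := by
    ext s
    simp
  rw [e]
  refine ⟨h1.comp_sub_right r, ?_⟩
  rw [integral_sub_right_eq_self (fun s => rlKernel a (t - r - s) * rlKernel b s) r, h2]

/-! ### Fractional integrals on (0, T): reflection, Fubini and the semigroup law. -/

/-- Left Riemann–Liouville integral on `(0, T)`, as an integral over the whole interval. -/
noncomputable def fracL (a T : ℝ) (v : ℝ → ℝ) (t : ℝ) : ℝ :=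
  ∫ s in Ioo 0 T, rlKernel a (t - s) * v s

/-- Right Riemann–Liouville integral on `(0, T)`, as an integral over the whole interval. -/
noncomputable def fracR (a T : ℝ) (v : ℝ → ℝ) (t : ℝ) : ℝ :=
  ∫ s in Ioo 0 T, rlKernel a (s - t) * v s

lemma integrableOn_rlKernel_iff {a t T : ℝ} (ht0 : 0 ≤ t) (htT : t ≤ T) (ha : 0 < a) (v : ℝ → ℝ) :
    IntegrableOn (fun s => rlKernel a (t - s) * v s) (Ioo 0 T) ↔
      IntervalIntegrable (fun s => (t - s) ^ (a - 1) * v s) volume 0 t := by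
  have e : EqOn (fun s => rlKernel a (t - s) * v s)
      ((Ioo 0 t).indicator fun s => (Real.Gamma a)⁻¹ * ((t - s) ^ (a - 1) * v s)) (Ioo 0 T) := by
    intro s hs
    by_cases h : s < t
    · rw [indicator_of_mem (show s ∈ Ioo 0 t from ⟨hs.1, h⟩)]
      simp only
      rw [rlKernel_of_pos _ (by linarith)]
      ring
    · rw [indicator_of_notMem (fun h' => h h'.2)]
      simp only
      rw [rlKernel_of_nonpos _ (by linarith), zero_mul]
  rw [integrableOn_congr_fun e measurableSet_Ioo, integrableOn_indicator_iff measurableSet_Ioo,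
    inter_eq_left.2 (Ioo_subset_Ioo_right htT),
    intervalIntegrable_iff_integrableOn_Ioo_of_le ht0, IntegrableOn,
    integrable_const_mul_iff (IsUnit.mk0 _ (inv_ne_zero (Real.Gamma_pos_of_pos ha).ne')),
    IntegrableOn]

lemma rlLeft_eq_fracL {a t T : ℝ} (ht0 : 0 ≤ t) (htT : t ≤ T) (ha : 0 < a) (v : ℝ → ℝ) :
    rlLeft a 0 v t = fracL a T v t := by
  have e : EqOn (fun s => rlKernel a (t - s) * v s)
      ((Ioo 0 t).indicator fun s => (1 / Real.Gamma a) * ((t - s) ^ (a - 1) * v s)) (Ioo 0 T) := by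
    intro s hs
    by_cases h : s < t
    · rw [indicator_of_mem (show s ∈ Ioo 0 t from ⟨hs.1, h⟩)]
      simp only
      rw [rlKernel_of_pos _ (by linarith)]
      ring
    · rw [indicator_of_notMem (fun h' => h h'.2)]
      simp only
      rw [rlKernel_of_nonpos _ (by linarith), zero_mul]
  rw [fracL, setIntegral_congr_fun measurableSet_Ioo e, setIntegral_indicator measurableSet_Ioo,
    inter_eq_right.2 (Ioo_subset_Ioo_right htT), rlLeft, if_neg ha.ne',
    intervalIntegral.integral_of_le ht0, integral_Ioc_eq_integral_Ioo, integral_const_mul]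

lemma rlRight_eq_rlLeft (a T : ℝ) (v : ℝ → ℝ) (t : ℝ) :
    rlRight a T v t = rlLeft a 0 (fun s => v (T - s)) (T - t) := by
  unfold rlRight rlLeft
  split_ifs
  · simp
  · congr 1
    have := intervalIntegral.integral_comp_sub_left (a := 0) (b := T - t)
      (fun s => (s - t) ^ (a - 1) * v s) T
    simp only [sub_zero, sub_sub_cancel] at this
    rw [← this]
    refine intervalIntegral.integral_congr fun s _ => ?_
    simp only
    rw [show T - s - t = T - t - s by ring]

lemma setIntegral_Ioo_reflect (T : ℝ) (w : ℝ → ℝ) :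
    ∫ s in Ioo 0 T, w (T - s) = ∫ s in Ioo 0 T, w s := by
  have hmp : MeasurePreserving (fun s : ℝ => T - s) volume volume :=
    Measure.measurePreserving_sub_left volume T
  have := hmp.setIntegral_preimage_emb (MeasurableEquiv.subLeft T).measurableEmbedding w (Ioo 0 T)
  simpa using this

lemma integrableOn_Ioo_reflect (T : ℝ) (w : ℝ → ℝ) :
    IntegrableOn (fun s => w (T - s)) (Ioo 0 T) ↔ IntegrableOn w (Ioo 0 T) := by
  have hmp : MeasurePreserving (fun s : ℝ => T - s) volume volume :=
    Measure.measurePreserving_sub_left volume T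
  have := hmp.integrableOn_comp_preimage (MeasurableEquiv.subLeft T).measurableEmbedding
    (f := w) (s := Ioo 0 T)
  simpa [Function.comp_def] using this

lemma fracR_eq_fracL (a T : ℝ) (v : ℝ → ℝ) (t : ℝ) :
    fracR a T v t = fracL a T (fun s => v (T - s)) (T - t) := by
  unfold fracR fracL
  rw [← setIntegral_Ioo_reflect T (fun s => rlKernel a (s - t) * v s)]
  refine setIntegral_congr_fun measurableSet_Ioo fun s _ => ?_
  simp only
  rw [show T - s - t = T - t - s by ring]

lemma rlRight_eq_fracR {a t T : ℝ} (ht0 : 0 ≤ t) (htT : t ≤ T) (ha : 0 < a) (v : ℝ → ℝ) :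
    rlRight a T v t = fracR a T v t := by
  rw [rlRight_eq_rlLeft, fracR_eq_fracL, rlLeft_eq_fracL (T := T) (by linarith) (by linarith) ha]

lemma integrableOn_rlKernel_right_iff {a t T : ℝ} (ht0 : 0 ≤ t) (htT : t ≤ T) (ha : 0 < a)
    (v : ℝ → ℝ) :
    IntegrableOn (fun s => rlKernel a (s - t) * v s) (Ioo 0 T) ↔
      IntervalIntegrable (fun s => (s - t) ^ (a - 1) * v s) volume t T := by
  rw [← integrableOn_Ioo_reflect]
  have h := integrableOn_rlKernel_iff (T := T) (t := T - t) (by linarith) (by linarith) ha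
    (fun s => v (T - s))
  have h2 := IntervalIntegrable.comp_sub_left_iff (a := t) (b := T)
    (f := fun s => (s - t) ^ (a - 1) * v s) T
  simp only [show ∀ s, T - s - t = T - t - s from fun s => by ring] at h2 ⊢
  rw [h, ← h2, sub_self, IntervalIntegrable.symm_iff]

/-- Tonelli for a non-negative kernel whose integral c in the first variable is known: only c · v
has to be integrable. It justifies the Fubini exchanges in `fracL_fracL` and `riesz_factorization`.
-/
lemma integrable_kernel_prod {μ ν : Measure ℝ} [SFinite μ] [SFinite ν] {k : ℝ → ℝ → ℝ}
    {c v : ℝ → ℝ} (hk : Measurable (Function.uncurry k)) (hk0 : ∀ s r, 0 ≤ k s r)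
    (hc : ∀ᵐ r ∂ν, Integrable (fun s => k s r) μ ∧ ∫ s, k s r ∂μ = c r)
    (hv : AEStronglyMeasurable v ν) (hcv : Integrable (fun r => c r * v r) ν) :
    Integrable (fun z : ℝ × ℝ => k z.1 z.2 * v z.2) (μ.prod ν) := by
  have hm : AEStronglyMeasurable (fun z : ℝ × ℝ => k z.1 z.2 * v z.2) (μ.prod ν) :=
    (hk.aestronglyMeasurable (μ := μ.prod ν)).mul hv.comp_snd
  rw [integrable_prod_iff' hm]
  refine ⟨hc.mono fun r hr => hr.1.mul_const (v r), ?_⟩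
  refine hcv.norm.congr (hc.mono fun r hr => ?_)
  have h0 : 0 ≤ c r := hr.2 ▸ integral_nonneg fun s => hk0 s r
  simp only [norm_mul, Real.norm_of_nonneg (hk0 _ _), Real.norm_of_nonneg h0]
  rw [integral_mul_const, hr.2]

lemma measurePreserving_reflect (T : ℝ) :
    MeasurePreserving (fun s : ℝ => T - s) (volume.restrict (Ioo 0 T))
      (volume.restrict (Ioo 0 T)) := by
  have h := (Measure.measurePreserving_sub_left volume T).restrict_preimage_emb
    (MeasurableEquiv.subLeft T).measurableEmbedding (Ioo 0 T)
  simpa using h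

/-- The product of kernels lives on r < s < t, so restricting to (0, T) loses nothing when 0 ≤ r and
t ≤ T. -/
lemma rlKernel_conv_restrict {a b T t r : ℝ} (ha : 0 < a) (hb : 0 < b) (htT : t ≤ T)
    (hr : 0 ≤ r) :
    IntegrableOn (fun s => rlKernel a (t - s) * rlKernel b (s - r)) (Ioo 0 T) ∧
      ∫ s in Ioo 0 T, rlKernel a (t - s) * rlKernel b (s - r) = rlKernel (a + b) (t - r) := by
  obtain ⟨h1, h2⟩ := rlKernel_conv ha hb t r
  refine ⟨h1.integrableOn, ?_⟩
  rw [setIntegral_eq_integral_of_forall_compl_eq_zero, h2]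
  intro s hs
  by_cases h : s ≤ r
  · rw [rlKernel_of_nonpos b (by linarith), mul_zero]
  · rw [rlKernel_of_nonpos a, zero_mul]
    by_contra h'
    exact hs ⟨by linarith, by linarith⟩

/-- Fubini and the convolution law. The identity is stated at a single t, with integrability asked
only there: the flux must be differentiated classically, so an almost everywhere version would not
suffice. -/
lemma fracL_fracL {a b T t : ℝ} (ha : 0 < a) (hb : 0 < b) (htT : t ≤ T) {v : ℝ → ℝ}
    (hv : AEStronglyMeasurable v (volume.restrict (Ioo 0 T)))
    (hi : IntegrableOn (fun r => rlKernel (a + b) (t - r) * v r) (Ioo 0 T)) :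
    IntegrableOn (fun s => rlKernel a (t - s) * fracL b T v s) (Ioo 0 T) ∧
      fracL a T (fracL b T v) t = fracL (a + b) T v t := by
  have hF := integrable_kernel_prod (μ := volume.restrict (Ioo 0 T))
    (ν := volume.restrict (Ioo 0 T)) (k := fun s r => rlKernel a (t - s) * rlKernel b (s - r))
    (c := fun r => rlKernel (a + b) (t - r)) (v := v) (by unfold Function.uncurry; fun_prop)
    (fun s r => mul_nonneg (rlKernel_nonneg ha _) (rlKernel_nonneg hb _))
    (by filter_upwards [ae_restrict_mem measurableSet_Ioo] with r hr
        exact rlKernel_conv_restrict ha hb htT hr.1.le) hv hi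
  have e : ∀ s, ∫ r in Ioo 0 T, rlKernel a (t - s) * rlKernel b (s - r) * v r =
      rlKernel a (t - s) * fracL b T v s := by
    intro s
    rw [fracL, ← integral_const_mul]
    simp only [mul_assoc]
  constructor
  · have := hF.integral_prod_left
    simpa only [IntegrableOn, e] using this
  · have := integral_integral_swap
      (f := fun s r => rlKernel a (t - s) * rlKernel b (s - r) * v r) hF
    simp only [e] at this
    rw [fracL, this, fracL]
    refine setIntegral_congr_fun measurableSet_Ioo fun r hr => ?_
    rw [integral_mul_const, (rlKernel_conv_restrict ha hb htT hr.1.le).2]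

lemma aestronglyMeasurable_reflect {T : ℝ} {v : ℝ → ℝ}
    (hv : AEStronglyMeasurable v (volume.restrict (Ioo 0 T))) :
    AEStronglyMeasurable (fun s => v (T - s)) (volume.restrict (Ioo 0 T)) :=
  hv.comp_measurePreserving (measurePreserving_reflect T)

lemma fracR_fracR {a b T t : ℝ} (ha : 0 < a) (hb : 0 < b) (ht : 0 ≤ t) {v : ℝ → ℝ}
    (hv : AEStronglyMeasurable v (volume.restrict (Ioo 0 T)))
    (hi : IntegrableOn (fun r => rlKernel (a + b) (r - t) * v r) (Ioo 0 T)) :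
    IntegrableOn (fun s => rlKernel a (s - t) * fracR b T v s) (Ioo 0 T) ∧
      fracR a T (fracR b T v) t = fracR (a + b) T v t := by
  have h := fracL_fracL (T := T) (t := T - t) ha hb (by linarith) (aestronglyMeasurable_reflect hv)
    (by
      rw [← integrableOn_Ioo_reflect] at hi
      simpa only [show ∀ s, T - s - t = T - t - s from fun s => by ring] using hi)
  rw [fracR_eq_fracL, fracR_eq_fracL, ← h.2]
  constructor
  · rw [← integrableOn_Ioo_reflect]
    simpa only [fracR_eq_fracL b, sub_sub_cancel,
      show ∀ s, T - s - t = T - t - s from fun s => by ring] using h.1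
  · simp only [fracR_eq_fracL b, sub_sub_cancel]

lemma integral_rlKernel_left {a T t : ℝ} (ha : 0 < a) (htT : t ≤ T) :
    IntegrableOn (fun s => rlKernel a (t - s)) (Ioo 0 T) ∧
      ∫ s in Ioo 0 T, rlKernel a (t - s) = rlKernel (a + 1) t := by
  obtain ⟨h1, h2⟩ := rlKernel_conv_restrict (r := 0) ha one_pos htT le_rfl
  have e : EqOn (fun s => rlKernel a (t - s) * rlKernel 1 (s - 0)) (fun s => rlKernel a (t - s))
      (Ioo 0 T) := by
    intro s hs
    simp only
    rw [sub_zero, rlKernel_one hs.1, mul_one]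
  refine ⟨h1.congr_fun e measurableSet_Ioo, ?_⟩
  rw [← setIntegral_congr_fun measurableSet_Ioo e, h2, sub_zero]

lemma integral_rlKernel_right {a T t : ℝ} (ha : 0 < a) (ht : 0 ≤ t) :
    IntegrableOn (fun s => rlKernel a (s - t)) (Ioo 0 T) ∧
      ∫ s in Ioo 0 T, rlKernel a (s - t) = rlKernel (a + 1) (T - t) := by
  obtain ⟨h1, h2⟩ := integral_rlKernel_left (T := T) (t := T - t) ha (by linarith)
  rw [← integrableOn_Ioo_reflect, ← setIntegral_Ioo_reflect]
  simpa only [show ∀ s, T - s - t = T - t - s from fun s => by ring] using ⟨h1, h2⟩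

lemma integrable_rlKernel_prod {a T : ℝ} (ha : 0 < a) {v : ℝ → ℝ}
    (hv : IntegrableOn v (Ioo 0 T)) :
    Integrable (fun z : ℝ × ℝ => rlKernel a (z.1 - z.2) * v z.2)
      ((volume.restrict (Ioo 0 T)).prod (volume.restrict (Ioo 0 T))) := by
  refine integrable_kernel_prod (k := fun t s => rlKernel a (t - s))
    (c := fun s => rlKernel (a + 1) (T - s)) (v := v) (by unfold Function.uncurry; fun_prop)
    (fun s r => rlKernel_nonneg ha _) ?_ hv.aestronglyMeasurable ?_
  · filter_upwards [ae_restrict_mem measurableSet_Ioo] with r hr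
    exact integral_rlKernel_right ha hr.1.le
  · refine hv.bdd_mul (c := rlKernel (a + 1) T)
      (Measurable.aestronglyMeasurable (by fun_prop)) ?_
    filter_upwards [ae_restrict_mem measurableSet_Ioo] with r hr
    rw [Real.norm_of_nonneg (rlKernel_nonneg (by linarith) _)]
    exact rlKernel_mono (by linarith) (by linarith [hr.1])

lemma integrable_rlKernel_prod' {a T : ℝ} (ha : 0 < a) {v : ℝ → ℝ}
    (hv : IntegrableOn v (Ioo 0 T)) :
    Integrable (fun z : ℝ × ℝ => rlKernel a (z.2 - z.1) * v z.2)
      ((volume.restrict (Ioo 0 T)).prod (volume.restrict (Ioo 0 T))) := by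
  refine integrable_kernel_prod (k := fun t s => rlKernel a (s - t))
    (c := fun s => rlKernel (a + 1) s) (v := v) (by unfold Function.uncurry; fun_prop)
    (fun s r => rlKernel_nonneg ha _) ?_ hv.aestronglyMeasurable ?_
  · filter_upwards [ae_restrict_mem measurableSet_Ioo] with r hr
    exact integral_rlKernel_left ha hr.2.le
  · refine hv.bdd_mul (c := rlKernel (a + 1) T)
      (Measurable.aestronglyMeasurable (by fun_prop)) ?_
    filter_upwards [ae_restrict_mem measurableSet_Ioo] with r hr
    rw [Real.norm_of_nonneg (rlKernel_nonneg (by linarith) _)]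
    exact rlKernel_mono (by linarith) hr.2.le

lemma ae_integrable_fracL {a T : ℝ} (ha : 0 < a) {v : ℝ → ℝ} (hv : IntegrableOn v (Ioo 0 T)) :
    ∀ᵐ t ∂(volume.restrict (Ioo 0 T)),
      IntegrableOn (fun s => rlKernel a (t - s) * v s) (Ioo 0 T) :=
  (integrable_rlKernel_prod ha hv).prod_right_ae

lemma integrableOn_fracL {a T : ℝ} (ha : 0 < a) {v : ℝ → ℝ} (hv : IntegrableOn v (Ioo 0 T)) :
    IntegrableOn (fracL a T v) (Ioo 0 T) :=
  (integrable_rlKernel_prod ha hv).integral_prod_left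

lemma integrableOn_reflect_of {T : ℝ} {v : ℝ → ℝ} (hv : IntegrableOn v (Ioo 0 T)) :
    IntegrableOn (fun s => v (T - s)) (Ioo 0 T) := (integrableOn_Ioo_reflect T v).2 hv

lemma integrableOn_fracR {a T : ℝ} (ha : 0 < a) {v : ℝ → ℝ} (hv : IntegrableOn v (Ioo 0 T)) :
    IntegrableOn (fracR a T v) (Ioo 0 T) := by
  rw [← integrableOn_Ioo_reflect]
  simpa only [fracR_eq_fracL, sub_sub_cancel] using
    integrableOn_fracL ha (integrableOn_reflect_of hv)

lemma fracL_one {T t : ℝ} (ht0 : 0 ≤ t) (htT : t ≤ T) (v : ℝ → ℝ) :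
    fracL 1 T v t = ∫ s in (0 : ℝ)..t, v s := by
  rw [← rlLeft_eq_fracL ht0 htT one_pos]
  simp [rlLeft]

lemma fracR_one {T t : ℝ} (ht0 : 0 ≤ t) (htT : t ≤ T) (v : ℝ → ℝ) :
    fracR 1 T v t = ∫ s in t..T, v s := by
  rw [← rlRight_eq_fracR ht0 htT one_pos]
  simp [rlRight]

lemma integrable_rlKernel_one_mul {T : ℝ} (t : ℝ) {v : ℝ → ℝ} (hv : IntegrableOn v (Ioo 0 T)) :
    IntegrableOn (fun s => rlKernel 1 (t - s) * v s) (Ioo 0 T) := by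
  refine hv.bdd_mul (c := 1) (Measurable.aestronglyMeasurable (by fun_prop)) (Eventually.of_forall fun r => ?_)
  rw [Real.norm_of_nonneg (rlKernel_nonneg one_pos _)]
  rcases le_or_gt (t - r) 0 with h | h
  · simp [rlKernel_of_nonpos _ h]
  · rw [rlKernel_one h]

lemma fracL_congr {a T : ℝ} {v w : ℝ → ℝ} (h : v =ᵐ[volume.restrict (Ioo 0 T)] w) (t : ℝ) :
    fracL a T v t = fracL a T w t :=
  integral_congr_ae (h.mono fun s hs => by simp only [hs])

lemma fracR_congr {a T : ℝ} {v w : ℝ → ℝ} (h : v =ᵐ[volume.restrict (Ioo 0 T)] w) (t : ℝ) :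
    fracR a T v t = fracR a T w t :=
  integral_congr_ae (h.mono fun s hs => by simp only [hs])

/-! ### Injectivity, bounds and Hölder continuity of fractional integrals. -/

lemma ae_eq_of_forall_integral_eq {T : ℝ} (hT : 0 ≤ T) {p q : ℝ → ℝ} (hp : IntegrableOn p (Ioo 0 T))
    (hq : IntegrableOn q (Ioo 0 T))
    (h : ∀ t ∈ Ioo 0 T, ∫ s in (0 : ℝ)..t, p s = ∫ s in (0 : ℝ)..t, q s) :
    p =ᵐ[volume.restrict (Ioo 0 T)] q := by
  have hp' := (intervalIntegrable_iff_integrableOn_Ioo_of_le hT).2 hp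
  have hq' := (intervalIntegrable_iff_integrableOn_Ioo_of_le hT).2 hq
  rw [EventuallyEq, ae_restrict_iff' measurableSet_Ioo]
  filter_upwards [hp'.ae_hasDerivAt_integral, hq'.ae_hasDerivAt_integral] with t h1 h2 ht
  have ht' : t ∈ uIcc 0 T := by rw [uIcc_of_le hT]; exact Ioo_subset_Icc_self ht
  refine (h1 ht' 0 left_mem_uIcc).unique ((h2 ht' 0 left_mem_uIcc).congr_of_eventuallyEq ?_)
  filter_upwards [Ioo_mem_nhds ht.1 ht.2] with s hs using h s hs

/-- Applying the integral of order 1 - a turns both sides into ordinary primitives, and Lebesgue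
differentiation recovers the integrands. -/
lemma fracL_injective {a T : ℝ} (hT : 0 ≤ T) (ha : 0 < a) (ha1 : a < 1) {p q : ℝ → ℝ}
    (hp : IntegrableOn p (Ioo 0 T)) (hq : IntegrableOn q (Ioo 0 T))
    (h : fracL a T p =ᵐ[volume.restrict (Ioo 0 T)] fracL a T q) :
    p =ᵐ[volume.restrict (Ioo 0 T)] q := by
  refine ae_eq_of_forall_integral_eq hT hp hq fun t ht => ?_
  rw [← fracL_one ht.1.le ht.2.le, ← fracL_one ht.1.le ht.2.le]
  have e : (1 : ℝ) = (1 - a) + a := by ring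
  have hb : 0 < 1 - a := by linarith
  have h1 := (fracL_fracL hb ha ht.2.le hp.aestronglyMeasurable
    (by rw [← e]; exact integrable_rlKernel_one_mul t hp)).2
  have h2 := (fracL_fracL hb ha ht.2.le hq.aestronglyMeasurable
    (by rw [← e]; exact integrable_rlKernel_one_mul t hq)).2
  rw [← e] at h1 h2
  rw [← h1, ← h2, fracL_congr h]

lemma ae_reflect {T : ℝ} {p : ℝ → Prop} (h : ∀ᵐ s ∂(volume.restrict (Ioo 0 T)), p s) :
    ∀ᵐ s ∂(volume.restrict (Ioo 0 T)), p (T - s) :=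
  (measurePreserving_reflect T).quasiMeasurePreserving.ae h

lemma fracR_injective {a T : ℝ} (hT : 0 ≤ T) (ha : 0 < a) (ha1 : a < 1) {p q : ℝ → ℝ}
    (hp : IntegrableOn p (Ioo 0 T)) (hq : IntegrableOn q (Ioo 0 T))
    (h : fracR a T p =ᵐ[volume.restrict (Ioo 0 T)] fracR a T q) :
    p =ᵐ[volume.restrict (Ioo 0 T)] q := by
  have h2 := ae_reflect h
  simp only [fracR_eq_fracL, sub_sub_cancel] at h2
  have h3 := ae_reflect
    (fracL_injective hT ha ha1 (integrableOn_reflect_of hp) (integrableOn_reflect_of hq) h2)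
  simpa only [sub_sub_cancel, EventuallyEq] using h3

lemma abs_fracL_le {a T t M : ℝ} (ha : 0 < a) (htT : t ≤ T) {v : ℝ → ℝ}
    (hv : ∀ r ∈ Ioo 0 T, r < t → |v r| ≤ M) :
    |fracL a T v t| ≤ M * rlKernel (a + 1) t := by
  obtain ⟨h1, h2⟩ := integral_rlKernel_left (T := T) (t := t) ha htT
  rw [← h2, ← integral_const_mul, ← Real.norm_eq_abs]
  refine norm_integral_le_of_norm_le (h1.const_mul M) ?_
  filter_upwards [ae_restrict_mem measurableSet_Ioo] with r hr
  rw [norm_mul, Real.norm_of_nonneg (rlKernel_nonneg ha _), mul_comm, Real.norm_eq_abs]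
  rcases lt_or_ge r t with h | h
  · exact mul_le_mul_of_nonneg_right (hv r hr h) (rlKernel_nonneg ha _)
  · rw [rlKernel_of_nonpos _ (by linarith)]
    simp

lemma abs_fracR_le {a T t M : ℝ} (ha : 0 < a) (ht : 0 ≤ t) {v : ℝ → ℝ}
    (hv : ∀ r ∈ Ioo 0 T, t < r → |v r| ≤ M) :
    |fracR a T v t| ≤ M * rlKernel (a + 1) (T - t) := by
  rw [fracR_eq_fracL]
  exact abs_fracL_le ha (by linarith) fun r hr hrt =>
    hv _ ⟨by linarith [hr.2], by linarith [hr.1]⟩ (by linarith)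

lemma integrableOn_rlKernel_mul_of_bdd {a T t M : ℝ} (ha : 0 < a) (htT : t ≤ T) {v : ℝ → ℝ}
    (hvm : AEStronglyMeasurable v (volume.restrict (Ioo 0 T)))
    (hv : ∀ r ∈ Ioo 0 T, r < t → |v r| ≤ M) :
    IntegrableOn (fun s => rlKernel a (t - s) * v s) (Ioo 0 T) := by
  have h1 := (integral_rlKernel_left (T := T) (t := t) ha htT).1
  have hk : AEStronglyMeasurable (fun s => rlKernel a (t - s)) (volume.restrict (Ioo 0 T)) :=
    Measurable.aestronglyMeasurable (by fun_prop)
  refine (h1.const_mul M).mono' (hk.mul hvm) ?_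
  filter_upwards [ae_restrict_mem measurableSet_Ioo] with r hr
  rw [norm_mul, Real.norm_of_nonneg (rlKernel_nonneg ha _), mul_comm, Real.norm_eq_abs]
  rcases lt_or_ge r t with h | h
  · exact mul_le_mul_of_nonneg_right (hv r hr h) (rlKernel_nonneg ha _)
  · rw [rlKernel_of_nonpos _ (by linarith)]
    simp

/-- For a ≤ 1 the kernel is decreasing on (0, ∞), so the difference of the two kernels is at most
k(s - r) - k(t - r) + 2 k(t - r) 1_{r > s}. Its integral is K(s) - K(t) + 2 K(t - s) with K the
kernel of order a + 1, and K(s) ≤ K(t). -/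
lemma abs_fracL_sub_le {a T s t M : ℝ} (ha : 0 < a) (ha1 : a ≤ 1) (hs : 0 ≤ s) (hst : s < t)
    (htT : t ≤ T) (hM : 0 ≤ M) {v : ℝ → ℝ}
    (hvm : AEStronglyMeasurable v (volume.restrict (Ioo 0 T)))
    (hv : ∀ r ∈ Ioo 0 T, r < t → |v r| ≤ M) :
    |fracL a T v t - fracL a T v s| ≤ 2 * M * rlKernel (a + 1) (t - s) := by
  have hsT : s ≤ T := by linarith
  have it := integrableOn_rlKernel_mul_of_bdd ha htT hvm hv
  have is := integrableOn_rlKernel_mul_of_bdd ha hsT hvm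
    (fun r hr h => hv r hr (h.trans hst))
  obtain ⟨kt, kt'⟩ := integral_rlKernel_left (T := T) (t := t) ha htT
  obtain ⟨ks, ks'⟩ := integral_rlKernel_left (T := T) (t := s) ha hsT
  -- The kernel of order 1 acts as the indicator of r > s, so the convolution law computes the
  -- integral of k(t - r) over (s, t).
  obtain ⟨kc, kc'⟩ := rlKernel_conv_restrict (T := T) (t := t) (r := s) ha one_pos htT hs
  have hbound : IntegrableOn (fun r => M * (rlKernel a (s - r) - rlKernel a (t - r) +
      2 * (rlKernel a (t - r) * rlKernel 1 (r - s)))) (Ioo 0 T) :=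
    ((ks.sub kt).add (kc.const_mul 2)).const_mul M
  have : |fracL a T v t - fracL a T v s| ≤ ∫ r in Ioo 0 T, M * (rlKernel a (s - r) -
      rlKernel a (t - r) + 2 * (rlKernel a (t - r) * rlKernel 1 (r - s))) := by
    rw [fracL, fracL, ← integral_sub it is, ← Real.norm_eq_abs]
    refine norm_integral_le_of_norm_le hbound ?_
    have hne : ∀ᵐ r ∂(volume.restrict (Ioo 0 T)), r ≠ s :=
      ae_restrict_of_ae (by simp [ae_iff, measure_singleton])
    filter_upwards [ae_restrict_mem measurableSet_Ioo, hne] with r hr hrs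
    rw [← sub_mul, norm_mul, mul_comm, Real.norm_eq_abs, Real.norm_eq_abs]
    rcases lt_or_gt_of_ne hrs with h | h
    · rw [rlKernel_of_nonpos 1 (by linarith : r - s ≤ 0), mul_zero, mul_zero, add_zero]
      have hk := rlKernel_anti ha ha1 (show 0 < s - r by linarith) (show s - r ≤ t - r by linarith)
      rw [abs_of_nonpos (show rlKernel a (t - r) - rlKernel a (s - r) ≤ 0 by linarith), neg_sub]
      have := hv r hr (by linarith)
      exact mul_le_mul_of_nonneg_right this (by linarith)
    · rw [rlKernel_one (by linarith : 0 < r - s), mul_one,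
        rlKernel_of_nonpos a (by linarith : s - r ≤ 0), sub_zero,
        abs_of_nonneg (rlKernel_nonneg ha _)]
      rcases lt_or_ge r t with h' | h'
      · have := hv r hr h'
        have := mul_le_mul_of_nonneg_right this (rlKernel_nonneg ha (t - r))
        linarith
      · rw [rlKernel_of_nonpos a (by linarith : t - r ≤ 0)]
        simp
  refine this.trans ?_
  rw [integral_const_mul, integral_add (f := fun r => rlKernel a (s - r) - rlKernel a (t - r))
    (ks.sub kt) (kc.const_mul 2), integral_sub ks kt, integral_const_mul, kt', ks', kc']
  have := rlKernel_mono (show 1 ≤ a + 1 by linarith) hst.le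
  nlinarith

/-! ### Factorisation of the Riesz potential on an interval. -/

/-- The exponents -2b, b - 1, b - 1 add up to -2, so under a Möbius change of variable the
denominators cancel against the derivative. The map `φ` sends (0, 1) onto (0, x) and the point at
infinity of the y - s factor disappears, leaving the Beta integral with parameters 1 - 2b and b. -/
lemma moebius_integral {b x y : ℝ} (hb : 0 < b) (hb2 : 2 * b < 1) (hx : 0 < x) (hxy : x < y) :
    IntegrableOn (fun s : ℝ => s ^ (-(2 * b)) * (x - s) ^ (b - 1) * (y - s) ^ (b - 1)) (Ioo 0 x) ∧
      ∫ s in Ioo 0 x, s ^ (-(2 * b)) * (x - s) ^ (b - 1) * (y - s) ^ (b - 1) =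
        Real.Gamma (1 - 2 * b) * Real.Gamma b / Real.Gamma (1 - b) *
          ((x * y) ^ (-b) * (y - x) ^ (2 * b - 1)) := by
  have hy : 0 < y := hx.trans hxy
  have hd : 0 < y - x := by linarith
  set φ : ℝ → ℝ := fun w => x * y * w / (y - x + x * w) with hφ
  set φ' : ℝ → ℝ := fun w => x * y * (y - x) / (y - x + x * w) ^ 2 with hφ'
  have hden : ∀ w ∈ Ioo (0 : ℝ) 1, 0 < y - x + x * w := fun w hw => by
    have := mul_pos hx hw.1; linarith
  have hderiv : ∀ w ∈ Ioo (0 : ℝ) 1, HasDerivWithinAt φ (φ' w) (Ioo 0 1) w := by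
    intro w hw
    have h1 : HasDerivAt (fun w => x * y * w) (x * y) w := by
      simpa using (hasDerivAt_id w).const_mul (x * y)
    have h2 : HasDerivAt (fun w => y - x + x * w) x w := by
      simpa using ((hasDerivAt_id w).const_mul x).const_add (y - x)
    have h3 := (h1.div h2 (hden w hw).ne').hasDerivWithinAt (s := Ioo 0 1)
    refine h3.congr_deriv ?_
    simp only [hφ']
    congr 1
    ring
  have hinj : InjOn φ (Ioo 0 1) := by
    intro w hw z hz h
    simp only [hφ] at h
    rw [div_eq_div_iff (hden w hw).ne' (hden z hz).ne'] at h
    have h' : (x * y * (y - x)) * (w - z) = 0 := by linear_combination h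
    rcases mul_eq_zero.1 h' with h0 | h0
    · exact absurd h0 (by positivity)
    · linarith
  have himg : φ '' Ioo 0 1 = Ioo 0 x := by
    ext s
    constructor
    · rintro ⟨w, hw, rfl⟩
      have := hden w hw
      refine ⟨div_pos (by have := hw.1; positivity) this, ?_⟩
      rw [div_lt_iff₀ this]
      have := mul_pos (mul_pos hx hd) (sub_pos.2 hw.2)
      nlinarith
    · rintro ⟨h0, h1⟩
      have hys : 0 < y - s := by linarith
      have hz : x * y - x * s ≠ 0 := by
        have := mul_pos hx hys
        nlinarith
      refine ⟨s * (y - x) / (x * (y - s)), ⟨by positivity, ?_⟩, ?_⟩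
      · rw [div_lt_one (by positivity)]
        nlinarith
      · simp only [hφ]
        have : y - x + x * (s * (y - x) / (x * (y - s))) = y * (y - x) / (y - s) := by
          field_simp
          ring
        rw [this]
        field_simp
  obtain ⟨hB1, hB2⟩ := integral_beta (a := 1 - 2 * b) (b := b) (by linarith) hb
  have hcongr : EqOn (fun w => |φ' w| • ((φ w) ^ (-(2 * b)) * (x - φ w) ^ (b - 1) *
      (y - φ w) ^ (b - 1))) (fun w => ((x * y) ^ (-b) * (y - x) ^ (2 * b - 1)) *
        (w ^ (1 - 2 * b - 1) * (1 - w) ^ (b - 1))) (Ioo 0 1) := by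
    intro w hw
    have hD := hden w hw
    have hw0 := hw.1
    have hw1 : 0 < 1 - w := by linarith [hw.2]
    have e1 : x - φ w = x * (y - x) * (1 - w) / (y - x + x * w) := by
      simp only [hφ]; field_simp; ring
    have e2 : y - φ w = y * (y - x) / (y - x + x * w) := by
      simp only [hφ]; field_simp; ring
    have e3 : 0 ≤ φ' w := by simp only [hφ']; positivity
    simp only [smul_eq_mul]
    rw [e1, e2, abs_of_nonneg e3]
    simp only [hφ, hφ']
    set D := y - x + x * w
    -- Both sides are positive products of powers, so the identity is checked on logarithms, where
    -- it is linear.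
    have hlog : ∀ a b : ℝ, 0 < a → 0 < b → Real.log a = Real.log b → a = b :=
      fun a b ha hb h => Real.log_injOn_pos ha hb h
    apply hlog
    · positivity
    · positivity
    · have l1 := Real.log_rpow (show 0 < x * y * w / D by positivity) (-(2 * b))
      have l2 := Real.log_rpow (show 0 < x * (y - x) * (1 - w) / D by positivity) (b - 1)
      have l3 := Real.log_rpow (show 0 < y * (y - x) / D by positivity) (b - 1)
      rw [Real.log_mul (by positivity) (by positivity), Real.log_mul (by positivity) (by positivity),
        Real.log_mul (by positivity) (by positivity), l1, l2, l3,
        Real.log_mul (by positivity) (by positivity), Real.log_mul (by positivity) (by positivity),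
        Real.log_mul (by positivity) (by positivity), Real.log_rpow (by positivity),
        Real.log_rpow hd, Real.log_rpow hw0, Real.log_rpow hw1]
      rw [Real.log_div (by positivity) (by positivity), Real.log_div (by positivity) (by positivity),
        Real.log_div (by positivity) (by positivity), Real.log_div (by positivity) (by positivity),
        Real.log_pow, Real.log_mul (by positivity) hw0.ne', Real.log_mul (by positivity) hw1.ne',
        Real.log_mul (by positivity) hd.ne', Real.log_mul hx.ne' hy.ne', Real.log_mul hx.ne' hd.ne',
        Real.log_mul hy.ne' hd.ne']
      push_cast
      ring
  constructor
  · rw [← himg, integrableOn_image_iff_integrableOn_abs_deriv_smul measurableSet_Ioo hderiv hinj,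
      integrableOn_congr_fun hcongr measurableSet_Ioo]
    exact hB1.const_mul _
  · rw [← himg, integral_image_eq_integral_abs_deriv_smul measurableSet_Ioo hderiv hinj,
      setIntegral_congr_fun measurableSet_Ioo hcongr, integral_const_mul, hB2,
      show 1 - 2 * b + b = 1 - b by ring]
    ring

lemma riesz_kernel_of_lt {b x y T : ℝ} (hb : 0 < b) (hb2 : 2 * b < 1) (hx : 0 < x) (hxy : x < y)
    (hxT : x ≤ T) :
    IntegrableOn (fun s => rlKernel b (x - s) * (|s| ^ (-(2 * b)) * rlKernel b (y - s))) (Ioo 0 T) ∧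
      ∫ s in Ioo 0 T, rlKernel b (x - s) * (|s| ^ (-(2 * b)) * rlKernel b (y - s)) =
        Real.Gamma (1 - 2 * b) / (Real.Gamma b * Real.Gamma (1 - b)) *
          ((x * y) ^ (-b) * |x - y| ^ (2 * b - 1)) := by
  have hG := Real.Gamma_pos_of_pos hb
  obtain ⟨h1, h2⟩ := moebius_integral hb hb2 hx hxy
  have e : EqOn (fun s => rlKernel b (x - s) * (|s| ^ (-(2 * b)) * rlKernel b (y - s)))
      ((Ioo 0 x).indicator fun s => (Real.Gamma b ^ 2)⁻¹ *
        (s ^ (-(2 * b)) * (x - s) ^ (b - 1) * (y - s) ^ (b - 1))) (Ioo 0 T) := by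
    intro s hs
    by_cases h : s < x
    · rw [indicator_of_mem (show s ∈ Ioo 0 x from ⟨hs.1, h⟩)]
      simp only
      rw [rlKernel_of_pos _ (by linarith), rlKernel_of_pos _ (by linarith), abs_of_pos hs.1]
      field_simp
    · rw [indicator_of_notMem (fun h' => h h'.2)]
      simp only
      rw [rlKernel_of_nonpos _ (by linarith), zero_mul]
  rw [integrableOn_congr_fun e measurableSet_Ioo, integrableOn_indicator_iff measurableSet_Ioo,
    setIntegral_congr_fun measurableSet_Ioo e, setIntegral_indicator measurableSet_Ioo,
    inter_eq_right.2 (Ioo_subset_Ioo_right hxT), inter_eq_left.2 (Ioo_subset_Ioo_right hxT),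
    integral_const_mul, h2, abs_sub_comm, abs_of_pos (by linarith : 0 < y - x)]
  refine ⟨h1.const_mul _, ?_⟩
  field_simp

lemma riesz_kernel {b x y T : ℝ} (hb : 0 < b) (hb2 : 2 * b < 1) (hx : 0 < x) (hy : 0 < y)
    (hxy : x ≠ y) (hxT : x ≤ T) (hyT : y ≤ T) :
    IntegrableOn (fun s => rlKernel b (x - s) * (|s| ^ (-(2 * b)) * rlKernel b (y - s))) (Ioo 0 T) ∧
      ∫ s in Ioo 0 T, rlKernel b (x - s) * (|s| ^ (-(2 * b)) * rlKernel b (y - s)) =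
        Real.Gamma (1 - 2 * b) / (Real.Gamma b * Real.Gamma (1 - b)) *
          ((x * y) ^ (-b) * |x - y| ^ (2 * b - 1)) := by
  rcases lt_or_gt_of_ne hxy with h | h
  · exact riesz_kernel_of_lt hb hb2 hx h hxT
  · have := riesz_kernel_of_lt hb hb2 hy h hyT
    rw [mul_comm y x, abs_sub_comm y x] at this
    simpa only [show ∀ s, rlKernel b (x - s) * (|s| ^ (-(2 * b)) * rlKernel b (y - s)) =
      rlKernel b (y - s) * (|s| ^ (-(2 * b)) * rlKernel b (x - s)) from fun s => by ring] using this

/-- Quotient of the reflection formulas at b and 2b, by the double-angle formula for the sine. This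
is where the cosine in the problem comes from. -/
lemma gamma_reflection_ratio {b : ℝ} (hb : 0 < b) (hb2 : 2 * b < 1) :
    Real.Gamma b * Real.Gamma (1 - b) =
      2 * Real.cos (Real.pi * b) * (Real.Gamma (2 * b) * Real.Gamma (1 - 2 * b)) := by
  have hpi := Real.pi_pos
  have hs : 0 < Real.sin (Real.pi * b) :=
    Real.sin_pos_of_pos_of_lt_pi (by positivity) (by nlinarith)
  have hc : 0 < Real.cos (Real.pi * b) :=
    Real.cos_pos_of_mem_Ioo ⟨by nlinarith, by nlinarith⟩
  rw [Real.Gamma_mul_Gamma_one_sub, Real.Gamma_mul_Gamma_one_sub,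
    show Real.pi * (2 * b) = 2 * (Real.pi * b) by ring, Real.sin_two_mul]
  field_simp

/-- The Riesz potential on an interval factors through weighted fractional integrals. -/
lemma riesz_factorization {b T t : ℝ} (hb : 0 < b) (hb2 : 2 * b < 1) (ht : t ∈ Ioo 0 T)
    {v : ℝ → ℝ} (hv : AEStronglyMeasurable v (volume.restrict (Ioo 0 T)))
    (hL : IntegrableOn (fun r => rlKernel (2 * b) (t - r) * v r) (Ioo 0 T))
    (hR : IntegrableOn (fun r => rlKernel (2 * b) (r - t) * v r) (Ioo 0 T)) :
    fracL (2 * b) T v t + fracR (2 * b) T v t =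
      2 * Real.cos (Real.pi * b) * (t ^ b * fracL b T
        (fun s => s ^ (-(2 * b)) * fracR b T (fun y => y ^ b * v y) s) t) := by
  have hG := Real.Gamma_pos_of_pos hb
  have hG2 := Real.Gamma_pos_of_pos (show 0 < 2 * b by linarith)
  have hG3 := Real.Gamma_pos_of_pos (show 0 < 1 - 2 * b by linarith)
  have hG4 := Real.Gamma_pos_of_pos (show 0 < 1 - b by linarith)
  set c : ℝ → ℝ := fun y => Real.Gamma (1 - 2 * b) / (Real.Gamma b * Real.Gamma (1 - b)) *
          ((t * y) ^ (-b) * |t - y| ^ (2 * b - 1)) with hc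
  have hne : ∀ᵐ r ∂(volume.restrict (Ioo 0 T)), r ≠ t :=
    ae_restrict_of_ae (by simp [ae_iff, measure_singleton])
  have hc' : ∀ᵐ y ∂(volume.restrict (Ioo 0 T)),
      IntegrableOn (fun s => rlKernel b (t - s) * (|s| ^ (-(2 * b)) * rlKernel b (y - s)))
        (Ioo 0 T) ∧
      ∫ s in Ioo 0 T, rlKernel b (t - s) * (|s| ^ (-(2 * b)) * rlKernel b (y - s)) = c y := by
    filter_upwards [ae_restrict_mem measurableSet_Ioo, hne] with y hy hyt
    exact riesz_kernel hb hb2 ht.1 hy.1 hyt.symm ht.2.le hy.2.le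
  have hcw : (fun y => c y * (y ^ b * v y)) =ᵐ[volume.restrict (Ioo 0 T)]
      fun y => (2 * Real.cos (Real.pi * b) * t ^ b)⁻¹ *
        (rlKernel (2 * b) (t - y) * v y + rlKernel (2 * b) (y - t) * v y) := by
    filter_upwards [ae_restrict_mem measurableSet_Ioo, hne] with y hy hyt
    have hk : rlKernel (2 * b) (t - y) + rlKernel (2 * b) (y - t) =
        |t - y| ^ (2 * b - 1) / Real.Gamma (2 * b) := by
      rcases lt_or_gt_of_ne hyt with h | h
      · rw [rlKernel_of_pos _ (by linarith), rlKernel_of_nonpos _ (by linarith), add_zero,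
          abs_of_pos (by linarith)]
      · rw [rlKernel_of_nonpos _ (by linarith), rlKernel_of_pos _ (by linarith), zero_add,
          abs_sub_comm, abs_of_pos (by linarith)]
    have hcos : 0 < Real.cos (Real.pi * b) := by
      have hpi := Real.pi_pos
      exact Real.cos_pos_of_mem_Ioo ⟨by nlinarith, by nlinarith⟩
    have hr := gamma_reflection_ratio hb hb2
    have hty : (t * y) ^ (-b) = (t ^ b)⁻¹ * (y ^ b)⁻¹ := by
      rw [Real.mul_rpow ht.1.le hy.1.le, Real.rpow_neg ht.1.le, Real.rpow_neg hy.1.le]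
    have := Real.rpow_pos_of_pos ht.1 b
    have := Real.rpow_pos_of_pos hy.1 b
    rw [← add_mul, hk]
    simp only [hc]
    rw [hty, hr]
    field_simp
  -- The absolute value in |s|^{-2b} makes the kernel non-negative for every real s, as the Tonelli
  -- lemma requires; on (0, T) it changes nothing.
  have hF := integrable_kernel_prod (μ := volume.restrict (Ioo 0 T))
    (ν := volume.restrict (Ioo 0 T))
    (k := fun s y => rlKernel b (t - s) * (|s| ^ (-(2 * b)) * rlKernel b (y - s)))
    (c := c) (v := fun y => y ^ b * v y) (by unfold Function.uncurry; fun_prop)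
    (fun s r => mul_nonneg (rlKernel_nonneg hb _)
      (mul_nonneg (Real.rpow_nonneg (abs_nonneg _) _) (rlKernel_nonneg hb _))) hc'
    ((Measurable.aestronglyMeasurable (by fun_prop)).mul hv)
    (((hL.add hR).const_mul _).congr hcw.symm)
  have hsw := integral_integral_swap (f := fun s y => rlKernel b (t - s) * (|s| ^ (-(2 * b)) *
    rlKernel b (y - s)) * (y ^ b * v y)) hF
  have e1 : ∫ s in Ioo 0 T, ∫ y in Ioo 0 T, rlKernel b (t - s) * (|s| ^ (-(2 * b)) *
      rlKernel b (y - s)) * (y ^ b * v y) = fracL b T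
        (fun s => s ^ (-(2 * b)) * fracR b T (fun y => y ^ b * v y) s) t := by
    refine setIntegral_congr_fun measurableSet_Ioo fun s hs => ?_
    simp only [fracR]
    rw [← integral_const_mul, ← integral_const_mul, abs_of_pos hs.1]
    simp only [mul_assoc]
  have e2 : ∫ y in Ioo 0 T, ∫ s in Ioo 0 T, rlKernel b (t - s) * (|s| ^ (-(2 * b)) *
      rlKernel b (y - s)) * (y ^ b * v y) = (2 * Real.cos (Real.pi * b) * t ^ b)⁻¹ *
        (fracL (2 * b) T v t + fracR (2 * b) T v t) := by
    rw [fracL, fracR, ← integral_add hL hR, ← integral_const_mul, ← integral_congr_ae hcw]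
    refine integral_congr_ae (hc'.mono fun y hy => ?_)
    simp only
    rw [integral_mul_const, hy.2]
  rw [← e1, hsw, e2]
  have hcos : 0 < Real.cos (Real.pi * b) := by
    have hpi := Real.pi_pos
    exact Real.cos_pos_of_mem_Ioo ⟨by nlinarith, by nlinarith⟩
  have := Real.rpow_pos_of_pos ht.1 b
  generalize Real.cos (Real.pi * b) = C at *
  field_simp

/-! ### Marchaud derivative of a Hölder function. -/

/-- The kernel `x ↦ (x + ε)^{a-2}` on `(0, ∞)`, extended by zero. -/
noncomputable def shiftKernel (a ε x : ℝ) : ℝ := if 0 < x then (x + ε) ^ (a - 2) else 0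

lemma shiftKernel_of_pos (a ε : ℝ) {x : ℝ} (hx : 0 < x) :
    shiftKernel a ε x = (x + ε) ^ (a - 2) := if_pos hx

lemma shiftKernel_of_nonpos (a ε : ℝ) {x : ℝ} (hx : x ≤ 0) : shiftKernel a ε x = 0 :=
  if_neg hx.not_gt

@[fun_prop]
lemma measurable_shiftKernel (a ε : ℝ) : Measurable (shiftKernel a ε) := by
  unfold shiftKernel
  exact Measurable.ite measurableSet_Ioi (by fun_prop) measurable_const

lemma shiftKernel_nonneg (a : ℝ) {ε : ℝ} (hε : 0 ≤ ε) (x : ℝ) : 0 ≤ shiftKernel a ε x := by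
  unfold shiftKernel
  split_ifs with h
  · positivity
  · exact le_rfl

lemma shiftKernel_le {a ε : ℝ} (ha : a < 1) (hε : 0 ≤ ε) (x : ℝ) :
    shiftKernel a ε x ≤ shiftKernel a 0 x := by
  unfold shiftKernel
  split_ifs with h
  · exact Real.rpow_le_rpow_of_nonpos (by linarith) (by linarith) (by linarith)
  · exact le_rfl

lemma shiftKernel_le_const {a ε : ℝ} (ha : a < 1) (hε : 0 < ε) (x : ℝ) :
    shiftKernel a ε x ≤ ε ^ (a - 2) := by
  unfold shiftKernel
  split_ifs with h
  · exact Real.rpow_le_rpow_of_nonpos hε (by linarith) (by linarith)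
  · positivity

lemma integral_shift_rpow {a ε p q : ℝ} (ha : a < 1) (hε : 0 < ε) (hpq : p ≤ q) :
    (1 - a) * ∫ s in p..q, (s - p + ε) ^ (a - 2) = ε ^ (a - 1) - (q - p + ε) ^ (a - 1) := by
  have h := intervalIntegral.integral_comp_add_right (a := p) (b := q)
    (fun u : ℝ => u ^ (a - 2)) (ε - p)
  have e : ∀ s : ℝ, s - p + ε = s + (ε - p) := fun s => by ring
  simp only [e]
  rw [h, integral_rpow (Or.inr ⟨by linarith, ?_⟩)]
  · have : a - 1 ≠ 0 := by linarith
    rw [show p + (ε - p) = ε by ring, show a - 2 + 1 = a - 1 by ring]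
    field_simp
    ring
  · rw [uIcc_of_le (by linarith)]
    intro h0
    linarith [h0.1]

lemma integral_shiftKernel_right {a ε T y : ℝ} (ha : a < 1) (hε : 0 < ε) (hy : y ∈ Ioo 0 T) :
    (1 - a) * ∫ s in Ioo 0 T, shiftKernel a ε (s - y) =
      ε ^ (a - 1) - (T - y + ε) ^ (a - 1) := by
  have e : EqOn (fun s => shiftKernel a ε (s - y))
      ((Ioo y T).indicator fun s => (s - y + ε) ^ (a - 2)) (Ioo 0 T) := by
    intro s hs
    by_cases h : y < s
    · rw [indicator_of_mem (show s ∈ Ioo y T from ⟨h, hs.2⟩)]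
      exact shiftKernel_of_pos _ _ (by linarith)
    · rw [indicator_of_notMem (fun h' => h h'.1)]
      exact shiftKernel_of_nonpos _ _ (by linarith)
  rw [setIntegral_congr_fun measurableSet_Ioo e, setIntegral_indicator measurableSet_Ioo,
    inter_eq_right.2 (Ioo_subset_Ioo_left hy.1.le), ← integral_shift_rpow ha hε hy.2.le,
    intervalIntegral.integral_of_le hy.2.le, integral_Ioc_eq_integral_Ioo]

lemma integral_shiftKernel_left {a ε T x s : ℝ} (ha : a < 1) (hε : 0 < ε) (hs : s ∈ Ioo 0 T) :
    (1 - a) * ∫ y in Ioo x T, shiftKernel a ε (s - y) =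
      (Ioi x).indicator (fun s => ε ^ (a - 1) - (s - x + ε) ^ (a - 1)) s := by
  by_cases hxs : x < s
  · have e : EqOn (fun y => shiftKernel a ε (s - y))
        ((Ioo x s).indicator fun y => (s - y + ε) ^ (a - 2)) (Ioo x T) := by
      intro y hy
      by_cases h : y < s
      · rw [indicator_of_mem (show y ∈ Ioo x s from ⟨hy.1, h⟩)]
        exact shiftKernel_of_pos _ _ (by linarith)
      · rw [indicator_of_notMem (fun h' => h h'.2)]
        exact shiftKernel_of_nonpos _ _ (by linarith)
    rw [setIntegral_congr_fun measurableSet_Ioo e, setIntegral_indicator measurableSet_Ioo,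
      inter_eq_right.2 (Ioo_subset_Ioo_right hs.2.le), indicator_of_mem (show s ∈ Ioi x from hxs),
      ← integral_Ioc_eq_integral_Ioo, ← intervalIntegral.integral_of_le hxs.le]
    have h := intervalIntegral.integral_comp_sub_left (a := x) (b := s)
      (fun u : ℝ => (u - 0 + ε) ^ (a - 2)) s
    have h2 := integral_shift_rpow (p := 0) (q := s - x) ha hε (by linarith)
    simp only [sub_zero, sub_self] at h h2
    rw [h, h2]
  · have e : EqOn (fun y => shiftKernel a ε (s - y)) (fun _ => 0) (Ioo x T) := fun y hy =>
      shiftKernel_of_nonpos _ _ (by linarith [hy.1])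
    rw [setIntegral_congr_fun measurableSet_Ioo e, indicator_of_notMem (show s ∉ Ioi x from hxs)]
    simp

/-- Regularized Marchaud derivative; for `ε = 0` it inverts the right Riemann–Liouville integral of
order `1 - a`. -/
noncomputable def marchaud (a T : ℝ) (k : ℝ → ℝ) (ε y : ℝ) : ℝ :=
  (Real.Gamma a)⁻¹ * ((T - y + ε) ^ (a - 1) * k y +
    (1 - a) * ∫ s in Ioo 0 T, shiftKernel a ε (s - y) * (k y - k s))

lemma measurable_marchaud (a T : ℝ) {k : ℝ → ℝ} (hk : Measurable k) (ε : ℝ) :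
    Measurable (marchaud a T k ε) := by
  unfold marchaud
  have : Measurable fun y => ∫ s in Ioo 0 T, shiftKernel a ε (s - y) * (k y - k s) := by
    refine StronglyMeasurable.measurable (StronglyMeasurable.integral_prod_right' (f := fun z : ℝ × ℝ =>
      shiftKernel a ε (z.2 - z.1) * (k z.1 - k z.2)) (Measurable.stronglyMeasurable ?_))
    fun_prop
  fun_prop

/-- Hölder continuity of exponent a improves the singularity a - 2 to 2a - 2, which is integrable
because a > 1/2. -/
lemma shiftKernel_mul_sub_le {a T L : ℝ} (ha : 1 / 2 < a) (ha1 : a < 1) {k : ℝ → ℝ}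
    (hL : ∀ x ∈ Ioo 0 T, ∀ y ∈ Ioo 0 T, x < y → |k x - k y| ≤ L * (y - x) ^ a)
    {y s ε : ℝ} (hε : 0 ≤ ε) (hy : y ∈ Ioo 0 T) (hs : s ∈ Ioo 0 T) :
    |shiftKernel a ε (s - y) * (k y - k s)| ≤
      L * Real.Gamma (2 * a - 1) * rlKernel (2 * a - 1) (s - y) := by
  rw [abs_mul, abs_of_nonneg (shiftKernel_nonneg a hε _)]
  rcases lt_or_ge y s with h | h
  · have h1 := shiftKernel_le ha1 hε (s - y)
    have h2 := hL y hy s hs h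
    have h0 : 0 < s - y := by linarith
    refine (mul_le_mul h1 h2 (abs_nonneg _) (shiftKernel_nonneg a le_rfl _)).trans ?_
    have hz := (Real.Gamma_pos_of_pos (show 0 < 2 * a - 1 by linarith)).ne'
    rw [rlKernel_of_pos _ h0, shiftKernel_of_pos _ _ h0, add_zero, mul_assoc, mul_div_cancel₀ _ hz,
      show 2 * a - 1 - 1 = (a - 2) + a by ring, Real.rpow_add h0]
    exact le_of_eq (by ring)
  · rw [shiftKernel_of_nonpos _ _ (by linarith), rlKernel_of_nonpos _ (by linarith)]
    simp


/-- The bound does not depend on ε ≥ 0, so it serves as the dominating function for ε → 0. -/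
lemma abs_marchaud_le {a T L M : ℝ} (ha : 1 / 2 < a) (ha1 : a < 1) {k : ℝ → ℝ}
    (hM : ∀ x ∈ Ioo 0 T, |k x| ≤ M)
    (hL : ∀ x ∈ Ioo 0 T, ∀ y ∈ Ioo 0 T, x < y → |k x - k y| ≤ L * (y - x) ^ a) (hL0 : 0 ≤ L)
    {y ε : ℝ} (hε : 0 ≤ ε) (hy : y ∈ Ioo 0 T) :
    |marchaud a T k ε y| ≤
      (Real.Gamma a)⁻¹ * (M + L * T ^ a / (2 * a - 1)) * (T - y) ^ (a - 1) := by
  have hG := Real.Gamma_pos_of_pos (show 0 < a by linarith)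
  have hp : 0 < 2 * a - 1 := by linarith
  have hTy : 0 < T - y := by linarith [hy.2]
  obtain ⟨i1, i2⟩ := integral_rlKernel_right (a := 2 * a - 1) (T := T) (t := y) hp hy.1.le
  have hint : |∫ s in Ioo 0 T, shiftKernel a ε (s - y) * (k y - k s)| ≤
      L * T ^ a / (2 * a - 1) * (T - y) ^ (a - 1) := by
    have h1 : |∫ s in Ioo 0 T, shiftKernel a ε (s - y) * (k y - k s)| ≤
        ∫ s in Ioo 0 T, L * Real.Gamma (2 * a - 1) * rlKernel (2 * a - 1) (s - y) := by
      rw [← Real.norm_eq_abs]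
      refine norm_integral_le_of_norm_le (i1.const_mul _) ?_
      filter_upwards [ae_restrict_mem measurableSet_Ioo] with s hs
      exact shiftKernel_mul_sub_le ha ha1 hL hε hy hs
    refine h1.trans ?_
    rw [integral_const_mul, i2, rlKernel_of_pos _ hTy, Real.Gamma_add_one hp.ne',
      show 2 * a - 1 + 1 - 1 = a + (a - 1) by ring, Real.rpow_add hTy]
    have hG2 := Real.Gamma_pos_of_pos hp
    have h2 : (T - y) ^ a ≤ T ^ a :=
      Real.rpow_le_rpow hTy.le (by linarith [hy.1]) (by linarith)
    have h3 := Real.rpow_pos_of_pos hTy (a - 1)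
    calc L * Real.Gamma (2 * a - 1) * ((T - y) ^ a * (T - y) ^ (a - 1) /
          ((2 * a - 1) * Real.Gamma (2 * a - 1)))
        = L * (T - y) ^ a / (2 * a - 1) * (T - y) ^ (a - 1) := by field_simp
      _ ≤ _ := by gcongr
  have hk : |(T - y + ε) ^ (a - 1) * k y| ≤ M * (T - y) ^ (a - 1) := by
    rw [abs_mul, abs_of_nonneg (by positivity), mul_comm]
    have := (abs_nonneg _).trans (hM y hy)
    exact mul_le_mul (hM y hy) (Real.rpow_le_rpow_of_nonpos hTy (by linarith) (by linarith))
      (by positivity) this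
  unfold marchaud
  rw [abs_mul, abs_of_nonneg (inv_nonneg.2 hG.le), mul_assoc]
  gcongr
  refine (abs_add_le _ _).trans ?_
  rw [abs_mul (1 - a), abs_of_pos (show 0 < 1 - a by linarith), add_mul]
  have := abs_nonneg (∫ s in Ioo 0 T, shiftKernel a ε (s - y) * (k y - k s))
  nlinarith

/-- For ε > 0 the kernel is bounded, so the difference k(y) - k(s) can be split and Fubini applied;
the two terms in ε^{a-1} then cancel. -/
lemma integral_marchaud_pos {a T M x ε : ℝ} (ha1 : a < 1) (hε : 0 < ε)
    {k : ℝ → ℝ} (hk : Measurable k) (hM : ∀ x ∈ Ioo 0 T, |k x| ≤ M) (hx : x ∈ Ioo 0 T) :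
    ∫ y in Ioo x T, marchaud a T k ε y =
      (Real.Gamma a)⁻¹ * ∫ s in Ioo x T, (s - x + ε) ^ (a - 1) * k s := by
  have hsub : Ioo x T ⊆ Ioo 0 T := Ioo_subset_Ioo_left hx.1.le
  have hki : IntegrableOn k (Ioo 0 T) := by
    refine Measure.integrableOn_of_bounded (M := M) (by simp) hk.aestronglyMeasurable ?_
    filter_upwards [ae_restrict_mem measurableSet_Ioo] with s hs using hM s hs
  have hsi : ∀ y, IntegrableOn (fun s => shiftKernel a ε (s - y)) (Ioo 0 T) := fun y => by
    refine Measure.integrableOn_of_bounded (M := ε ^ (a - 2)) (by simp)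
      (Measurable.aestronglyMeasurable (by fun_prop)) (Eventually.of_forall fun s => ?_)
    rw [Real.norm_of_nonneg (shiftKernel_nonneg a hε.le _)]
    exact shiftKernel_le_const ha1 hε _
  have hsk : ∀ y, IntegrableOn (fun s => shiftKernel a ε (s - y) * k s) (Ioo 0 T) := fun y => by
    refine hki.bdd_mul (c := ε ^ (a - 2)) (Measurable.aestronglyMeasurable (by fun_prop))
      (Eventually.of_forall fun s => ?_)
    rw [Real.norm_of_nonneg (shiftKernel_nonneg a hε.le _)]
    exact shiftKernel_le_const ha1 hε _
  -- The boundary term (T - y + ε)^{a-1} k(y) completes the mass of the kernel to ε^{a-1}.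
  have e1 : ∀ y ∈ Ioo 0 T, marchaud a T k ε y = (Real.Gamma a)⁻¹ * (ε ^ (a - 1) * k y -
      (1 - a) * ∫ s in Ioo 0 T, shiftKernel a ε (s - y) * k s) := by
    intro y hy
    unfold marchaud
    have h := integral_shiftKernel_right ha1 hε hy
    simp only [mul_sub]
    rw [integral_sub ((hsi y).mul_const _) (hsk y), integral_mul_const, mul_sub (1 - a),
      ← mul_assoc (1 - a), h]
    ring
  have hF : Integrable (fun z : ℝ × ℝ => shiftKernel a ε (z.2 - z.1) * k z.2)
      ((volume.restrict (Ioo x T)).prod (volume.restrict (Ioo 0 T))) := by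
    have : Integrable (fun z : ℝ × ℝ => k z.2)
      ((volume.restrict (Ioo x T)).prod (volume.restrict (Ioo 0 T))) := hki.comp_snd _
    refine this.bdd_mul (c := ε ^ (a - 2)) (f := fun z : ℝ × ℝ => shiftKernel a ε (z.2 - z.1))
      (Measurable.aestronglyMeasurable (by fun_prop)) (Eventually.of_forall fun s => ?_)
    rw [Real.norm_of_nonneg (shiftKernel_nonneg a hε.le _)]
    exact shiftKernel_le_const ha1 hε _
  have hsw := integral_integral_swap (f := fun y s => shiftKernel a ε (s - y) * k s) hF
  have hkx := hki.mono_set hsub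
  rw [setIntegral_congr_fun measurableSet_Ioo (fun y hy => e1 y (hsub hy)), integral_const_mul,
    integral_sub (hkx.const_mul _) (Integrable.const_mul hF.integral_prod_left _),
    integral_const_mul, integral_const_mul]
  rw [hsw, ← integral_const_mul (1 - a)]
  have e2 : EqOn (fun s => (1 - a) * ∫ y in Ioo x T, shiftKernel a ε (s - y) * k s)
      ((Ioi x).indicator fun s => ε ^ (a - 1) * k s - (s - x + ε) ^ (a - 1) * k s) (Ioo 0 T) := by
    intro s hs
    simp only
    rw [integral_mul_const, ← mul_assoc, integral_shiftKernel_left ha1 hε hs]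
    by_cases h : x < s
    · rw [indicator_of_mem (show s ∈ Ioi x from h), indicator_of_mem (show s ∈ Ioi x from h), sub_mul]
    · rw [indicator_of_notMem (show s ∉ Ioi x from h), indicator_of_notMem (show s ∉ Ioi x from h),
        zero_mul]
  have hset : Ioo 0 T ∩ Ioi x = Ioo x T := by
    ext s
    have := hx.1
    constructor
    · rintro ⟨h1, h2⟩; exact ⟨h2, h1.2⟩
    · rintro ⟨h1, h2⟩; exact ⟨⟨by linarith, h2⟩, h1⟩
  have hkε : IntegrableOn (fun s => (s - x + ε) ^ (a - 1) * k s) (Ioo x T) := by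
    refine hkx.bdd_mul (c := ε ^ (a - 1)) (Measurable.aestronglyMeasurable (by fun_prop)) ?_
    filter_upwards [ae_restrict_mem measurableSet_Ioo] with s hs
    have : 0 < s - x := by linarith [hs.1]
    rw [Real.norm_of_nonneg (by positivity)]
    exact Real.rpow_le_rpow_of_nonpos hε (by linarith) (by linarith)
  rw [setIntegral_congr_fun measurableSet_Ioo e2, setIntegral_indicator measurableSet_Ioi, hset,
    integral_sub (hkx.const_mul _) hkε, integral_const_mul]
  ring

lemma tendsto_marchaud {a T L : ℝ} (ha : 1 / 2 < a) (ha1 : a < 1) {k : ℝ → ℝ} (hk : Measurable k)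
    (hL : ∀ x ∈ Ioo 0 T, ∀ y ∈ Ioo 0 T, x < y → |k x - k y| ≤ L * (y - x) ^ a)
    {y : ℝ} (hy : y ∈ Ioo 0 T) :
    Tendsto (fun n : ℕ => marchaud a T k (1 / ((n : ℝ) + 1)) y) atTop (𝓝 (marchaud a T k 0 y)) := by
  have hε := tendsto_one_div_add_atTop_nhds_zero_nat (𝕜 := ℝ)
  have hTy : 0 < T - y := by linarith [hy.2]
  have hp : 0 < 2 * a - 1 := by linarith
  have hpow : ∀ x e : ℝ, 0 < x → Tendsto (fun n : ℕ => (x + 1 / ((n : ℝ) + 1)) ^ e) atTop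
      (𝓝 ((x + 0) ^ e)) := fun x e hx =>
    (tendsto_const_nhds.add hε).rpow_const (Or.inl (by rw [add_zero]; exact hx.ne'))
  obtain ⟨i1, -⟩ := integral_rlKernel_right (a := 2 * a - 1) (T := T) (t := y) hp hy.1.le
  unfold marchaud
  refine Tendsto.const_mul _ (((hpow _ _ hTy).mul_const _).add (Tendsto.const_mul _ ?_))
  refine tendsto_integral_of_dominated_convergence
    (fun s => L * Real.Gamma (2 * a - 1) * rlKernel (2 * a - 1) (s - y))
    (fun n => Measurable.aestronglyMeasurable (by fun_prop)) (i1.const_mul _) ?_ ?_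
  · intro n
    filter_upwards [ae_restrict_mem measurableSet_Ioo] with s hs
    exact shiftKernel_mul_sub_le ha ha1 hL (by positivity) hy hs
  · refine Eventually.of_forall fun s => Tendsto.mul_const _ ?_
    rcases lt_or_ge y s with h | h
    · have h0 : 0 < s - y := by linarith
      simp only [shiftKernel_of_pos _ _ h0]
      exact hpow _ _ h0
    · have h0 : s - y ≤ 0 := by linarith
      simp only [shiftKernel_of_nonpos _ _ h0]
      exact tendsto_const_nhds

lemma integrableOn_rpow_right {a x T : ℝ} (ha : 0 < a) :
    IntegrableOn (fun y => (T - y) ^ (a - 1)) (Ioo x T) := by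
  rcases le_or_gt T x with h | h
  · simp [Ioo_eq_empty (not_lt.2 h)]
  have h1 : IntervalIntegrable (fun y : ℝ => y ^ (a - 1)) volume 0 (T - x) :=
    intervalIntegral.intervalIntegrable_rpow' (by linarith)
  have h2 := h1.comp_sub_left T
  simp only [sub_zero, sub_sub_cancel] at h2
  exact (intervalIntegrable_iff_integrableOn_Ioo_of_le h.le).1 h2.symm

lemma integrableOn_rpow_left {a x T : ℝ} (ha : 0 < a) :
    IntegrableOn (fun y => (y - x) ^ (a - 1)) (Ioo x T) := by
  rcases le_or_gt T x with h | h
  · simp [Ioo_eq_empty (not_lt.2 h)]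
  have h1 : IntervalIntegrable (fun y : ℝ => y ^ (a - 1)) volume 0 (T - x) :=
    intervalIntegral.intervalIntegrable_rpow' (by linarith)
  have h2 := h1.comp_sub_right x
  simp only [zero_add, sub_add_cancel] at h2
  exact (intervalIntegrable_iff_integrableOn_Ioo_of_le h.le).1 h2

lemma fracR_eq_integral {a T x : ℝ} (hx : 0 ≤ x) (hxT : x ≤ T) (ha : 0 < a) (k : ℝ → ℝ) :
    fracR a T k x = (Real.Gamma a)⁻¹ * ∫ s in Ioo x T, (s - x) ^ (a - 1) * k s := by
  rw [← rlRight_eq_fracR hx hxT ha, rlRight, if_neg ha.ne', intervalIntegral.integral_of_le hxT,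
    integral_Ioc_eq_integral_Ioo, one_div]

/-- The right fractional integral of order `a` of an `a`-Hölder function, `a > 1/2`, is the integral
of the Marchaud derivative. -/
lemma fracR_eq_integral_marchaud {a T L M x : ℝ} (ha : 1 / 2 < a) (ha1 : a < 1) {k : ℝ → ℝ}
    (hk : Measurable k) (hM : ∀ x ∈ Ioo 0 T, |k x| ≤ M)
    (hL : ∀ x ∈ Ioo 0 T, ∀ y ∈ Ioo 0 T, x < y → |k x - k y| ≤ L * (y - x) ^ a) (hL0 : 0 ≤ L)
    (hx : x ∈ Ioo 0 T) :
    fracR a T k x = ∫ y in x..T, marchaud a T k 0 y := by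
  have ha0 : 0 < a := by linarith
  have hsub : Ioo x T ⊆ Ioo 0 T := Ioo_subset_Ioo_left hx.1.le
  have hε := tendsto_one_div_add_atTop_nhds_zero_nat (𝕜 := ℝ)
  rw [intervalIntegral.integral_of_le hx.2.le, integral_Ioc_eq_integral_Ioo,
    fracR_eq_integral hx.1.le hx.2.le ha0]
  have h1 : Tendsto (fun n : ℕ => ∫ y in Ioo x T, marchaud a T k (1 / ((n : ℝ) + 1)) y) atTop
      (𝓝 (∫ y in Ioo x T, marchaud a T k 0 y)) := by
    refine tendsto_integral_of_dominated_convergence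
      (fun y => (Real.Gamma a)⁻¹ * (M + L * T ^ a / (2 * a - 1)) * (T - y) ^ (a - 1))
      (fun n => (measurable_marchaud a T hk _).aestronglyMeasurable)
      ((integrableOn_rpow_right ha0).const_mul _) ?_ ?_
    · intro n
      filter_upwards [ae_restrict_mem measurableSet_Ioo] with y hy
      exact abs_marchaud_le ha ha1 hM hL hL0 (by positivity) (hsub hy)
    · filter_upwards [ae_restrict_mem measurableSet_Ioo] with y hy
      exact tendsto_marchaud ha ha1 hk hL (hsub hy)
  have h2 : Tendsto (fun n : ℕ => (Real.Gamma a)⁻¹ *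
      ∫ s in Ioo x T, (s - x + 1 / ((n : ℝ) + 1)) ^ (a - 1) * k s) atTop
      (𝓝 ((Real.Gamma a)⁻¹ * ∫ s in Ioo x T, (s - x) ^ (a - 1) * k s)) := by
    refine Tendsto.const_mul _ (tendsto_integral_of_dominated_convergence
      (fun s => (s - x) ^ (a - 1) * M) (fun n => Measurable.aestronglyMeasurable (by fun_prop))
      ((integrableOn_rpow_left ha0).mul_const _) ?_ ?_)
    · intro n
      filter_upwards [ae_restrict_mem measurableSet_Ioo] with s hs
      have h0 : 0 < s - x := by linarith [hs.1]
      have hn : 0 < 1 / ((n : ℝ) + 1) := by positivity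
      rw [norm_mul, Real.norm_of_nonneg (by positivity)]
      exact mul_le_mul (Real.rpow_le_rpow_of_nonpos h0 (by linarith) (by linarith))
        (hM s (hsub hs)) (norm_nonneg _) (by positivity)
    · filter_upwards [ae_restrict_mem measurableSet_Ioo] with s hs
      have h0 : 0 < s - x := by linarith [hs.1]
      have := (tendsto_const_nhds (x := s - x)).add hε
      rw [add_zero] at this
      exact (this.rpow_const (Or.inl h0.ne')).mul_const _
  refine tendsto_nhds_unique h2 (h1.congr fun n => ?_)
  exact integral_marchaud_pos ha1 (by positivity) hk hM hx

/-! ### The Green operator: bounds and Hölder estimates for its ingredients. -/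

lemma measurable_fracL (a T : ℝ) {v : ℝ → ℝ} (hv : Measurable v) : Measurable (fracL a T v) := by
  unfold fracL
  refine StronglyMeasurable.measurable (StronglyMeasurable.integral_prod_right' (f := fun z : ℝ × ℝ =>
    rlKernel a (z.1 - z.2) * v z.2) (Measurable.stronglyMeasurable ?_))
  fun_prop

lemma measurable_fracR (a T : ℝ) {v : ℝ → ℝ} (hv : Measurable v) : Measurable (fracR a T v) := by
  unfold fracR
  refine StronglyMeasurable.measurable (StronglyMeasurable.integral_prod_right' (f := fun z : ℝ × ℝ =>
    rlKernel a (z.2 - z.1) * v z.2) (Measurable.stronglyMeasurable ?_))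
  fun_prop

lemma fracL_eq_integral {a T t : ℝ} (ht : 0 ≤ t) (htT : t ≤ T) (ha : 0 < a) (w : ℝ → ℝ) :
    fracL a T w t = (Real.Gamma a)⁻¹ * ∫ s in (0 : ℝ)..t, (t - s) ^ (a - 1) * w s := by
  rw [← rlLeft_eq_fracL ht htT ha, rlLeft, if_neg ha.ne', one_div]

lemma fracL_scale {a T t : ℝ} (ht : 0 < t) (htT : t ≤ T) (ha : 0 < a) (w : ℝ → ℝ) :
    fracL a T w t =
      (Real.Gamma a)⁻¹ * (t ^ a * ∫ σ in (0 : ℝ)..1, (1 - σ) ^ (a - 1) * w (t * σ)) := by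
  rw [fracL_eq_integral ht.le htT ha]
  congr 1
  have h := intervalIntegral.integral_comp_mul_left (a := 0) (b := 1)
    (fun s => (t - s) ^ (a - 1) * w s) ht.ne'
  simp only [mul_zero, mul_one, smul_eq_mul] at h
  have h2 : ∫ σ in (0 : ℝ)..1, (t - t * σ) ^ (a - 1) * w (t * σ) =
      t ^ (a - 1) * ∫ σ in (0 : ℝ)..1, (1 - σ) ^ (a - 1) * w (t * σ) := by
    rw [← intervalIntegral.integral_const_mul]
    refine intervalIntegral.integral_congr fun σ hσ => ?_
    rw [uIcc_of_le zero_le_one] at hσ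
    rw [show t - t * σ = t * (1 - σ) by ring, Real.mul_rpow ht.le (by linarith [hσ.2])]
    ring
  rw [h2] at h
  rw [show a = (a - 1) + 1 by ring, Real.rpow_add_one ht.ne', show a - 1 + 1 - 1 = a - 1 by ring,
    mul_right_comm, h]
  field_simp

/-- The function `τ ↦ τ^{-2α} I^α(y^α h)(τ)`. -/
noncomputable def greenDensity (α T : ℝ) (h : ℝ → ℝ) (τ : ℝ) : ℝ :=
  τ ^ (-(2 * α)) * fracL α T (fun y => y ^ α * h y) τ

/-- The solution `x ↦ x^α I_-^α(τ^{-2α} I^α(y^α h))(x)` of the linear boundary value problem. -/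
noncomputable def greenSolution (α T : ℝ) (h : ℝ → ℝ) (x : ℝ) : ℝ :=
  x ^ α * fracR α T (greenDensity α T h) x

/-- The function whose Marchaud derivative yields the derivative of `greenSolution`. -/
noncomputable def greenTrace (α T : ℝ) (h : ℝ → ℝ) (s : ℝ) : ℝ :=
  -(s * greenDensity α T h s) + (2 * α - 1) * fracR 1 T (greenDensity α T h) s

lemma measurable_greenDensity (α T : ℝ) {h : ℝ → ℝ} (hh : Measurable h) :
    Measurable (greenDensity α T h) := by
  have := measurable_fracL α T (v := fun y => y ^ α * h y) (by fun_prop)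
  unfold greenDensity
  fun_prop

lemma measurable_greenTrace (α T : ℝ) {h : ℝ → ℝ} (hh : Measurable h) :
    Measurable (greenTrace α T h) := by
  have h1 := measurable_greenDensity α T hh
  have h2 := measurable_fracR 1 T h1
  unfold greenTrace
  fun_prop

lemma abs_rpow_mul_le {α t r B : ℝ} {h : ℝ → ℝ} (hα : 0 < α) (hB : ∀ x, |h x| ≤ B) (hr : 0 < r)
    (hrt : r < t) : |r ^ α * h r| ≤ t ^ α * B := by
  rw [abs_mul, abs_of_pos (Real.rpow_pos_of_pos hr _)]
  exact mul_le_mul (Real.rpow_le_rpow hr.le hrt.le hα.le) (hB r) (abs_nonneg _)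
    (Real.rpow_nonneg (hr.trans hrt).le _)

/-- The weight y^α and the integration of order α each contribute a factor τ^α, exactly compensated
by τ^{-2α}. -/
lemma abs_greenDensity_le {α T τ B : ℝ} {h : ℝ → ℝ} (hα : 0 < α) (hB : ∀ x, |h x| ≤ B)
    (hτ : τ ∈ Ioo 0 T) : |greenDensity α T h τ| ≤ B / Real.Gamma (α + 1) := by
  have h1 : |fracL α T (fun y => y ^ α * h y) τ| ≤ τ ^ α * B * rlKernel (α + 1) τ :=
    abs_fracL_le hα hτ.2.le fun r hr hrt => abs_rpow_mul_le hα hB hr.1 hrt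
  have hp := Real.rpow_pos_of_pos hτ.1 α
  rw [rlKernel_of_pos _ hτ.1, show α + 1 - 1 = α by ring] at h1
  unfold greenDensity
  rw [abs_mul, abs_of_pos (Real.rpow_pos_of_pos hτ.1 _), show -(2 * α) = -α + -α by ring,
    Real.rpow_add hτ.1, Real.rpow_neg hτ.1.le]
  calc _ ≤ (τ ^ α)⁻¹ * (τ ^ α)⁻¹ * (τ ^ α * B * (τ ^ α / Real.Gamma (α + 1))) := by gcongr
    _ = _ := by field_simp

lemma integrableOn_greenDensity {α T B : ℝ} {h : ℝ → ℝ} (hα : 0 < α) (hh : Measurable h)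
    (hB : ∀ x, |h x| ≤ B) : IntegrableOn (greenDensity α T h) (Ioo 0 T) := by
  refine Measure.integrableOn_of_bounded (M := B / Real.Gamma (α + 1)) (by simp)
    (measurable_greenDensity α T hh).aestronglyMeasurable ?_
  filter_upwards [ae_restrict_mem measurableSet_Ioo] with s hs using abs_greenDensity_le hα hB hs

lemma sub_le_rpow_mul {α T s t : ℝ} (hα1 : α ≤ 1) (hs : 0 < s) (hst : s < t) (htT : t < T) :
    t - s ≤ T ^ (1 - α) * (t - s) ^ α := by
  have h0 : 0 < t - s := by linarith
  calc t - s = (t - s) ^ (1 - α) * (t - s) ^ α := by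
        rw [← Real.rpow_add h0]; simp
    _ ≤ _ := by
        gcongr
        linarith

/-- With p = τ^{2α} g, g the density, p is α-Hölder by `abs_fracL_sub_le`, with a constant of size
t^α. The difference is split so that g is taken only at s and the increment of p carries the weight
t^{1-2α}, which leaves the bounded factor t^{1-α}. -/
lemma abs_mul_greenDensity_sub_le {α T B s t : ℝ} {h : ℝ → ℝ} (hα : 1 / 2 < α) (hα1 : α ≤ 1)
    (hh : Measurable h) (hB : ∀ x, |h x| ≤ B) (hs : s ∈ Ioo 0 T) (ht : t ∈ Ioo 0 T) (hst : s < t) :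
    |s * greenDensity α T h s - t * greenDensity α T h t| ≤
      3 * T ^ (1 - α) * (B / Real.Gamma (α + 1)) * (t - s) ^ α := by
  have hα0 : 0 < α := by linarith
  have hB0 : 0 ≤ B := (abs_nonneg _).trans (hB 0)
  have hG := Real.Gamma_pos_of_pos (show 0 < α + 1 by linarith)
  have hs0 := hs.1
  have ht0 := ht.1
  have hT0 : 0 < T := ht0.trans ht.2
  have hts : 0 < t - s := by linarith
  set p := fracL α T (fun y => y ^ α * h y) with hp
  have hg : ∀ τ, 0 < τ → p τ = τ ^ (2 * α) * greenDensity α T h τ := fun τ hτ => by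
    rw [greenDensity, ← mul_assoc, ← Real.rpow_add hτ]
    simp [hp]
  have hg' : ∀ τ, 0 < τ → τ * greenDensity α T h τ = τ ^ (1 - 2 * α) * p τ := fun τ hτ => by
    rw [hg τ hτ, ← mul_assoc, ← Real.rpow_add hτ]
    simp
  have h1 : |p t - p s| ≤ 2 * (t ^ α * B) * rlKernel (α + 1) (t - s) :=
    abs_fracL_sub_le hα0 hα1 hs0.le hst ht.2.le (by positivity)
      (Measurable.aestronglyMeasurable (by fun_prop))
      fun r hr hrt => abs_rpow_mul_le hα0 hB hr.1 hrt
  rw [rlKernel_of_pos _ hts, show α + 1 - 1 = α by ring] at h1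
  have hgs := abs_greenDensity_le hα0 hB hs
  -- Since 0 < 2α - 1 ≤ 1, the number (s/t)^{2α-1} lies between s/t and 1, so the left side is at
  -- most s(1 - s/t) ≤ t - s.
  have hkey : |s - t ^ (1 - 2 * α) * s ^ (2 * α)| ≤ t - s := by
    have e1 : t ^ (1 - 2 * α) * s ^ (2 * α) = s * (s / t) ^ (2 * α - 1) := by
      rw [Real.div_rpow hs0.le ht0.le, show 2 * α - 1 = -(1 - 2 * α) by ring,
        Real.rpow_neg hs0.le, Real.rpow_neg ht0.le, show 2 * α = 1 - (1 - 2 * α) by ring,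
        Real.rpow_sub hs0, Real.rpow_one, show 1 - (1 - (1 - 2 * α)) = 1 - 2 * α by ring]
      field_simp
    have hq1 : s / t < 1 := by rwa [div_lt_one ht0]
    have hq0 : 0 < s / t := by positivity
    have h2 : s / t ≤ (s / t) ^ (2 * α - 1) := by
      simpa using Real.rpow_le_rpow_of_exponent_ge hq0 hq1.le (show 2 * α - 1 ≤ 1 by linarith)
    have h3 : (s / t) ^ (2 * α - 1) ≤ 1 := Real.rpow_le_one hq0.le hq1.le (by linarith)
    rw [e1, abs_of_nonneg (by nlinarith)]
    have h4 : s * (s / t) ≤ s * (s / t) ^ (2 * α - 1) := by gcongr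
    have h5 : s - s * (s / t) ≤ t - s := by
      have : s * (s / t) = s ^ 2 / t := by ring
      rw [this, sub_le_iff_le_add, ← sub_le_iff_le_add', le_div_iff₀ ht0]
      nlinarith [sq_nonneg (t - s)]
    linarith
  have e : s * greenDensity α T h s - t * greenDensity α T h t =
      (s - t ^ (1 - 2 * α) * s ^ (2 * α)) * greenDensity α T h s -
        t ^ (1 - 2 * α) * (p t - p s) := by
    rw [hg' t ht0, hg s hs0]
    ring
  have hsub := sub_le_rpow_mul hα1 hs0 hst ht.2
  have b1 : |(s - t ^ (1 - 2 * α) * s ^ (2 * α)) * greenDensity α T h s| ≤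
      T ^ (1 - α) * (t - s) ^ α * (B / Real.Gamma (α + 1)) := by
    rw [abs_mul]
    exact mul_le_mul (hkey.trans hsub) hgs (abs_nonneg _)
      (mul_nonneg (Real.rpow_nonneg hT0.le _) (Real.rpow_nonneg hts.le _))
  have b2 : |t ^ (1 - 2 * α) * (p t - p s)| ≤
      2 * T ^ (1 - α) * (B / Real.Gamma (α + 1)) * (t - s) ^ α := by
    rw [abs_mul, abs_of_pos (Real.rpow_pos_of_pos ht0 _)]
    calc t ^ (1 - 2 * α) * |p t - p s|
        ≤ t ^ (1 - 2 * α) * (2 * (t ^ α * B) * ((t - s) ^ α / Real.Gamma (α + 1))) := by gcongr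
      _ = 2 * (t ^ (1 - 2 * α) * t ^ α) * (B / Real.Gamma (α + 1)) * (t - s) ^ α := by ring
      _ = 2 * t ^ (1 - α) * (B / Real.Gamma (α + 1)) * (t - s) ^ α := by
          rw [← Real.rpow_add ht0]; congr 4; ring
      _ ≤ _ := by
          have : t ^ (1 - α) ≤ T ^ (1 - α) :=
            Real.rpow_le_rpow ht0.le ht.2.le (by linarith)
          gcongr
  rw [e]
  refine (abs_sub _ _).trans ?_
  linarith

lemma abs_greenTrace_le {α T B s : ℝ} {h : ℝ → ℝ} (hα : 1 / 2 < α) (hα1 : α ≤ 1)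
    (hB : ∀ x, |h x| ≤ B) (hs : s ∈ Ioo 0 T) :
    |greenTrace α T h s| ≤ 2 * T * (B / Real.Gamma (α + 1)) := by
  have hα0 : 0 < α := by linarith
  have hB0 : 0 ≤ B := (abs_nonneg _).trans (hB 0)
  have hG := Real.Gamma_pos_of_pos (show 0 < α + 1 by linarith)
  have hb0 : 0 ≤ B / Real.Gamma (α + 1) := by positivity
  have h1 := abs_greenDensity_le hα0 hB hs
  have h2 : |fracR 1 T (greenDensity α T h) s| ≤ B / Real.Gamma (α + 1) * rlKernel (1 + 1) (T - s) :=
    abs_fracR_le one_pos hs.1.le fun r hr _ => abs_greenDensity_le hα0 hB hr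
  rw [rlKernel_of_pos _ (by linarith [hs.2])] at h2
  norm_num at h2
  have h3 : |s * greenDensity α T h s| ≤ T * (B / Real.Gamma (α + 1)) := by
    rw [abs_mul, abs_of_pos hs.1]
    exact mul_le_mul hs.2.le h1 (abs_nonneg _) (hs.1.trans hs.2).le
  have h4 : |(2 * α - 1) * fracR 1 T (greenDensity α T h) s| ≤ T * (B / Real.Gamma (α + 1)) := by
    rw [abs_mul, abs_of_pos (by linarith)]
    calc _ ≤ 1 * (B / Real.Gamma (α + 1) * T) := by
          refine mul_le_mul (by linarith) (h2.trans ?_) (abs_nonneg _) zero_le_one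
          have := hs.1
          gcongr
          linarith
      _ = _ := by ring
  unfold greenTrace
  refine (abs_add_le _ _).trans ?_
  rw [abs_neg]
  linarith

lemma abs_greenTrace_sub_le {α T B s t : ℝ} {h : ℝ → ℝ} (hα : 1 / 2 < α) (hα1 : α ≤ 1)
    (hh : Measurable h) (hB : ∀ x, |h x| ≤ B) (hs : s ∈ Ioo 0 T) (ht : t ∈ Ioo 0 T) (hst : s < t) :
    |greenTrace α T h s - greenTrace α T h t| ≤
      4 * T ^ (1 - α) * (B / Real.Gamma (α + 1)) * (t - s) ^ α := by
  have hα0 : 0 < α := by linarith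
  have hB0 : 0 ≤ B := (abs_nonneg _).trans (hB 0)
  have hG := Real.Gamma_pos_of_pos (show 0 < α + 1 by linarith)
  have h1 := abs_mul_greenDensity_sub_le hα hα1 hh hB hs ht hst
  have hT0 : 0 ≤ T := (hs.1.trans hs.2).le
  have hi := (intervalIntegrable_iff_integrableOn_Ioo_of_le hT0).2
    (integrableOn_greenDensity (T := T) hα0 hh hB)
  have hi1 : IntervalIntegrable (greenDensity α T h) volume s t := hi.mono_set (by
    rw [uIcc_of_le hst.le, uIcc_of_le hT0]; exact Icc_subset_Icc hs.1.le ht.2.le)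
  have hi2 : IntervalIntegrable (greenDensity α T h) volume t T := hi.mono_set (by
    rw [uIcc_of_le ht.2.le, uIcc_of_le hT0]; exact Icc_subset_Icc_left ht.1.le)
  have e : fracR 1 T (greenDensity α T h) s - fracR 1 T (greenDensity α T h) t =
      ∫ r in s..t, greenDensity α T h r := by
    rw [fracR_one hs.1.le hs.2.le, fracR_one ht.1.le ht.2.le,
      ← intervalIntegral.integral_add_adjacent_intervals hi1 hi2]
    ring
  have h2 : |∫ r in s..t, greenDensity α T h r| ≤ B / Real.Gamma (α + 1) * (t - s) := by
    have := intervalIntegral.norm_integral_le_of_norm_le_const (a := s) (b := t)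
      (f := greenDensity α T h) (C := B / Real.Gamma (α + 1)) fun r hr => by
        rw [uIoc_of_le hst.le] at hr
        exact abs_greenDensity_le hα0 hB ⟨hs.1.trans hr.1, hr.2.trans_lt ht.2⟩
    rwa [abs_of_pos (by linarith : 0 < t - s)] at this
  have h3 := sub_le_rpow_mul hα1 hs.1 hst ht.2
  have h4 : |(2 * α - 1) * ∫ r in s..t, greenDensity α T h r| ≤
      T ^ (1 - α) * (B / Real.Gamma (α + 1)) * (t - s) ^ α := by
    rw [abs_mul, abs_of_pos (by linarith)]
    calc _ ≤ 1 * (B / Real.Gamma (α + 1) * (T ^ (1 - α) * (t - s) ^ α)) := by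
          refine mul_le_mul (by linarith) (h2.trans ?_) (abs_nonneg _) zero_le_one
          gcongr
      _ = _ := by ring
  have e2 : greenTrace α T h s - greenTrace α T h t =
      -(s * greenDensity α T h s - t * greenDensity α T h t) +
        (2 * α - 1) * ∫ r in s..t, greenDensity α T h r := by
    rw [← e]
    unfold greenTrace
    ring
  rw [e2]
  refine (abs_add_le _ _).trans ?_
  rw [abs_neg]
  linarith

/-- A function whose fractional integral of order `α - 1` is `greenTrace`. -/
noncomputable def greenPhi (α T : ℝ) (h : ℝ → ℝ) : ℝ → ℝ :=
  if α = 1 then greenTrace α T h else marchaud α T (greenTrace α T h) 0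

lemma measurable_greenPhi (α T : ℝ) {h : ℝ → ℝ} (hh : Measurable h) :
    Measurable (greenPhi α T h) := by
  unfold greenPhi
  split_ifs
  · exact measurable_greenTrace α T hh
  · exact measurable_marchaud α T (measurable_greenTrace α T hh) 0

/-- The constant in the bound for `greenPhi`. -/
noncomputable def greenConst (α T : ℝ) : ℝ :=
  2 * T / Real.Gamma (α + 1) + (Real.Gamma α)⁻¹ * (2 * T / Real.Gamma (α + 1) +
    4 * T ^ (1 - α) / Real.Gamma (α + 1) * T ^ α / (2 * α - 1))

lemma greenConst_nonneg {α T : ℝ} (hα : 1 / 2 < α) (hT : 0 < T) : 0 ≤ greenConst α T := by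
  have hG := Real.Gamma_pos_of_pos (show 0 < α + 1 by linarith)
  have hG' := Real.Gamma_pos_of_pos (show 0 < α by linarith)
  have : 0 < 2 * α - 1 := by linarith
  unfold greenConst
  positivity

lemma abs_greenPhi_le {α T B y : ℝ} {h : ℝ → ℝ} (hα : 1 / 2 < α) (hα1 : α ≤ 1)
    (hh : Measurable h) (hB : ∀ x, |h x| ≤ B) (hy : y ∈ Ioo 0 T) :
    |greenPhi α T h y| ≤ greenConst α T * B * (T - y) ^ (α - 1) := by
  have hB0 : 0 ≤ B := (abs_nonneg _).trans (hB 0)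
  have hG := Real.Gamma_pos_of_pos (show 0 < α + 1 by linarith)
  have hG' := Real.Gamma_pos_of_pos (show 0 < α by linarith)
  have hp : 0 < 2 * α - 1 := by linarith
  have hT : 0 < T := hy.1.trans hy.2
  have hTy : 0 < T - y := by linarith [hy.2]
  unfold greenPhi
  split_ifs with h1
  · subst h1
    refine (abs_greenTrace_le hα hα1 hB hy).trans ?_
    rw [sub_self, Real.rpow_zero, mul_one, greenConst, add_mul]
    have : 0 ≤ (Real.Gamma 1)⁻¹ * (2 * T / Real.Gamma (1 + 1) +
      4 * T ^ ((1 : ℝ) - 1) / Real.Gamma (1 + 1) * T ^ (1 : ℝ) / (2 * 1 - 1)) * B := by positivity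
    calc _ = 2 * T / Real.Gamma (1 + 1) * B := by ring
      _ ≤ _ := by linarith
  · have hlt : α < 1 := lt_of_le_of_ne hα1 h1
    refine (abs_marchaud_le hα hlt (fun x hx => abs_greenTrace_le hα hα1 hB hx)
      (fun x hx y hy hxy => abs_greenTrace_sub_le hα hα1 hh hB hx hy hxy) (by positivity)
      le_rfl hy).trans ?_
    refine mul_le_mul_of_nonneg_right ?_ (by positivity)
    unfold greenConst
    rw [add_mul]
    have : 0 ≤ 2 * T / Real.Gamma (α + 1) * B := by positivity
    refine le_trans (le_of_eq ?_) (le_add_of_nonneg_left this)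
    ring

lemma fracR_greenTrace_eq_integral {α T B x : ℝ} {h : ℝ → ℝ} (hα : 1 / 2 < α) (hα1 : α ≤ 1)
    (hh : Measurable h) (hB : ∀ x, |h x| ≤ B) (hx : x ∈ Ioo 0 T) :
    fracR α T (greenTrace α T h) x = ∫ y in x..T, greenPhi α T h y := by
  have hB0 : 0 ≤ B := (abs_nonneg _).trans (hB 0)
  have hG := Real.Gamma_pos_of_pos (show 0 < α + 1 by linarith)
  have hT : 0 < T := hx.1.trans hx.2
  unfold greenPhi
  split_ifs with h1
  · subst h1
    exact fracR_one hx.1.le hx.2.le _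
  · have hlt : α < 1 := lt_of_le_of_ne hα1 h1
    exact fracR_eq_integral_marchaud hα hlt (measurable_greenTrace α T hh)
      (fun x hx => abs_greenTrace_le hα hα1 hB hx)
      (fun x hx y hy hxy => abs_greenTrace_sub_le hα hα1 hh hB hx hy hxy) (by positivity) hx

lemma integrableOn_greenPhi {α T B : ℝ} {h : ℝ → ℝ} (hα : 1 / 2 < α) (hα1 : α ≤ 1)
    (hh : Measurable h) (hB : ∀ x, |h x| ≤ B) : IntegrableOn (greenPhi α T h) (Ioo 0 T) := by
  refine ((integrableOn_rpow_right (a := α) (T := T) (x := 0) (by linarith)).const_mul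
    (greenConst α T * B)).mono' (measurable_greenPhi α T hh).aestronglyMeasurable ?_
  filter_upwards [ae_restrict_mem measurableSet_Ioo] with y hy
  exact abs_greenPhi_le hα hα1 hh hB hy

lemma integrableOn_rlKernel_right_mul_of_bdd {a T t M : ℝ} (ha : 0 < a) (ht : 0 ≤ t) {v : ℝ → ℝ}
    (hvm : AEStronglyMeasurable v (volume.restrict (Ioo 0 T)))
    (hv : ∀ r ∈ Ioo 0 T, |v r| ≤ M) :
    IntegrableOn (fun s => rlKernel a (s - t) * v s) (Ioo 0 T) := by
  have h := integrableOn_rlKernel_mul_of_bdd (T := T) (t := T - t) (M := M) ha (by linarith)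
    (aestronglyMeasurable_reflect hvm) fun r hr _ => hv _ ⟨by linarith [hr.2], by linarith [hr.1]⟩
  rw [← integrableOn_Ioo_reflect]
  simpa only [show ∀ s, T - s - t = T - t - s from fun s => by ring] using h

/-- Write s = x + (s - x) and absorb s - x into the kernel, (s - x) k_α(s - x) = α k_{α+1}(s - x);
the coefficient of order α + 1 becomes (2α - 1) - α = -(1 - α). -/
lemma fracR_greenTrace {α T B x : ℝ} {h : ℝ → ℝ} (hα : 1 / 2 < α)
    (hh : Measurable h) (hB : ∀ x, |h x| ≤ B) (hx : x ∈ Ioo 0 T) :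
    fracR α T (greenTrace α T h) x = -(x * fracR α T (greenDensity α T h) x) -
      (1 - α) * fracR (α + 1) T (greenDensity α T h) x := by
  have hα0 : 0 < α := by linarith
  have hgm := (measurable_greenDensity α T hh).aestronglyMeasurable
    (μ := volume.restrict (Ioo 0 T))
  have hgb : ∀ r ∈ Ioo 0 T, |greenDensity α T h r| ≤ B / Real.Gamma (α + 1) :=
    fun r hr => abs_greenDensity_le hα0 hB hr
  have i1 := integrableOn_rlKernel_right_mul_of_bdd hα0 hx.1.le hgm hgb
  have i2 := integrableOn_rlKernel_right_mul_of_bdd (a := α + 1) (by linarith) hx.1.le hgm hgb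
  obtain ⟨i3, e3⟩ := fracR_fracR (b := 1) hα0 one_pos hx.1.le hgm i2
  rw [fracR, show (fun s => rlKernel α (s - x) * greenTrace α T h s) = fun s =>
      (2 * α - 1) * (rlKernel α (s - x) * fracR 1 T (greenDensity α T h) s) -
      (x * (rlKernel α (s - x) * greenDensity α T h s) +
        α * (rlKernel (α + 1) (s - x) * greenDensity α T h s)) from ?_,
    integral_sub (g := fun s => x * (rlKernel α (s - x) * greenDensity α T h s) +
        α * (rlKernel (α + 1) (s - x) * greenDensity α T h s))
      (i3.const_mul _) ((i1.const_mul _).add (i2.const_mul _)),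
    integral_add (i1.const_mul _) (i2.const_mul _), integral_const_mul, integral_const_mul,
    integral_const_mul]
  · change (2 * α - 1) * fracR α T (fracR 1 T (greenDensity α T h)) x -
      (x * fracR α T (greenDensity α T h) x + α * fracR (α + 1) T (greenDensity α T h) x) = _
    rw [e3]
    ring
  · ext s
    have := mul_rlKernel hα0 (s - x)
    unfold greenTrace
    linear_combination -greenDensity α T h s * this

/-! ### The derivative of the Green solution. -/

lemma integral_eq_sub_of_absolutelyContinuous {F F' : ℝ → ℝ} {a b : ℝ} (hab : a ≤ b)
    (hF : AbsolutelyContinuousOnInterval F a b)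
    (h : ∀ᵐ x, x ∈ Ioo a b → HasDerivAt F (F' x) x) : ∫ x in a..b, F' x = F b - F a := by
  rw [← hF.integral_deriv_eq_sub, intervalIntegral.integral_of_le hab,
    intervalIntegral.integral_of_le hab, integral_Ioc_eq_integral_Ioo, integral_Ioc_eq_integral_Ioo]
  refine integral_congr_ae ((ae_restrict_iff' measurableSet_Ioo).2 (h.mono fun x hx hxm => ?_))
  exact (hx hxm).deriv.symm

lemma intervalIntegrable_of_integrableOn_Ioo {T x y : ℝ} {w : ℝ → ℝ} (hw : IntegrableOn w (Ioo 0 T))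
    (hx : x ∈ Icc 0 T) (hy : y ∈ Icc 0 T) : IntervalIntegrable w volume x y := by
  have hT : 0 ≤ T := hx.1.trans hx.2
  refine ((intervalIntegrable_iff_integrableOn_Ioo_of_le hT).2 hw).mono_set ?_
  rw [uIcc_of_le hT]
  exact uIcc_subset_Icc hx hy

/-- The derivative of `greenSolution` on `(0, T)`. -/
noncomputable def greenDeriv (α T : ℝ) (h : ℝ → ℝ) (y : ℝ) : ℝ := y ^ (α - 1) * greenPhi α T h y

lemma measurable_greenDeriv (α T : ℝ) {h : ℝ → ℝ} (hh : Measurable h) :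
    Measurable (greenDeriv α T h) := by
  have := measurable_greenPhi α T hh
  unfold greenDeriv
  fun_prop

lemma abs_greenDeriv_le {α T B y : ℝ} {h : ℝ → ℝ} (hα : 1 / 2 < α) (hα1 : α ≤ 1)
    (hh : Measurable h) (hB : ∀ x, |h x| ≤ B) (hy : y ∈ Ioo 0 T) :
    |greenDeriv α T h y| ≤ greenConst α T * B * (y ^ (α - 1) * (T - y) ^ (α - 1)) := by
  have hp := Real.rpow_pos_of_pos hy.1 (α - 1)
  rw [greenDeriv, abs_mul, abs_of_pos hp]
  calc _ ≤ y ^ (α - 1) * (greenConst α T * B * (T - y) ^ (α - 1)) := by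
        gcongr
        exact abs_greenPhi_le hα hα1 hh hB hy
    _ = _ := by ring

lemma integrableOn_rpow_mul_rpow {a T : ℝ} (ha : 0 < a) :
    IntegrableOn (fun y => y ^ (a - 1) * (T - y) ^ (a - 1)) (Ioo 0 T) := by
  have h := ((rlKernel_conv_zero ha ha T).1.integrableOn (s := Ioo 0 T)).const_mul
    (Real.Gamma a ^ 2)
  have hG := Real.Gamma_pos_of_pos ha
  refine IntegrableOn.congr_fun (f := fun y => Real.Gamma a ^ 2 *
    (rlKernel a (T - y) * rlKernel a y)) h (fun y hy => ?_) measurableSet_Ioo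
  simp only
  rw [rlKernel_of_pos _ hy.1, rlKernel_of_pos _ (by linarith [hy.2])]
  field_simp

lemma integrableOn_greenDeriv {α T B : ℝ} {h : ℝ → ℝ} (hα : 1 / 2 < α) (hα1 : α ≤ 1)
    (hh : Measurable h) (hB : ∀ x, |h x| ≤ B) : IntegrableOn (greenDeriv α T h) (Ioo 0 T) := by
  refine ((integrableOn_rpow_mul_rpow (a := α) (T := T) (by linarith)).const_mul
    (greenConst α T * B)).mono' (measurable_greenDeriv α T hh).aestronglyMeasurable ?_
  filter_upwards [ae_restrict_mem measurableSet_Ioo] with y hy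
  exact abs_greenDeriv_le hα hα1 hh hB hy

/-- With w = I₋^α g, g the density, `fracR_greenTrace` gives (x w)' = φ + (1 - α) w almost
everywhere, φ being `greenPhi`. Applying the product rule to x^α w = x^{α-1} · (x w) cancels the
terms in w and leaves x^{α-1} φ. On [x, T] the factor x^{α-1} is smooth. -/
lemma integral_greenDeriv_right {α T B x : ℝ} {h : ℝ → ℝ} (hα : 1 / 2 < α) (hα1 : α ≤ 1)
    (hh : Measurable h) (hB : ∀ x, |h x| ≤ B) (hx : x ∈ Ioo 0 T) :
    ∫ y in x..T, greenDeriv α T h y = -greenSolution α T h x := by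
  have hα0 : 0 < α := by linarith
  have hx0 := hx.1
  have hT : 0 ≤ T := (hx.1.trans hx.2).le
  set g := greenDensity α T h with hg
  have hgi := integrableOn_greenDensity (T := T) hα0 hh hB
  have hwi := integrableOn_fracR hα0 hgi
  set w := fracR α T g with hw
  set ξ : ℝ → ℝ := fun y => greenPhi α T h y + (1 - α) * w y with hξ
  have hφi := integrableOn_greenPhi (T := T) hα hα1 hh hB
  have hξi : IntegrableOn ξ (Ioo 0 T) := hφi.add (hwi.const_mul _)
  have hgb : ∀ r ∈ Ioo 0 T, |g r| ≤ B / Real.Gamma (α + 1) :=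
    fun r hr => abs_greenDensity_le hα0 hB hr
  have hE : ∀ y ∈ Ioo 0 T, ∫ z in y..T, ξ z = -(y * w y) := by
    intro y hy
    have hyI : y ∈ Icc 0 T := Ioo_subset_Icc_self hy
    have hTI : T ∈ Icc 0 T := ⟨hT, le_rfl⟩
    have e1 := fracR_greenTrace hα hh hB hy
    rw [fracR_greenTrace_eq_integral hα hα1 hh hB hy] at e1
    have e2 := (fracR_fracR (b := α) one_pos hα0 hy.1.le hgi.aestronglyMeasurable
      (integrableOn_rlKernel_right_mul_of_bdd (a := 1 + α) (by linarith) hy.1.le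
        hgi.aestronglyMeasurable hgb)).2
    rw [fracR_one hy.1.le hy.2.le, add_comm 1 α] at e2
    simp only [hξ]
    rw [intervalIntegral.integral_add (intervalIntegrable_of_integrableOn_Ioo hφi hyI hTI)
      ((intervalIntegrable_of_integrableOn_Ioo hwi hyI hTI).const_mul _),
      intervalIntegral.integral_const_mul, e1, hw, e2]
    ring
  have hξI : IntervalIntegrable ξ volume x T :=
    intervalIntegrable_of_integrableOn_Ioo hξi (Ioo_subset_Icc_self hx) ⟨hT, le_rfl⟩
  have hac1 : AbsolutelyContinuousOnInterval (fun y => ∫ z in T..y, ξ z) x T :=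
    hξI.absolutelyContinuousOnInterval_intervalIntegral right_mem_uIcc
  have hac2 : AbsolutelyContinuousOnInterval (fun y : ℝ => y ^ (α - 1)) x T := by
    refine ContDiffOn.absolutelyContinuousOnInterval fun y hy => ?_
    rw [uIcc_of_le hx.2.le] at hy
    exact (Real.contDiffAt_rpow_const_of_ne (hx.1.trans_le hy.1).ne').contDiffWithinAt
  have hmain := integral_eq_sub_of_absolutelyContinuous (F' := greenDeriv α T h) hx.2.le
    (hac2.fun_mul hac1) (by
      filter_upwards [hξI.ae_hasDerivAt_integral] with y hy hyx
      have hy0 : 0 < y := hx.1.trans hyx.1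
      have hyu : y ∈ uIcc x T := by rw [uIcc_of_le hx.2.le]; exact Ioo_subset_Icc_self hyx
      have h1 := hy hyu T right_mem_uIcc
      have h2 := (Real.hasDerivAt_rpow_const (p := α - 1) (Or.inl hy0.ne')).mul h1
      refine h2.congr_deriv ?_
      have h3 := hE y ⟨hy0, hyx.2⟩
      rw [intervalIntegral.integral_symm, neg_inj] at h3
      rw [h3]
      simp only [hξ, greenDeriv]
      have h4 : y ^ (α - 1) = y ^ (α - 1 - 1) * y := by
        rw [← Real.rpow_add_one hy0.ne']; ring_nf
      rw [h4]
      ring)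
  rw [hmain, intervalIntegral.integral_same, mul_zero, zero_sub, intervalIntegral.integral_symm,
    hE x hx, greenSolution, ← hg, ← hw]
  have h4 : x ^ α = x ^ (α - 1) * x := by
    rw [← Real.rpow_add_one hx.1.ne']; ring_nf
  rw [h4]
  ring

lemma abs_greenSolution_le {α T B x : ℝ} {h : ℝ → ℝ} (hα : 0 < α) (hB : ∀ x, |h x| ≤ B)
    (hx : x ∈ Ioo 0 T) :
    |greenSolution α T h x| ≤ x ^ α * (B / Real.Gamma (α + 1) * rlKernel (α + 1) T) := by
  have hB0 : 0 ≤ B := (abs_nonneg _).trans (hB 0)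
  have hG := Real.Gamma_pos_of_pos (show 0 < α + 1 by linarith)
  have hp := Real.rpow_pos_of_pos hx.1 α
  rw [greenSolution, abs_mul, abs_of_pos hp]
  have h1 : |fracR α T (greenDensity α T h) x| ≤ B / Real.Gamma (α + 1) * rlKernel (α + 1) (T - x) :=
    abs_fracR_le hα hx.1.le fun r hr _ => abs_greenDensity_le hα hB hr
  gcongr
  refine h1.trans ?_
  gcongr
  exact rlKernel_mono (by linarith) (by linarith [hx.1])

lemma greenSolution_zero {α T : ℝ} (hα : 0 < α) (h : ℝ → ℝ) : greenSolution α T h 0 = 0 := by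
  rw [greenSolution, Real.zero_rpow hα.ne', zero_mul]

lemma greenSolution_right {α T : ℝ} (h : ℝ → ℝ) : greenSolution α T h T = 0 := by
  rw [greenSolution, fracR, setIntegral_congr_fun (g := fun _ => (0 : ℝ)) measurableSet_Ioo]
  · simp
  · intro s hs
    simp only
    rw [rlKernel_of_nonpos _ (by linarith [hs.2]), zero_mul]

/-- The previous formula integrates from T and needs x > 0. Since the solution is O(x^α) at 0, the
total integral of the derivative is 0, and the base point can be moved to 0. -/
lemma greenSolution_eq_integral {α T B : ℝ} {h : ℝ → ℝ} (hα : 1 / 2 < α) (hα1 : α ≤ 1) (hT : 0 < T)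
    (hh : Measurable h) (hB : ∀ x, |h x| ≤ B) {x : ℝ} (hx : x ∈ Icc 0 T) :
    greenSolution α T h x = ∫ y in (0 : ℝ)..x, greenDeriv α T h y := by
  have hα0 : 0 < α := by linarith
  have hvi := integrableOn_greenDeriv (T := T) hα hα1 hh hB
  have hVI : IntervalIntegrable (greenDeriv α T h) volume 0 T :=
    intervalIntegrable_of_integrableOn_Ioo hvi ⟨le_rfl, hT.le⟩ ⟨hT.le, le_rfl⟩
  have hc : ContinuousOn (fun y => ∫ z in T..y, greenDeriv α T h z) (uIcc 0 T) :=
    (hVI.absolutelyContinuousOnInterval_intervalIntegral right_mem_uIcc).continuousOn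
  have h0 : ∫ y in (0 : ℝ)..T, greenDeriv α T h y = 0 := by
    have t1 : Tendsto (fun y => ∫ z in T..y, greenDeriv α T h z) (𝓝[>] 0)
        (𝓝 (∫ z in T..0, greenDeriv α T h z)) :=
      (hc 0 left_mem_uIcc).mono_left (by
        rw [uIcc_of_le hT.le]
        exact (nhdsWithin_mono _ Ioo_subset_Icc_self).trans' (nhdsWithin_Ioo_eq_nhdsGT hT).ge)
    have t2 : Tendsto (greenSolution α T h) (𝓝[>] 0) (𝓝 0) := by
      have hpow : Tendsto (fun x : ℝ => x ^ α * (B / Real.Gamma (α + 1) * rlKernel (α + 1) T))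
          (𝓝[>] 0) (𝓝 0) := by
        have h1 : Tendsto (fun x : ℝ => x ^ α) (𝓝[>] 0) (𝓝 (0 ^ α)) :=
          (Real.continuousAt_rpow_const 0 α (Or.inr hα0.le)).tendsto.mono_left nhdsWithin_le_nhds
        have := h1.mul_const (B / Real.Gamma (α + 1) * rlKernel (α + 1) T)
        rwa [Real.zero_rpow hα0.ne', zero_mul] at this
      refine squeeze_zero_norm' ?_ hpow
      filter_upwards [Ioo_mem_nhdsGT hT] with y hy using abs_greenSolution_le hα0 hB hy
    have t3 : Tendsto (fun y => ∫ z in T..y, greenDeriv α T h z) (𝓝[>] 0) (𝓝 0) := by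
      refine t2.congr' ?_
      filter_upwards [Ioo_mem_nhdsGT hT] with y hy
      rw [intervalIntegral.integral_symm, integral_greenDeriv_right hα hα1 hh hB hy, neg_neg]
    rw [intervalIntegral.integral_symm, tendsto_nhds_unique t1 t3, neg_zero]
  rcases eq_or_lt_of_le hx.1 with rfl | hx0
  · rw [greenSolution_zero hα0, intervalIntegral.integral_same]
  rcases eq_or_lt_of_le hx.2 with rfl | hxT
  · rw [greenSolution_right, h0]
  have h1 := intervalIntegral.integral_add_adjacent_intervals
    (intervalIntegrable_of_integrableOn_Ioo hvi ⟨le_rfl, hT.le⟩ hx)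
    (intervalIntegrable_of_integrableOn_Ioo hvi hx ⟨hT.le, le_rfl⟩)
  rw [h0, integral_greenDeriv_right hα hα1 hh hB ⟨hx0, hxT⟩] at h1
  linarith

/-- Both sides have the same right fractional integral of order α, so injectivity applies. -/
lemma fracR_greenPhi_ae {α T B : ℝ} {h : ℝ → ℝ} (hα : 1 / 2 < α) (hα1 : α < 1) (hT : 0 < T)
    (hh : Measurable h) (hB : ∀ x, |h x| ≤ B) :
    fracR (1 - α) T (greenPhi α T h) =ᵐ[volume.restrict (Ioo 0 T)] greenTrace α T h := by
  have hα0 : 0 < α := by linarith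
  have hφi := integrableOn_greenPhi (T := T) hα hα1.le hh hB
  have hki : IntegrableOn (greenTrace α T h) (Ioo 0 T) := by
    refine Measure.integrableOn_of_bounded (M := 2 * T * (B / Real.Gamma (α + 1))) (by simp)
      (measurable_greenTrace α T hh).aestronglyMeasurable ?_
    filter_upwards [ae_restrict_mem measurableSet_Ioo] with s hs
      using abs_greenTrace_le hα hα1.le hB hs
  refine fracR_injective hT.le hα0 hα1 (integrableOn_fracR (by linarith) hφi) hki ?_
  filter_upwards [ae_restrict_mem measurableSet_Ioo] with t ht
  have hi : IntegrableOn (fun r => rlKernel 1 (r - t) * greenPhi α T h r) (Ioo 0 T) := by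
    rw [integrableOn_rlKernel_right_iff ht.1.le ht.2.le one_pos]
    simpa using intervalIntegrable_of_integrableOn_Ioo hφi (Ioo_subset_Icc_self ht)
      ⟨hT.le, le_rfl⟩
  have e := (fracR_fracR (a := α) (b := 1 - α) hα0 (by linarith) ht.1.le hφi.aestronglyMeasurable
    (by rw [show α + (1 - α) = 1 by ring]; exact hi)).2
  rw [e, show α + (1 - α) = 1 by ring, fracR_one ht.1.le ht.2.le,
    fracR_greenTrace_eq_integral hα hα1.le hh hB ht]

/-! ### The flux of the Green solution. -/

/-- In the variable σ = y/τ all powers of τ cancel: the density is an average of h(τσ) against (1 -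
σ)^{α-1} σ^α. Integrating in τ under this average replaces h(τσ) by σ^{-1} ∫₀^{tσ} h. -/
lemma integral_greenDensity {α T B t : ℝ} {h : ℝ → ℝ} (hα : 0 < α) (hh : Measurable h)
    (hB : ∀ x, |h x| ≤ B) (ht : t ∈ Ioo 0 T) :
    t ^ (2 * α - 1) * ∫ s in (0 : ℝ)..t, greenDensity α T h s =
      fracL α T (fun x => x ^ (α - 1) * ∫ y in (0 : ℝ)..x, h y) t := by
  have ht0 := ht.1
  have e1 : ∀ τ ∈ Ioo 0 t, greenDensity α T h τ =
      (Real.Gamma α)⁻¹ * ∫ σ in Ioo 0 1, (1 - σ) ^ (α - 1) * σ ^ α * h (τ * σ) := by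
    intro τ hτ
    rw [greenDensity, fracL_scale hτ.1 (hτ.2.le.trans ht.2.le) hα,
      intervalIntegral.integral_of_le zero_le_one, integral_Ioc_eq_integral_Ioo]
    have : ∫ σ in Ioo (0 : ℝ) 1, (1 - σ) ^ (α - 1) * ((τ * σ) ^ α * h (τ * σ)) =
        τ ^ α * ∫ σ in Ioo 0 1, (1 - σ) ^ (α - 1) * σ ^ α * h (τ * σ) := by
      rw [← integral_const_mul]
      refine setIntegral_congr_fun measurableSet_Ioo fun σ hσ => ?_
      rw [Real.mul_rpow hτ.1.le hσ.1.le]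
      ring
    have hp := (Real.rpow_pos_of_pos hτ.1 α).ne'
    rw [this, show -(2 * α) = -α + -α by ring, Real.rpow_add hτ.1, Real.rpow_neg hτ.1.le]
    generalize ∫ σ in Ioo 0 1, (1 - σ) ^ (α - 1) * σ ^ α * h (τ * σ) = I
    field_simp
  have hI : IntegrableOn (fun σ : ℝ => (1 - σ) ^ (α - 1) * σ ^ α) (Ioo 0 1) := by
    have := (integral_beta (a := α + 1) (b := α) (by linarith) hα).1
    simp only [add_sub_cancel_right] at this
    exact this.congr_fun (fun x _ => mul_comm _ _) measurableSet_Ioo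
  have hF : Integrable (fun z : ℝ × ℝ => (1 - z.2) ^ (α - 1) * z.2 ^ α * h (z.1 * z.2))
      ((volume.restrict (Ioo 0 t)).prod (volume.restrict (Ioo 0 1))) :=
    (hI.comp_snd (μ := volume.restrict (Ioo 0 t))).mul_bdd (c := B)
      (Measurable.aestronglyMeasurable (by fun_prop)) (Eventually.of_forall fun z => hB _)
  have hsw := integral_integral_swap
    (f := fun τ σ => (1 - σ) ^ (α - 1) * σ ^ α * h (τ * σ)) hF
  have e2 : ∫ s in (0 : ℝ)..t, greenDensity α T h s = (Real.Gamma α)⁻¹ *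
      ∫ σ in Ioo (0 : ℝ) 1, (1 - σ) ^ (α - 1) * (σ ^ (α - 1) * ∫ y in (0 : ℝ)..(t * σ), h y) := by
    rw [intervalIntegral.integral_of_le ht0.le, integral_Ioc_eq_integral_Ioo,
      setIntegral_congr_fun measurableSet_Ioo e1, integral_const_mul, hsw]
    congr 1
    refine setIntegral_congr_fun measurableSet_Ioo fun σ hσ => ?_
    rw [integral_const_mul, ← integral_Ioc_eq_integral_Ioo, ← intervalIntegral.integral_of_le ht0.le]
    have h1 := intervalIntegral.integral_comp_mul_right (a := 0) (b := t) h hσ.1.ne'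
    rw [h1, zero_mul, smul_eq_mul, Real.rpow_sub_one hσ.1.ne']
    field_simp
  rw [e2, fracL_scale ht0 ht.2.le hα, intervalIntegral.integral_of_le zero_le_one,
    integral_Ioc_eq_integral_Ioo]
  have e3 : ∫ σ in Ioo (0 : ℝ) 1, (1 - σ) ^ (α - 1) *
        ((t * σ) ^ (α - 1) * ∫ y in (0 : ℝ)..(t * σ), h y) =
      t ^ (α - 1) * ∫ σ in Ioo (0 : ℝ) 1, (1 - σ) ^ (α - 1) *
        (σ ^ (α - 1) * ∫ y in (0 : ℝ)..(t * σ), h y) := by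
    rw [← integral_const_mul]
    refine setIntegral_congr_fun measurableSet_Ioo fun σ hσ => ?_
    rw [Real.mul_rpow ht0.le hσ.1.le]
    ring
  rw [e3, show 2 * α - 1 = α + (α - 1) by ring, Real.rpow_add ht0]
  ring

/-- The derivative of `s ↦ s^{2α-1} ∫₀ˢ greenDensity`. -/
noncomputable def greenWeight (α T : ℝ) (h : ℝ → ℝ) (s : ℝ) : ℝ :=
  s ^ (2 * α - 1) * greenDensity α T h s +
    (2 * α - 1) * s ^ (2 * α - 2) * ∫ r in (0 : ℝ)..s, greenDensity α T h r

lemma abs_integral_greenDensity_le {α T B s : ℝ} {h : ℝ → ℝ} (hα : 0 < α)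
    (hB : ∀ x, |h x| ≤ B) (hs : s ∈ Ioo 0 T) :
    |∫ r in (0 : ℝ)..s, greenDensity α T h r| ≤ B / Real.Gamma (α + 1) * s := by
  have := intervalIntegral.norm_integral_le_of_norm_le_const (a := 0) (b := s)
    (f := greenDensity α T h) (C := B / Real.Gamma (α + 1)) fun r hr => by
      rw [uIoc_of_le hs.1.le] at hr
      exact abs_greenDensity_le hα hB ⟨hr.1, hr.2.trans_lt hs.2⟩
  rwa [sub_zero, abs_of_pos hs.1] at this

lemma abs_greenWeight_le {α T B s : ℝ} {h : ℝ → ℝ} (hα : 1 / 2 < α) (hα1 : α ≤ 1)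
    (hB : ∀ x, |h x| ≤ B) (hs : s ∈ Ioo 0 T) :
    |greenWeight α T h s| ≤ 2 * T ^ (2 * α - 1) * (B / Real.Gamma (α + 1)) := by
  have hα0 : 0 < α := by linarith
  have hs0 := hs.1
  have h1 := abs_greenDensity_le hα0 hB hs
  have h2 := abs_integral_greenDensity_le hα0 hB hs
  have hB0 : 0 ≤ B := (abs_nonneg _).trans (hB 0)
  have hG := Real.Gamma_pos_of_pos (show 0 < α + 1 by linarith)
  have h3 : s ^ (2 * α - 1) ≤ T ^ (2 * α - 1) :=
    Real.rpow_le_rpow hs.1.le hs.2.le (by linarith)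
  have h4 : s ^ (2 * α - 2) * s = s ^ (2 * α - 1) := by
    rw [← Real.rpow_add_one hs0.ne']; ring_nf
  have b1 : |s ^ (2 * α - 1) * greenDensity α T h s| ≤
      T ^ (2 * α - 1) * (B / Real.Gamma (α + 1)) := by
    rw [abs_mul, abs_of_pos (Real.rpow_pos_of_pos hs0 _)]
    exact mul_le_mul h3 h1 (abs_nonneg _) ((Real.rpow_nonneg hs0.le _).trans h3)
  have b2 : |(2 * α - 1) * s ^ (2 * α - 2) * ∫ r in (0 : ℝ)..s, greenDensity α T h r| ≤
      T ^ (2 * α - 1) * (B / Real.Gamma (α + 1)) := by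
    rw [abs_mul, abs_mul, abs_of_pos (Real.rpow_pos_of_pos hs0 _),
      abs_of_pos (by linarith : 0 < 2 * α - 1)]
    calc _ ≤ 1 * s ^ (2 * α - 2) * (B / Real.Gamma (α + 1) * s) := by
          gcongr
          linarith
      _ = (s ^ (2 * α - 2) * s) * (B / Real.Gamma (α + 1)) := by ring
      _ ≤ _ := by rw [h4]; gcongr
  unfold greenWeight
  exact (abs_add_le _ _).trans (by linarith)

lemma continuousOn_integral_Ioo {T : ℝ} {w : ℝ → ℝ} (hT : 0 ≤ T) (hw : IntegrableOn w (Ioo 0 T)) :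
    ContinuousOn (fun s => ∫ r in (0 : ℝ)..s, w r) (Icc 0 T) := by
  have := ((intervalIntegrable_of_integrableOn_Ioo hw ⟨le_rfl, hT⟩
    ⟨hT, le_rfl⟩).absolutelyContinuousOnInterval_intervalIntegral left_mem_uIcc).continuousOn
  rwa [uIcc_of_le hT] at this

lemma aestronglyMeasurable_greenWeight {α T B : ℝ} {h : ℝ → ℝ} (hα : 0 < α)
    (hh : Measurable h) (hB : ∀ x, |h x| ≤ B) :
    AEStronglyMeasurable (greenWeight α T h) (volume.restrict (Ioo 0 T)) := by
  rcases le_or_gt T 0 with hT | hT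
  · simp [Ioo_eq_empty (not_lt.2 hT)]
  have h1 := measurable_greenDensity α T hh
  have h2 : AEStronglyMeasurable (fun s => ∫ r in (0 : ℝ)..s, greenDensity α T h r)
      (volume.restrict (Ioo 0 T)) :=
    ((continuousOn_integral_Ioo hT.le (integrableOn_greenDensity hα hh hB)).mono
      Ioo_subset_Icc_self).aestronglyMeasurable measurableSet_Ioo
  unfold greenWeight
  exact (Measurable.aestronglyMeasurable (by fun_prop)).add
    ((Measurable.aestronglyMeasurable (by fun_prop)).mul h2)

lemma integrableOn_greenWeight {α T B : ℝ} {h : ℝ → ℝ} (hα : 1 / 2 < α) (hα1 : α ≤ 1)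
    (hh : Measurable h) (hB : ∀ x, |h x| ≤ B) : IntegrableOn (greenWeight α T h) (Ioo 0 T) := by
  refine Integrable.of_bound (aestronglyMeasurable_greenWeight (by linarith) hh hB)
    (2 * T ^ (2 * α - 1) * (B / Real.Gamma (α + 1))) ?_
  filter_upwards [ae_restrict_mem measurableSet_Ioo] with s hs using abs_greenWeight_le hα hα1 hB hs

lemma absolutelyContinuous_rpow {c a b : ℝ} (hc : 0 < c) :
    AbsolutelyContinuousOnInterval (fun s : ℝ => s ^ c) a b := by
  have hi : ∀ x y : ℝ, IntervalIntegrable (fun r : ℝ => c * r ^ (c - 1)) volume x y := fun x y =>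
    (intervalIntegral.intervalIntegrable_rpow' (by linarith)).const_mul c
  have e : (fun s : ℝ => s ^ c) = fun s => (∫ r in a..s, c * r ^ (c - 1)) + a ^ c := by
    ext s
    rw [intervalIntegral.integral_const_mul, integral_rpow (Or.inl (by linarith)), sub_add_cancel]
    field_simp
    ring
  rw [e]
  refine AbsolutelyContinuousOnInterval.fun_add
    ((hi a b).absolutelyContinuousOnInterval_intervalIntegral left_mem_uIcc) ?_
  exact ContDiffOn.absolutelyContinuousOnInterval contDiffOn_const

lemma integral_greenWeight {α T B t : ℝ} {h : ℝ → ℝ} (hα : 1 / 2 < α)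
    (hh : Measurable h) (hB : ∀ x, |h x| ≤ B) (ht : t ∈ Ioo 0 T) :
    ∫ s in (0 : ℝ)..t, greenWeight α T h s =
      t ^ (2 * α - 1) * ∫ s in (0 : ℝ)..t, greenDensity α T h s := by
  have hα0 : 0 < α := by linarith
  have hgI : IntervalIntegrable (greenDensity α T h) volume 0 t :=
    intervalIntegrable_of_integrableOn_Ioo (integrableOn_greenDensity (T := T) hα0 hh hB)
      ⟨le_rfl, (ht.1.trans ht.2).le⟩ (Ioo_subset_Icc_self ht)
  have hac := (absolutelyContinuous_rpow (a := 0) (b := t) (show 0 < 2 * α - 1 by linarith)).fun_mul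
    (hgI.absolutelyContinuousOnInterval_intervalIntegral left_mem_uIcc)
  rw [integral_eq_sub_of_absolutelyContinuous ht.1.le hac, intervalIntegral.integral_same, mul_zero,
    sub_zero]
  filter_upwards [hgI.ae_hasDerivAt_integral] with s hs hst
  have h1 := hs (by rw [uIcc_of_le ht.1.le]; exact Ioo_subset_Icc_self hst) 0 left_mem_uIcc
  have h2 := (Real.hasDerivAt_rpow_const (p := 2 * α - 1) (Or.inl hst.1.ne')).mul h1
  refine h2.congr_deriv ?_
  rw [greenWeight, show 2 * α - 1 - 1 = 2 * α - 2 by ring]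
  ring

lemma continuousOn_of_abs_sub_le {T C a : ℝ} (ha : 0 < a) {w : ℝ → ℝ}
    (h : ∀ s ∈ Ioo 0 T, ∀ t ∈ Ioo 0 T, s < t → |w s - w t| ≤ C * (t - s) ^ a) :
    ContinuousOn w (Ioo 0 T) := by
  intro x hx
  have h2 : ∀ y ∈ Ioo 0 T, |w y - w x| ≤ C * |y - x| ^ a := by
    intro y hy
    rcases lt_trichotomy y x with hyx | rfl | hyx
    · rw [abs_sub_comm y, abs_of_pos (by linarith : 0 < x - y)]
      exact h y hy x hx hyx
    · simp [Real.zero_rpow ha.ne']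
    · rw [abs_sub_comm (w y), abs_of_pos (by linarith : 0 < y - x)]
      exact h x hx y hy hyx
  rw [ContinuousWithinAt, tendsto_iff_norm_sub_tendsto_zero]
  have h3 : Tendsto (fun y => C * |y - x| ^ a) (𝓝[Ioo 0 T] x) (𝓝 0) := by
    have hc : ContinuousAt (fun y => C * |y - x| ^ a) x := by
      refine continuousAt_const.mul (ContinuousAt.rpow_const (by fun_prop) (Or.inr ha.le))
    have := hc.tendsto
    simp only [sub_self, abs_zero, Real.zero_rpow ha.ne', mul_zero] at this
    exact this.mono_left nhdsWithin_le_nhds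
  refine squeeze_zero' (Eventually.of_forall fun _ => norm_nonneg _) ?_ h3
  filter_upwards [self_mem_nhdsWithin] with y hy using h2 y hy

lemma continuousOn_fracL {a T M : ℝ} (ha : 0 < a) (ha1 : a ≤ 1) (hM : 0 ≤ M) {v : ℝ → ℝ}
    (hvm : AEStronglyMeasurable v (volume.restrict (Ioo 0 T)))
    (hv : ∀ r ∈ Ioo 0 T, |v r| ≤ M) : ContinuousOn (fracL a T v) (Ioo 0 T) := by
  refine continuousOn_of_abs_sub_le (C := 2 * M / Real.Gamma (a + 1)) ha fun s hs t ht hst => ?_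
  have := abs_fracL_sub_le ha ha1 hs.1.le hst ht.2.le hM hvm fun r hr _ => hv r hr
  rw [rlKernel_of_pos _ (by linarith), show a + 1 - 1 = a by ring] at this
  rw [abs_sub_comm]
  exact this.trans (le_of_eq (by ring))

lemma eqOn_Ioo_of_ae_eq {T : ℝ} {f g : ℝ → ℝ} (h : f =ᵐ[volume.restrict (Ioo 0 T)] g)
    (hf : ContinuousOn f (Ioo 0 T)) (hg : ContinuousOn g (Ioo 0 T)) : EqOn f g (Ioo 0 T) :=
  Measure.eqOn_open_of_ae_eq h isOpen_Ioo hf hg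

lemma integrableOn_of_bounded_measurable {T B : ℝ} {h : ℝ → ℝ} (hh : Measurable h)
    (hB : ∀ x, |h x| ≤ B) : IntegrableOn h (Ioo 0 T) :=
  Measure.integrableOn_of_bounded (M := B) (by simp) hh.aestronglyMeasurable
    (Eventually.of_forall hB)

/-- Applying the integral of order α to both sides gives the identity of `integral_greenDensity`.
Injectivity yields equality almost everywhere, and continuity of both sides makes it hold at every
point. -/
lemma fracL_greenWeight {α T B t : ℝ} {h : ℝ → ℝ} (hα : 1 / 2 < α) (hα1 : α < 1)
    (hh : Measurable h) (hB : ∀ x, |h x| ≤ B) (ht : t ∈ Ioo 0 T) :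
    fracL (1 - α) T (greenWeight α T h) t = t ^ (α - 1) * ∫ s in (0 : ℝ)..t, h s := by
  have hα0 : 0 < α := by linarith
  have hT : 0 < T := ht.1.trans ht.2
  have hB0 : 0 ≤ B := (abs_nonneg _).trans (hB 0)
  have hG := Real.Gamma_pos_of_pos (show 0 < α + 1 by linarith)
  have hwi := integrableOn_greenWeight (T := T) hα hα1.le hh hB
  have hhi := integrableOn_of_bounded_measurable (T := T) hh hB
  have hcH : ContinuousOn (fun t : ℝ => t ^ (α - 1) * ∫ s in (0 : ℝ)..t, h s) (Ioo 0 T) :=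
    ContinuousOn.mul (continuousOn_id.rpow_const fun x hx => Or.inl hx.1.ne')
      ((continuousOn_integral_Ioo hT.le hhi).mono Ioo_subset_Icc_self)
  have hHb : ∀ s ∈ Ioo 0 T, ‖s ^ (α - 1) * ∫ r in (0 : ℝ)..s, h r‖ ≤ B * s ^ α := by
    intro s hs
    have := intervalIntegral.norm_integral_le_of_norm_le_const (a := 0) (b := s)
      (f := h) (C := B) fun r _ => hB r
    rw [sub_zero, abs_of_pos hs.1] at this
    rw [norm_mul, Real.norm_of_nonneg (Real.rpow_nonneg hs.1.le _)]
    calc _ ≤ s ^ (α - 1) * (B * s) := by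
          gcongr
          exact Real.rpow_nonneg hs.1.le _
      _ = B * (s ^ (α - 1) * s) := by ring
      _ = _ := by rw [← Real.rpow_add_one hs.1.ne']; simp
  have hHi : IntegrableOn (fun t : ℝ => t ^ (α - 1) * ∫ s in (0 : ℝ)..t, h s) (Ioo 0 T) := by
    refine Integrable.of_bound (hcH.aestronglyMeasurable measurableSet_Ioo) (B * T ^ α) ?_
    filter_upwards [ae_restrict_mem measurableSet_Ioo] with s hs
    refine (hHb s hs).trans ?_
    have := hs.1
    gcongr
    exact hs.2.le
  refine eqOn_Ioo_of_ae_eq (fracL_injective hT.le hα0 hα1 (integrableOn_fracL (by linarith) hwi)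
    hHi ?_) (continuousOn_fracL (by linarith) (by linarith) (by positivity) hwi.aestronglyMeasurable
      fun r hr => abs_greenWeight_le hα hα1.le hB hr) hcH ht
  filter_upwards [ae_restrict_mem measurableSet_Ioo] with x hx
  have e := (fracL_fracL (a := α) (b := 1 - α) hα0 (by linarith) hx.2.le hwi.aestronglyMeasurable
    (by rw [show α + (1 - α) = 1 by ring]; exact integrable_rlKernel_one_mul x hwi)).2
  rw [e, show α + (1 - α) = 1 by ring, fracL_one hx.1.le hx.2.le, integral_greenWeight hα hh hB hx,
    integral_greenDensity hα0 hh hB hx]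

lemma greenTrace_eq {α T B s : ℝ} {h : ℝ → ℝ} (hα : 0 < α) (hh : Measurable h)
    (hB : ∀ x, |h x| ≤ B) (hs : s ∈ Ioo 0 T) :
    greenTrace α T h s = -(s * greenDensity α T h s) + (2 * α - 1) *
      ((∫ r in (0 : ℝ)..T, greenDensity α T h r) - ∫ r in (0 : ℝ)..s, greenDensity α T h r) := by
  have hT : 0 < T := hs.1.trans hs.2
  have hgi := integrableOn_greenDensity (T := T) hα hh hB
  rw [greenTrace, fracR_one hs.1.le hs.2.le, ← intervalIntegral.integral_add_adjacent_intervals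
    (intervalIntegrable_of_integrableOn_Ioo hgi ⟨le_rfl, hT.le⟩ (Ioo_subset_Icc_self hs))
    (intervalIntegrable_of_integrableOn_Ioo hgi (Ioo_subset_Icc_self hs) ⟨hT.le, le_rfl⟩),
    add_sub_cancel_left]

lemma continuousOn_greenTrace {α T B : ℝ} {h : ℝ → ℝ} (hα : 1 / 2 < α) (hα1 : α ≤ 1)
    (hh : Measurable h) (hB : ∀ x, |h x| ≤ B) : ContinuousOn (greenTrace α T h) (Ioo 0 T) :=
  continuousOn_of_abs_sub_le (by linarith) fun _ hs _ ht hst =>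
    abs_greenTrace_sub_le hα hα1 hh hB hs ht hst

/-- For α = 1 the part of the trace depending on s is minus `greenWeight`, which has the same
primitive as t ↦ ∫₀ᵗ h. -/
lemma greenTrace_one_eq {T B : ℝ} {h : ℝ → ℝ} (hh : Measurable h) (hB : ∀ x, |h x| ≤ B) {t : ℝ}
    (ht : t ∈ Ioo 0 T) : greenTrace 1 T h t =
      (∫ r in (0 : ℝ)..T, greenDensity 1 T h r) - ∫ s in (0 : ℝ)..t, h s := by
  have hT : 0 < T := ht.1.trans ht.2
  have hwi := integrableOn_greenWeight (α := 1) (T := T) (by norm_num) le_rfl hh hB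
  have hhi := integrableOn_of_bounded_measurable (T := T) hh hB
  have hHc : ContinuousOn (fun t => ∫ s in (0 : ℝ)..t, h s) (Ioo 0 T) :=
    (continuousOn_integral_Ioo hT.le hhi).mono Ioo_subset_Icc_self
  have hHi : IntegrableOn (fun t => ∫ s in (0 : ℝ)..t, h s) (Ioo 0 T) :=
    ((continuousOn_integral_Ioo hT.le hhi).integrableOn_compact isCompact_Icc).mono_set
      Ioo_subset_Icc_self
  refine eqOn_Ioo_of_ae_eq (f := greenTrace 1 T h) (g := fun t =>
    (∫ r in (0 : ℝ)..T, greenDensity 1 T h r) - ∫ s in (0 : ℝ)..t, h s) ?_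
    (continuousOn_greenTrace (by norm_num) le_rfl hh hB) (continuousOn_const.sub hHc) ht
  have hae : greenWeight 1 T h =ᵐ[volume.restrict (Ioo 0 T)] fun t => ∫ s in (0 : ℝ)..t, h s := by
    refine ae_eq_of_forall_integral_eq hT.le hwi hHi fun x hx => ?_
    rw [integral_greenWeight (by norm_num) hh hB hx, integral_greenDensity one_pos hh hB hx,
      fracL_one hx.1.le hx.2.le]
    simp
  filter_upwards [hae, ae_restrict_mem measurableSet_Ioo] with x hx hxm
  rw [← hx, greenTrace_eq one_pos hh hB hxm, greenWeight]
  norm_num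
  ring

/-- Within δ of t the function is bounded and the kernel integrable; farther away the roles are
exchanged. -/
lemma integrableOn_rlKernel_mul_of_local {a T t δ M : ℝ} (ha : 0 < a) (ha1 : a ≤ 1) (htT : t ≤ T)
    (hδ : 0 < δ) {v : ℝ → ℝ} (hv : IntegrableOn v (Ioo 0 T))
    (hb : ∀ r ∈ Ioo 0 T, t - δ < r → r < t → |v r| ≤ M) (hM : 0 ≤ M) :
    IntegrableOn (fun s => rlKernel a (t - s) * v s) (Ioo 0 T) := by
  have h1 := (integral_rlKernel_left (T := T) (t := t) ha htT).1
  have hk : AEStronglyMeasurable (fun s => rlKernel a (t - s)) (volume.restrict (Ioo 0 T)) :=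
    Measurable.aestronglyMeasurable (by fun_prop)
  refine ((h1.const_mul M).add (hv.norm.const_mul (rlKernel a δ))).mono'
    (hk.mul hv.aestronglyMeasurable) ?_
  filter_upwards [ae_restrict_mem measurableSet_Ioo] with r hr
  have h0 := rlKernel_nonneg ha (t - r)
  have h0' := rlKernel_nonneg ha δ
  simp only [Pi.add_apply, norm_mul, Real.norm_of_nonneg h0]
  have hn := norm_nonneg (v r)
  rcases le_or_gt t r with h | h
  · rw [rlKernel_of_nonpos _ (by linarith)]
    simp only [zero_mul, mul_zero, zero_add]
    positivity
  rcases lt_or_ge (t - δ) r with h2 | h2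
  · have := mul_le_mul_of_nonneg_left (hb r hr h2 h) h0
    rw [Real.norm_eq_abs] at *
    nlinarith
  · have := mul_le_mul_of_nonneg_right (rlKernel_anti ha ha1 hδ (show δ ≤ t - r by linarith)) hn
    nlinarith

lemma integrableOn_rlKernel_right_mul_of_local {a T t δ M : ℝ} (ha : 0 < a) (ha1 : a ≤ 1)
    (ht : 0 ≤ t) (hδ : 0 < δ) {v : ℝ → ℝ} (hv : IntegrableOn v (Ioo 0 T))
    (hb : ∀ r ∈ Ioo 0 T, t < r → r < t + δ → |v r| ≤ M) (hM : 0 ≤ M) :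
    IntegrableOn (fun s => rlKernel a (s - t) * v s) (Ioo 0 T) := by
  have h := integrableOn_rlKernel_mul_of_local (T := T) (t := T - t) ha ha1 (by linarith) hδ
    (integrableOn_reflect_of hv) (fun r hr h1 h2 =>
      hb _ ⟨by linarith [hr.2], by linarith [hr.1]⟩ (by linarith) (by linarith)) hM
  rw [← integrableOn_Ioo_reflect]
  simpa only [show ∀ s, T - s - t = T - t - s from fun s => by ring] using h

lemma integrableOn_rlKernel_mul_of_weight {α a T K : ℝ} (hα1 : α ≤ 1)
    (ha : 0 < a) (ha1 : a ≤ 1) (hK : 0 ≤ K) {v : ℝ → ℝ} (hv : IntegrableOn v (Ioo 0 T))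
    (hb : ∀ y ∈ Ioo 0 T, |v y| ≤ K * (y ^ (α - 1) * (T - y) ^ (α - 1))) {t : ℝ}
    (ht : t ∈ Ioo 0 T) :
    IntegrableOn (fun s => rlKernel a (t - s) * v s) (Ioo 0 T) ∧
      IntegrableOn (fun s => rlKernel a (s - t) * v s) (Ioo 0 T) := by
  obtain ⟨ht0, htT⟩ := ht
  have hTt : 0 < T - t := by linarith
  -- Every r within δ of t stays at distance at least δ from both end points, where the weight is
  -- singular.
  set δ := min t (T - t) / 2 with hδ
  have hδ0 : 0 < δ := by positivity
  have hδ1 : δ ≤ t / 2 := by rw [hδ]; gcongr; exact min_le_left _ _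
  have hδ2 : δ ≤ (T - t) / 2 := by rw [hδ]; gcongr; exact min_le_right _ _
  have hloc : ∀ r ∈ Ioo 0 T, t - δ < r → r < t + δ →
      |v r| ≤ K * (δ ^ (α - 1) * δ ^ (α - 1)) := by
    intro r hr h1 h2
    refine (hb r hr).trans ?_
    have e1 : r ^ (α - 1) ≤ δ ^ (α - 1) :=
      Real.rpow_le_rpow_of_nonpos hδ0 (by linarith) (by linarith)
    have e2 : (T - r) ^ (α - 1) ≤ δ ^ (α - 1) :=
      Real.rpow_le_rpow_of_nonpos hδ0 (by linarith) (by linarith)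
    have : 0 ≤ (T - r) ^ (α - 1) := Real.rpow_nonneg (by linarith [hr.2]) _
    gcongr
  exact ⟨integrableOn_rlKernel_mul_of_local ha ha1 htT.le hδ0 hv
      (fun r hr h1 h2 => hloc r hr h1 (by linarith)) (by positivity),
    integrableOn_rlKernel_right_mul_of_local ha ha1 ht0.le hδ0 hv
      (fun r hr h1 h2 => hloc r hr (by linarith) h2) (by positivity)⟩

/-- `greenSolution` solves the linear problem `(flux u)' = -2 |cos πα| h`. -/
lemma riesz_greenDeriv {α T B : ℝ} {h : ℝ → ℝ} (hα : 1 / 2 < α) (hα1 : α < 1)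
    (hh : Measurable h) (hB : ∀ x, |h x| ≤ B) :
    ∃ c, ∀ t ∈ Ioo 0 T,
      fracL (2 * (1 - α)) T (greenDeriv α T h) t + fracR (2 * (1 - α)) T (greenDeriv α T h) t =
        c - 2 * |Real.cos (Real.pi * α)| * ∫ s in (0 : ℝ)..t, h s := by
  set b := 1 - α with hb
  have hb0 : 0 < b := by linarith
  have hb2 : 2 * b < 1 := by linarith
  have hB0 : 0 ≤ B := (abs_nonneg _).trans (hB 0)
  have hcos : |Real.cos (Real.pi * α)| = Real.cos (Real.pi * b) := by
    have h1 : Real.cos (Real.pi * b) = -Real.cos (Real.pi * α) := by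
      rw [hb, show Real.pi * (1 - α) = Real.pi - Real.pi * α by ring, Real.cos_pi_sub]
    have h2 : 0 < Real.cos (Real.pi * b) := by
      have hpi := Real.pi_pos
      exact Real.cos_pos_of_mem_Ioo ⟨by nlinarith, by nlinarith⟩
    rw [h1] at h2 ⊢
    exact abs_of_neg (by linarith)
  rw [hcos]
  set N0 := ∫ r in (0 : ℝ)..T, greenDensity α T h r with hN0
  have hGp := Real.Gamma_pos_of_pos (show 0 < 1 - 2 * b by linarith)
  -- The left integral of order b of s^{2α-2} = s^{-2b} is a multiple of t^{-b}, so after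
  -- multiplication by t^b it contributes this constant.
  refine ⟨2 * Real.cos (Real.pi * b) * ((2 * α - 1) * N0 * Real.Gamma (1 - 2 * b) /
    Real.Gamma (1 - b)), fun t ht => ?_⟩
  have hT : 0 < T := ht.1.trans ht.2
  have hvi := integrableOn_greenDeriv (T := T) hα hα1.le hh hB
  obtain ⟨iL, iR⟩ := integrableOn_rlKernel_mul_of_weight (a := 2 * b) hα1.le (by linarith)
    hb2.le (mul_nonneg (greenConst_nonneg hα hT) hB0) hvi
    (fun y hy => abs_greenDeriv_le hα hα1.le hh hB hy) ht
  rw [riesz_factorization hb0 hb2 ht hvi.aestronglyMeasurable iL iR]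
  have hφ : (fun y => y ^ b * greenDeriv α T h y) =ᵐ[volume.restrict (Ioo 0 T)]
      greenPhi α T h := by
    filter_upwards [ae_restrict_mem measurableSet_Ioo] with y hy
    rw [greenDeriv, ← mul_assoc, ← Real.rpow_add hy.1, hb]
    simp
  -- The inner right integral is `greenTrace`; times s^{2α-2} it splits into a pure power and
  -- `greenWeight`, whose left integrals of order b are both known.
  have hk : (fun s => s ^ (-(2 * b)) * fracR b T (fun y => y ^ b * greenDeriv α T h y) s)
      =ᵐ[volume.restrict (Ioo 0 T)] fun s => (2 * α - 1) * N0 * Real.Gamma (1 - 2 * b) *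
        rlKernel (1 - 2 * b) (s - 0) - greenWeight α T h s := by
    filter_upwards [fracR_greenPhi_ae hα hα1 hT hh hB, ae_restrict_mem measurableSet_Ioo]
      with s hs hsm
    rw [fracR_congr hφ, hb, hs, greenTrace_eq (by linarith) hh hB hsm, sub_zero,
      rlKernel_of_pos _ hsm.1, greenWeight, ← hN0, show -(2 * (1 - α)) = 2 * α - 2 by ring,
      show 1 - 2 * (1 - α) - 1 = 2 * α - 2 by ring]
    have e1 : s ^ (2 * α - 1) = s ^ (2 * α - 2) * s := by
      rw [← Real.rpow_add_one hsm.1.ne']; ring_nf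
    have hG : Real.Gamma (1 - 2 * (1 - α)) ≠ 0 := hGp.ne'
    rw [e1]
    field_simp
    ring
  have hwi := integrableOn_greenWeight (T := T) hα hα1.le hh hB
  obtain ⟨i1, e1⟩ := rlKernel_conv_restrict (b := 1 - 2 * b) (T := T) (t := t) (r := 0) hb0
    (by linarith) ht.2.le le_rfl
  have i2 : IntegrableOn (fun s => rlKernel b (t - s) * greenWeight α T h s) (Ioo 0 T) :=
    integrableOn_rlKernel_mul_of_bdd hb0 ht.2.le hwi.aestronglyMeasurable
      fun r hr _ => abs_greenWeight_le hα hα1.le hB hr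
  have e2 := fracL_greenWeight hα hα1 hh hB ht
  rw [← hb] at e2
  have e3 : fracL b T (fun s => (2 * α - 1) * N0 * Real.Gamma (1 - 2 * b) *
        rlKernel (1 - 2 * b) (s - 0) - greenWeight α T h s) t =
      (2 * α - 1) * N0 * Real.Gamma (1 - 2 * b) * rlKernel (b + (1 - 2 * b)) (t - 0) -
        t ^ (α - 1) * ∫ s in (0 : ℝ)..t, h s := by
    rw [← e2, ← e1, fracL, fracL, ← integral_const_mul, ← integral_sub (i1.const_mul _) i2]
    exact setIntegral_congr_fun measurableSet_Ioo fun s _ => by ring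
  rw [fracL_congr hk, e3, sub_zero, rlKernel_of_pos _ ht.1, show b + (1 - 2 * b) = 1 - b by ring,
    show 1 - b - 1 = -b by ring, show α - 1 = -b by rw [hb]; ring, Real.rpow_neg ht.1.le]
  have := (Real.rpow_pos_of_pos ht.1 b).ne'
  have hG2 := (Real.Gamma_pos_of_pos (show 0 < 1 - b by linarith)).ne'
  generalize Real.cos (Real.pi * b) = C
  generalize ∫ s in (0 : ℝ)..t, h s = H
  field_simp

/-! ### L² bounds, adjointness and the fractional derivative space. -/

/-- Cauchy–Schwarz for the weight k, read off from the non-negative variance ∫ k (f - L/A)², where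
L/A is the weighted mean. -/
lemma sq_integral_mul_le {μ : Measure ℝ} {k f : ℝ → ℝ} (hk0 : ∀ x, 0 ≤ k x) (hk : Integrable k μ)
    (hkf : Integrable (fun x => k x * f x) μ) (hkf2 : Integrable (fun x => k x * f x ^ 2) μ)
    (hpos : 0 < ∫ x, k x ∂μ) :
    (∫ x, k x * f x ∂μ) ^ 2 ≤ (∫ x, k x ∂μ) * ∫ x, k x * f x ^ 2 ∂μ := by
  set A := ∫ x, k x ∂μ
  set L := ∫ x, k x * f x ∂μ with hL
  set D := ∫ x, k x * f x ^ 2 ∂μ with hD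
  have h0 : 0 ≤ ∫ x, k x * (f x - L / A) ^ 2 ∂μ :=
    integral_nonneg fun x => mul_nonneg (hk0 x) (sq_nonneg _)
  have e : ∫ x, k x * (f x - L / A) ^ 2 ∂μ = D - 2 * (L / A) * L + (L / A) ^ 2 * A := by
    rw [hD, hL, ← integral_const_mul, ← integral_const_mul, ← integral_sub hkf2 (hkf.const_mul _),
      ← integral_add (f := fun x => k x * f x ^ 2 - 2 * ((∫ x, k x * f x ∂μ) / A) * (k x * f x))
        (hkf2.sub (hkf.const_mul _)) (hk.const_mul _)]
    exact integral_congr_ae (Eventually.of_forall fun x => by ring)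
  rw [e] at h0
  have : D - 2 * (L / A) * L + (L / A) ^ 2 * A = D - L ^ 2 / A := by
    field_simp
    ring
  rw [this, sub_nonneg, div_le_iff₀ hpos] at h0
  linarith

lemma eLpNorm_two_eq {μ : Measure ℝ} {f : ℝ → ℝ} (hf : MemLp f 2 μ) :
    eLpNorm f 2 μ = ENNReal.ofReal (√(∫ x, f x ^ 2 ∂μ)) := by
  rw [hf.eLpNorm_eq_integral_rpow_norm (by norm_num) (by norm_num)]
  congr 1
  simp [Real.sqrt_eq_rpow]

/-- Schur test: Cauchy–Schwarz against the kernel, then Fubini, each costing one factor of the total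
mass of the kernel. -/
lemma fracL_memLp {a T : ℝ} (ha : 0 < a) {v : ℝ → ℝ} (hv : MemLp v 2 (volume.restrict (Ioo 0 T))) :
    MemLp (fracL a T v) 2 (volume.restrict (Ioo 0 T)) ∧
      ∫ t in Ioo 0 T, fracL a T v t ^ 2 ≤ rlKernel (a + 1) T ^ 2 * ∫ t in Ioo 0 T, v t ^ 2 := by
  have hvi : IntegrableOn v (Ioo 0 T) := hv.integrable (by norm_num)
  have hv2 : IntegrableOn (fun t => v t ^ 2) (Ioo 0 T) := hv.integrable_sq
  have hp := integrable_rlKernel_prod ha hv2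
  have hK0 : 0 ≤ rlKernel (a + 1) T := rlKernel_nonneg (by linarith) _
  have hpt : ∀ᵐ t ∂(volume.restrict (Ioo 0 T)), fracL a T v t ^ 2 ≤
      rlKernel (a + 1) T * ∫ s in Ioo 0 T, rlKernel a (t - s) * v s ^ 2 := by
    filter_upwards [ae_integrable_fracL ha hvi, hp.prod_right_ae,
      ae_restrict_mem measurableSet_Ioo] with t h1 h2 ht
    obtain ⟨k1, k2⟩ := integral_rlKernel_left (T := T) (t := t) ha ht.2.le
    have hpos : 0 < rlKernel (a + 1) t := by
      rw [rlKernel_of_pos _ ht.1]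
      exact div_pos (Real.rpow_pos_of_pos ht.1 _) (Real.Gamma_pos_of_pos (by linarith))
    have h3 := sq_integral_mul_le (fun s => rlKernel_nonneg ha (t - s)) k1 h1 h2
      (by rw [k2]; exact hpos)
    rw [k2] at h3
    refine h3.trans (mul_le_mul_of_nonneg_right (rlKernel_mono (by linarith) ht.2.le) ?_)
    exact integral_nonneg fun s => mul_nonneg (rlKernel_nonneg ha _) (sq_nonneg _)
  have hint : IntegrableOn (fun t => rlKernel (a + 1) T *
      ∫ s in Ioo 0 T, rlKernel a (t - s) * v s ^ 2) (Ioo 0 T) :=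
    Integrable.const_mul hp.integral_prod_left _
  have hm := (integrableOn_fracL ha hvi).aestronglyMeasurable
  have hsq : IntegrableOn (fun t => fracL a T v t ^ 2) (Ioo 0 T) := by
    refine Integrable.mono' hint (hm.pow 2) (hpt.mono fun t ht => ?_)
    rwa [Real.norm_of_nonneg (sq_nonneg _)]
  refine ⟨(memLp_two_iff_integrable_sq hm).2 hsq, ?_⟩
  refine (integral_mono_ae hsq hint hpt).trans ?_
  have hsw := integral_integral_swap (f := fun t s => rlKernel a (t - s) * v s ^ 2) hp
  rw [integral_const_mul, hsw, sq, mul_assoc]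
  refine mul_le_mul_of_nonneg_left ?_ hK0
  rw [← integral_const_mul]
  refine integral_mono_ae (Integrable.integral_prod_right hp) (hv2.const_mul _) ?_
  filter_upwards [ae_restrict_mem measurableSet_Ioo] with s hs
  rw [integral_mul_const, (integral_rlKernel_right ha hs.1.le).2]
  exact mul_le_mul_of_nonneg_right (rlKernel_mono (by linarith) (by linarith [hs.1])) (sq_nonneg _)

lemma memLp_reflect {T : ℝ} {v : ℝ → ℝ} (hv : MemLp v 2 (volume.restrict (Ioo 0 T))) :
    MemLp (fun s => v (T - s)) 2 (volume.restrict (Ioo 0 T)) :=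
  hv.comp_measurePreserving (measurePreserving_reflect T)

lemma fracR_memLp {a T : ℝ} (ha : 0 < a) {v : ℝ → ℝ}
    (hv : MemLp v 2 (volume.restrict (Ioo 0 T))) :
    MemLp (fracR a T v) 2 (volume.restrict (Ioo 0 T)) := by
  have h := memLp_reflect (fracL_memLp ha (memLp_reflect hv)).1
  simpa only [← fracR_eq_fracL] using h

lemma eLpNorm_fracL_le {a T : ℝ} (ha : 0 < a) {v : ℝ → ℝ}
    (hv : MemLp v 2 (volume.restrict (Ioo 0 T))) :
    eLpNorm (fracL a T v) 2 (volume.restrict (Ioo 0 T)) ≤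
      ENNReal.ofReal (rlKernel (a + 1) T) * eLpNorm v 2 (volume.restrict (Ioo 0 T)) := by
  have hK0 : 0 ≤ rlKernel (a + 1) T := rlKernel_nonneg (by linarith) _
  obtain ⟨h1, h2⟩ := fracL_memLp ha hv
  rw [eLpNorm_two_eq h1, eLpNorm_two_eq hv, ← ENNReal.ofReal_mul hK0]
  refine ENNReal.ofReal_le_ofReal ?_
  calc _ ≤ √(rlKernel (a + 1) T ^ 2 * ∫ t in Ioo 0 T, v t ^ 2) := Real.sqrt_le_sqrt h2
    _ = _ := by rw [Real.sqrt_mul (sq_nonneg _), Real.sqrt_sq hK0]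

/-- Left and right integrals are adjoint by Fubini, which is legitimate since |v| |w| ≤ v² + w² and
the kernel has bounded marginals. -/
lemma integral_fracL_mul {a T : ℝ} (ha : 0 < a) {v w : ℝ → ℝ}
    (hv : MemLp v 2 (volume.restrict (Ioo 0 T))) (hw : MemLp w 2 (volume.restrict (Ioo 0 T))) :
    ∫ t in Ioo 0 T, fracL a T v t * w t = ∫ s in Ioo 0 T, v s * fracR a T w s := by
  have h1 := integrable_rlKernel_prod ha (T := T) (v := fun t => v t ^ 2) hv.integrable_sq
  have h2 := (integrable_rlKernel_prod' ha (T := T) (v := fun t => w t ^ 2) hw.integrable_sq).swap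
  have hk : AEStronglyMeasurable (fun z : ℝ × ℝ => rlKernel a (z.1 - z.2))
      ((volume.restrict (Ioo 0 T)).prod (volume.restrict (Ioo 0 T))) :=
    Measurable.aestronglyMeasurable (by fun_prop)
  have hF : Integrable (fun z : ℝ × ℝ => rlKernel a (z.1 - z.2) * v z.2 * w z.1)
      ((volume.restrict (Ioo 0 T)).prod (volume.restrict (Ioo 0 T))) := by
    refine (h1.add h2).mono' ((hk.mul hv.1.comp_snd).mul hw.1.comp_fst)
      (Eventually.of_forall fun z => ?_)
    have h0 := rlKernel_nonneg ha (z.1 - z.2)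
    simp only [norm_mul, Real.norm_of_nonneg h0, Pi.add_apply, Function.comp, Prod.fst_swap,
      Prod.snd_swap, Real.norm_eq_abs]
    have : |v z.2| * |w z.1| ≤ v z.2 ^ 2 + w z.1 ^ 2 := by
      rw [← sq_abs (v z.2), ← sq_abs (w z.1)]
      nlinarith [sq_nonneg (|v z.2| - |w z.1|), sq_nonneg (|v z.2|), sq_nonneg (|w z.1|)]
    nlinarith [mul_le_mul_of_nonneg_left this h0]
  have hsw := integral_integral_swap (f := fun t s => rlKernel a (t - s) * v s * w t) hF
  simp only [integral_mul_const] at hsw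
  simp only [fracL, fracR]
  rw [hsw]
  refine integral_congr_ae (Eventually.of_forall fun s => ?_)
  simp only
  rw [← integral_const_mul]
  exact integral_congr_ae (Eventually.of_forall fun t => by ring)

lemma restrict_Icc_eq_Ioo (T : ℝ) :
    (volume : Measure ℝ).restrict (Icc 0 T) = volume.restrict (Ioo 0 T) :=
  (Measure.restrict_congr_set Ioo_ae_eq_Icc).symm

lemma memLp_of_continuousOn {T : ℝ} {w : ℝ → ℝ} (hw : ContinuousOn w (Icc 0 T)) :
    MemLp w 2 (volume.restrict (Ioo 0 T)) := by
  obtain ⟨C, hC⟩ := isCompact_Icc.exists_bound_of_continuousOn hw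
  refine MemLp.of_bound ((hw.mono Ioo_subset_Icc_self).aestronglyMeasurable measurableSet_Ioo) C ?_
  filter_upwards [ae_restrict_mem measurableSet_Ioo] with x hx
  exact hC x (Ioo_subset_Icc_self hx)

/-- The left fractional integral of order `b ≥ 0` on `(0, T)`, the identity for `b = 0`. -/
noncomputable def fracL₀ (b T : ℝ) (v : ℝ → ℝ) : ℝ → ℝ := if b = 0 then v else fracL b T v

lemma fracL₀_memLp {b T : ℝ} (hb : 0 ≤ b) {v : ℝ → ℝ}
    (hv : MemLp v 2 (volume.restrict (Ioo 0 T))) :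
    MemLp (fracL₀ b T v) 2 (volume.restrict (Ioo 0 T)) := by
  unfold fracL₀
  split_ifs with h
  · exact hv
  · exact (fracL_memLp (lt_of_le_of_ne hb (Ne.symm h)) hv).1

lemma eLpNorm_fracL₀_le {b T : ℝ} (hb : 0 ≤ b) {v : ℝ → ℝ}
    (hv : MemLp v 2 (volume.restrict (Ioo 0 T))) :
    eLpNorm (fracL₀ b T v) 2 (volume.restrict (Ioo 0 T)) ≤
      ENNReal.ofReal (rlKernel (b + 1) T + 1) * eLpNorm v 2 (volume.restrict (Ioo 0 T)) := by
  have hK0 : 0 ≤ rlKernel (b + 1) T := rlKernel_nonneg (by linarith) _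
  unfold fracL₀
  split_ifs with h
  · calc _ = ENNReal.ofReal 1 * eLpNorm v 2 (volume.restrict (Ioo 0 T)) := by simp
      _ ≤ _ := by gcongr; linarith
  · refine (eLpNorm_fracL_le (lt_of_le_of_ne hb (Ne.symm h)) hv).trans ?_
    gcongr
    linarith

lemma integral_fracL₀_sq_le {b T : ℝ} (hb : 0 ≤ b) {v : ℝ → ℝ}
    (hv : MemLp v 2 (volume.restrict (Ioo 0 T))) :
    ∫ t in Ioo 0 T, fracL₀ b T v t ^ 2 ≤
      (rlKernel (b + 1) T ^ 2 + 1) * ∫ t in Ioo 0 T, v t ^ 2 := by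
  have h0 : 0 ≤ ∫ t in Ioo 0 T, v t ^ 2 := integral_nonneg fun _ => sq_nonneg _
  unfold fracL₀
  split_ifs with h
  · nlinarith [sq_nonneg (rlKernel (b + 1) T)]
  · have := (fracL_memLp (lt_of_le_of_ne hb (Ne.symm h)) hv).2
    linarith

lemma fracL₀_sub_ae {b T : ℝ} (hb : 0 ≤ b) {v w : ℝ → ℝ} (hv : IntegrableOn v (Ioo 0 T))
    (hw : IntegrableOn w (Ioo 0 T)) :
    fracL₀ b T (fun t => v t - w t) =ᵐ[volume.restrict (Ioo 0 T)]
      fun t => fracL₀ b T v t - fracL₀ b T w t := by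
  unfold fracL₀
  split_ifs with h
  · rfl
  · have hb' := lt_of_le_of_ne hb (Ne.symm h)
    filter_upwards [ae_integrable_fracL hb' hv, ae_integrable_fracL hb' hw] with t h1 h2
    simp only [fracL, mul_sub]
    exact integral_sub h1 h2

lemma deriv_integral_ae {T : ℝ} (hT : 0 ≤ T) {v : ℝ → ℝ} (hv : IntegrableOn v (Ioo 0 T)) :
    deriv (fun x => ∫ y in (0 : ℝ)..x, v y) =ᵐ[volume.restrict (Ioo 0 T)] v := by
  have hI := intervalIntegrable_of_integrableOn_Ioo hv ⟨le_rfl, hT⟩ ⟨hT, le_rfl⟩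
  rw [EventuallyEq, ae_restrict_iff' measurableSet_Ioo]
  filter_upwards [hI.ae_hasDerivAt_integral] with t h1 ht
  exact (h1 (by rw [uIcc_of_le hT]; exact Ioo_subset_Icc_self ht) 0 left_mem_uIcc).deriv

lemma caputoLeft_ae {α T : ℝ} (hα1 : α ≤ 1) {u v : ℝ → ℝ}
    (hu : deriv u =ᵐ[volume.restrict (Ioo 0 T)] v) :
    caputoLeft α 0 u =ᵐ[volume.restrict (Ioo 0 T)] fracL₀ (1 - α) T v := by
  unfold fracL₀
  split_ifs with h
  · filter_upwards [hu] with t ht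
    rw [caputoLeft, rlLeft, if_pos h, ht]
  · have hb' := lt_of_le_of_ne (show 0 ≤ 1 - α by linarith) (Ne.symm h)
    filter_upwards [ae_restrict_mem measurableSet_Ioo] with t ht
    rw [caputoLeft, rlLeft_eq_fracL ht.1.le ht.2.le hb', fracL_congr hu]

/-- Approximation of a mean-zero `L²` function by smooth mean-zero functions. -/
lemma exists_smooth_mean_zero {T : ℝ} (hT : 0 < T) {v : ℝ → ℝ}
    (hv : MemLp v 2 (volume.restrict (Ioo 0 T))) (hv0 : ∫ y in (0 : ℝ)..T, v y = 0)
    {ε : ℝ} (hε : 0 < ε) :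
    ∃ w : ℝ → ℝ, ContDiff ℝ ∞ w ∧ ∫ y in (0 : ℝ)..T, w y = 0 ∧
      eLpNorm (fun t => w t - v t) 2 (volume.restrict (Ioo 0 T)) ≤ ENNReal.ofReal ε := by
  obtain ⟨g, -, hg, hgv⟩ := hv.exist_eLpNorm_sub_le (by norm_num) (by norm_num) (half_pos hε)
  have hgm : MemLp g 2 (volume.restrict (Ioo 0 T)) := by
    exact memLp_of_continuousOn hg.continuous.continuousOn
  set a := (∫ y in (0 : ℝ)..T, g y) / T with ha
  have hgI : ∀ x y, IntervalIntegrable g volume x y := fun x y =>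
    hg.continuous.intervalIntegrable x y
  refine ⟨fun t => g t - a, hg.sub contDiff_const, ?_, ?_⟩
  · rw [intervalIntegral.integral_sub (hgI _ _) (by simp), intervalIntegral.integral_const, ha]
    simp only [sub_zero, smul_eq_mul]
    field_simp
    ring
  have hd : MemLp (fun t => g t - v t) 2 (volume.restrict (Ioo 0 T)) := hgm.sub hv
  have hc : MemLp (fun _ => a) 2 (volume.restrict (Ioo 0 T)) := memLp_const a
  have hdi : IntegrableOn (fun t => g t - v t) (Ioo 0 T) := hd.integrable (by norm_num)
  have ha2 : a = (∫ y in Ioo 0 T, (g y - v y)) / T := by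
    have hvI : IntervalIntegrable v volume 0 T := intervalIntegrable_of_integrableOn_Ioo
      (hv.integrable (by norm_num)) ⟨le_rfl, hT.le⟩ ⟨hT.le, le_rfl⟩
    rw [← integral_Ioc_eq_integral_Ioo, ← intervalIntegral.integral_of_le hT.le,
      intervalIntegral.integral_sub (hgI _ _) hvI, hv0, sub_zero]
  -- As v has mean zero, the mean of g is the mean of g - v, so removing it at most doubles the
  -- error; this is why g was taken ε/2-close.
  have hle : eLpNorm (fun _ : ℝ => a) 2 (volume.restrict (Ioo 0 T)) ≤
      eLpNorm (fun t => g t - v t) 2 (volume.restrict (Ioo 0 T)) := by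
    rw [eLpNorm_two_eq hc, eLpNorm_two_eq hd]
    refine ENNReal.ofReal_le_ofReal (Real.sqrt_le_sqrt ?_)
    have h := sq_integral_mul_le (μ := volume.restrict (Ioo 0 T)) (k := fun _ => (1 : ℝ))
      (f := fun t => g t - v t) (fun _ => zero_le_one) (integrable_const _)
      (by simpa [IntegrableOn] using hdi) (by simpa using hd.integrable_sq) (by simp [hT])
    simp only [one_mul, integral_const, smul_eq_mul, mul_one, measureReal_restrict_apply_univ,
      Real.volume_real_Ioo_of_le hT.le, sub_zero] at h ⊢
    rw [ha2, div_pow, ← mul_div_assoc, div_le_iff₀ (by positivity)]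
    nlinarith
  have h1 : (fun t => g t - a - v t) = (fun t => g t - v t) - fun _ => a := by
    ext t
    simp only [Pi.sub_apply]
    ring
  have h2 : eLpNorm (fun t => g t - v t) 2 (volume.restrict (Ioo 0 T)) ≤ ENNReal.ofReal (ε / 2) := by
    have := eLpNorm_sub_comm v g 2 (volume.restrict (Ioo 0 T))
    rw [this] at hgv
    exact hgv
  rw [h1]
  refine (eLpNorm_sub_le hd.1 hc.1 (by norm_num)).trans ?_
  calc _ ≤ ENNReal.ofReal (ε / 2) + ENNReal.ofReal (ε / 2) := add_le_add h2 (hle.trans h2)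
    _ = _ := by rw [← ENNReal.ofReal_add (by positivity) (by positivity), add_halves]

lemma smoothZero_integral {T : ℝ} {w : ℝ → ℝ} (hw : ContDiff ℝ ∞ w)
    (h0 : ∫ y in (0 : ℝ)..T, w y = 0) : SmoothZero T fun x => ∫ y in (0 : ℝ)..x, w y := by
  refine ⟨ContDiff.contDiffOn ?_, intervalIntegral.integral_same, h0⟩
  have hd : ∀ x, HasDerivAt (fun x => ∫ y in (0 : ℝ)..x, w y) (w x) x := fun x =>
    intervalIntegral.integral_hasDerivAt_right (hw.continuous.intervalIntegrable _ _)
      (hw.continuous.stronglyMeasurableAtFilter _ _) hw.continuous.continuousAt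
  rw [contDiff_infty_iff_deriv]
  refine ⟨fun x => (hd x).differentiableAt, ?_⟩
  have : deriv (fun x => ∫ y in (0 : ℝ)..x, w y) = w := funext fun x => (hd x).deriv
  rw [this]
  exact hw

/-- The primitive of a mean-zero `L²` function belongs to the fractional derivative space. -/
lemma hasFracDeriv_integral {α T : ℝ} (hα1 : α ≤ 1) (hT : 0 < T) {v : ℝ → ℝ}
    (hv : MemLp v 2 (volume.restrict (Ioo 0 T))) (hv0 : ∫ y in (0 : ℝ)..T, v y = 0) :
    HasFracDeriv α T (fun x => ∫ y in (0 : ℝ)..x, v y)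
      (caputoLeft α 0 fun x => ∫ y in (0 : ℝ)..x, v y) := by
  have hb : 0 ≤ 1 - α := by linarith
  have hvi : IntegrableOn v (Ioo 0 T) := hv.integrable (by norm_num)
  have hcap := caputoLeft_ae hα1 (deriv_integral_ae hT.le hvi)
  have hprim : ∀ w : ℝ → ℝ, fracL 1 T w =ᵐ[volume.restrict (Ioo 0 T)]
      fun x => ∫ y in (0 : ℝ)..x, w y := fun w => by
    filter_upwards [ae_restrict_mem measurableSet_Ioo] with x hx
    exact fracL_one hx.1.le hx.2.le w
  have hε : ∀ n : ℕ, 0 < 1 / ((n : ℝ) + 1) := fun n => by positivity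
  -- The approximants are primitives of smooth mean-zero functions. Errors in the function and in
  -- its fractional derivative are both fractional integrals of w n - v, hence bounded by its L²
  -- norm.
  choose w hw hw0 hwv using fun n : ℕ => exists_smooth_mean_zero hT hv hv0 (hε n)
  have hwm : ∀ n, MemLp (w n) 2 (volume.restrict (Ioo 0 T)) := fun n => by
    exact memLp_of_continuousOn (hw n).continuous.continuousOn
  have hwi : ∀ n, IntegrableOn (w n) (Ioo 0 T) := fun n => (hwm n).integrable (by norm_num)
  have hlim : ∀ C : ℝ, Tendsto (fun n : ℕ => ENNReal.ofReal C * ENNReal.ofReal (1 / ((n : ℝ) + 1)))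
      atTop (𝓝 0) := fun C => by
    have h1 : Tendsto (fun n : ℕ => ENNReal.ofReal (1 / ((n : ℝ) + 1))) atTop (𝓝 0) := by
      simpa using ENNReal.tendsto_ofReal tendsto_one_div_add_atTop_nhds_zero_nat
    simpa using ENNReal.Tendsto.const_mul h1 (Or.inr ENNReal.ofReal_ne_top)
  rw [HasFracDeriv, restrict_Icc_eq_Ioo]
  refine ⟨(memLp_congr_ae (hprim v)).1 (fracL_memLp one_pos hv).1,
    (memLp_congr_ae hcap).2 (fracL₀_memLp hb hv), fun n x => ∫ y in (0 : ℝ)..x, w n y,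
    fun n => smoothZero_integral (hw n) (hw0 n), ?_, ?_⟩
  · refine tendsto_of_tendsto_of_tendsto_of_le_of_le tendsto_const_nhds
      (hlim (rlKernel (1 + 1) T)) (fun n => bot_le) fun n => ?_
    have e : (fun x => (∫ y in (0 : ℝ)..x, w n y) - ∫ y in (0 : ℝ)..x, v y)
        =ᵐ[volume.restrict (Ioo 0 T)] fracL 1 T (fun t => w n t - v t) := by
      filter_upwards [ae_restrict_mem measurableSet_Ioo] with x hx
      rw [fracL_one hx.1.le hx.2.le, intervalIntegral.integral_sub
        (intervalIntegrable_of_integrableOn_Ioo (hwi n) ⟨le_rfl, hT.le⟩ (Ioo_subset_Icc_self hx))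
        (intervalIntegrable_of_integrableOn_Ioo hvi ⟨le_rfl, hT.le⟩ (Ioo_subset_Icc_self hx))]
    simp only
    rw [eLpNorm_congr_ae e]
    refine (eLpNorm_fracL_le one_pos ((hwm n).sub hv)).trans ?_
    gcongr
    exact hwv n
  · refine tendsto_of_tendsto_of_tendsto_of_le_of_le tendsto_const_nhds
      (hlim (rlKernel (1 - α + 1) T + 1)) (fun n => bot_le) fun n => ?_
    have e : (fun t => caputoLeft α 0 (fun x => ∫ y in (0 : ℝ)..x, w n y) t -
        caputoLeft α 0 (fun x => ∫ y in (0 : ℝ)..x, v y) t)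
        =ᵐ[volume.restrict (Ioo 0 T)] fracL₀ (1 - α) T (fun t => w n t - v t) := by
      filter_upwards [hcap, caputoLeft_ae hα1 (deriv_integral_ae hT.le (hwi n)),
        fracL₀_sub_ae hb (hwi n) hvi] with t h1 h2 h3
      rw [h1, h2, h3]
    simp only
    rw [eLpNorm_congr_ae e]
    refine (eLpNorm_fracL₀_le hb ((hwm n).sub hv)).trans ?_
    gcongr
    exact hwv n

/-! ### Caputo derivatives, flux and energy of the Green primitive. -/

lemma caputoRight_ae {α T : ℝ} (hα1 : α < 1) {u v : ℝ → ℝ}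
    (hu : deriv u =ᵐ[volume.restrict (Ioo 0 T)] v) :
    caputoRight α T u =ᵐ[volume.restrict (Ioo 0 T)] fun t => -fracR (1 - α) T v t := by
  filter_upwards [ae_restrict_mem measurableSet_Ioo] with t ht
  rw [caputoRight, rlRight_eq_fracR ht.1.le ht.2.le (by linarith), fracR_congr hu]

lemma caputoRight_one (T : ℝ) (u : ℝ → ℝ) : caputoRight 1 T u = fun t => -deriv u t := by
  ext t
  simp [caputoRight, rlRight]

lemma caputoLeft_one (u : ℝ → ℝ) : caputoLeft 1 0 u = deriv u := by
  ext t
  simp [caputoLeft, rlLeft]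

lemma caputoRight_memLp {α T : ℝ} (hα1 : α ≤ 1) {u v : ℝ → ℝ}
    (hv : MemLp v 2 (volume.restrict (Ioo 0 T)))
    (hu : deriv u =ᵐ[volume.restrict (Ioo 0 T)] v) :
    MemLp (caputoRight α T u) 2 (volume.restrict (Ioo 0 T)) := by
  rcases hα1.lt_or_eq with h | rfl
  · exact (memLp_congr_ae (caputoRight_ae h hu)).2 (fracR_memLp (by linarith) hv).neg
  · rw [caputoRight_one]
    exact ((memLp_congr_ae hu).2 hv).neg

/-- For `α < 1` the flux of an absolutely continuous function `u` with derivative `v` is a sum of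
two fractional integrals of `v`. -/
lemma fracFlux_eq {α T t : ℝ} (hα1 : α < 1) {u v : ℝ → ℝ} (hv : IntegrableOn v (Ioo 0 T))
    (hu : deriv u =ᵐ[volume.restrict (Ioo 0 T)] v) (ht : t ∈ Ioo 0 T)
    (iL : IntegrableOn (fun s => rlKernel (2 * (1 - α)) (t - s) * v s) (Ioo 0 T))
    (iR : IntegrableOn (fun s => rlKernel (2 * (1 - α)) (s - t) * v s) (Ioo 0 T)) :
    FracFluxDefined α T u t ∧
      fracFlux α T u t = fracL (2 * (1 - α)) T v t + fracR (2 * (1 - α)) T v t := by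
  have hb : 0 < 1 - α := by linarith
  rw [two_mul] at iL iR ⊢
  have hL : caputoLeft α 0 u =ᵐ[volume.restrict (Ioo 0 T)] fracL (1 - α) T v := by
    have := caputoLeft_ae hα1.le hu
    rwa [fracL₀, if_neg hb.ne'] at this
  have hR := caputoRight_ae hα1 hu
  obtain ⟨l1, l2⟩ := fracL_fracL hb hb ht.2.le hv.aestronglyMeasurable iL
  obtain ⟨r1, r2⟩ := fracR_fracR hb hb ht.1.le hv.aestronglyMeasurable iR
  refine ⟨⟨Or.inr ?_, Or.inr ?_⟩, ?_⟩
  · rw [← integrableOn_rlKernel_iff ht.1.le ht.2.le hb]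
    exact Integrable.congr l1 (hL.mono fun s hs => by simp only [hs])
  · rw [← integrableOn_rlKernel_right_iff ht.1.le ht.2.le hb]
    exact Integrable.congr r1.neg (hR.mono fun s hs => by simp [hs])
  · rw [fracFlux, rlLeft_eq_fracL ht.1.le ht.2.le hb, rlRight_eq_fracR ht.1.le ht.2.le hb,
      fracL_congr hL, fracR_congr hR, l2, ← r2]
    have : fracR (1 - α) T (fun t => -fracR (1 - α) T v t) t =
        -fracR (1 - α) T (fracR (1 - α) T v) t := by
      unfold fracR
      rw [← integral_neg]
      simp only [mul_neg]
    rw [this, sub_neg_eq_add]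

lemma fracFlux_one_eq {T t : ℝ} (u : ℝ → ℝ) :
    FracFluxDefined 1 T u t ∧ fracFlux 1 T u t = 2 * deriv u t := by
  refine ⟨⟨Or.inl (by norm_num), Or.inl (by norm_num)⟩, ?_⟩
  rw [fracFlux, caputoLeft_one, caputoRight_one]
  simp [rlLeft, rlRight]
  ring

/-- The square of the pointwise bound has exponents 2α - 2 at both ends, integrable because α > 1/2.
The dependence on B is kept for the limit μ → 0+. -/
lemma greenDeriv_sq_le {α T B : ℝ} {h : ℝ → ℝ} (hα : 1 / 2 < α) (hα1 : α ≤ 1)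
    (hh : Measurable h) (hB : ∀ x, |h x| ≤ B) :
    MemLp (greenDeriv α T h) 2 (volume.restrict (Ioo 0 T)) ∧
      ∫ y in Ioo 0 T, greenDeriv α T h y ^ 2 ≤ (greenConst α T * B) ^ 2 *
        ∫ y in Ioo 0 T, y ^ (2 * α - 1 - 1) * (T - y) ^ (2 * α - 1 - 1) := by
  have hi := (integrableOn_rpow_mul_rpow (a := 2 * α - 1) (T := T) (by linarith)).const_mul
    ((greenConst α T * B) ^ 2)
  have hm := (measurable_greenDeriv α T hh).aestronglyMeasurable
    (μ := volume.restrict (Ioo 0 T))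
  have hle : ∀ᵐ y ∂(volume.restrict (Ioo 0 T)), greenDeriv α T h y ^ 2 ≤
      (greenConst α T * B) ^ 2 * (y ^ (2 * α - 1 - 1) * (T - y) ^ (2 * α - 1 - 1)) := by
    filter_upwards [ae_restrict_mem measurableSet_Ioo] with y hy
    have h1 := pow_le_pow_left₀ (abs_nonneg _) (abs_greenDeriv_le hα hα1 hh hB hy) 2
    rw [sq_abs, mul_pow, mul_pow (y ^ (α - 1)), ← Real.rpow_mul_natCast hy.1.le,
      ← Real.rpow_mul_natCast (by linarith [hy.2])] at h1
    rwa [show 2 * α - 1 - 1 = (α - 1) * ((2 : ℕ) : ℝ) by push_cast; ring]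
  have hsq : IntegrableOn (fun y => greenDeriv α T h y ^ 2) (Ioo 0 T) := by
    refine Integrable.mono' hi (hm.pow 2) (hle.mono fun y hy => ?_)
    rwa [Real.norm_of_nonneg (sq_nonneg _)]
  refine ⟨(memLp_two_iff_integrable_sq hm).2 hsq, ?_⟩
  rw [← integral_const_mul]
  exact integral_mono_ae hsq hi hle

/-- The absolutely continuous solution of the linear problem with right-hand side `h`. -/
noncomputable def greenPrimitive (α T : ℝ) (h : ℝ → ℝ) (x : ℝ) : ℝ :=
  ∫ y in (0 : ℝ)..x, greenDeriv α T h y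

lemma greenPrimitive_right {α T B : ℝ} {h : ℝ → ℝ} (hα : 1 / 2 < α) (hα1 : α ≤ 1) (hT : 0 < T)
    (hh : Measurable h) (hB : ∀ x, |h x| ≤ B) : greenPrimitive α T h T = 0 := by
  rw [greenPrimitive, ← greenSolution_eq_integral hα hα1 hT hh hB ⟨hT.le, le_rfl⟩,
    greenSolution_right]

lemma deriv_greenPrimitive_ae {α T B : ℝ} {h : ℝ → ℝ} (hα : 1 / 2 < α) (hα1 : α ≤ 1) (hT : 0 < T)
    (hh : Measurable h) (hB : ∀ x, |h x| ≤ B) :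
    deriv (greenPrimitive α T h) =ᵐ[volume.restrict (Ioo 0 T)] greenDeriv α T h :=
  deriv_integral_ae hT.le (integrableOn_greenDeriv hα hα1 hh hB)

lemma deriv_greenPrimitive_one {T B t : ℝ} {h : ℝ → ℝ} (hh : Measurable h)
    (hB : ∀ x, |h x| ≤ B) (ht : t ∈ Ioo 0 T) :
    deriv (greenPrimitive 1 T h) t = greenTrace 1 T h t := by
  have hv : EqOn (greenDeriv 1 T h) (greenTrace 1 T h) (Ioo 0 T) := fun y hy => by
    simp [greenDeriv, greenPhi]
  have hc : ContinuousAt (greenDeriv 1 T h) t :=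
    ((continuousOn_greenTrace (by norm_num) le_rfl hh hB).congr hv).continuousAt
      (isOpen_Ioo.mem_nhds ht)
  have hI := intervalIntegrable_of_integrableOn_Ioo
    (integrableOn_greenDeriv (α := 1) (T := T) (by norm_num) le_rfl hh hB)
    ⟨le_rfl, (ht.1.trans ht.2).le⟩ (Ioo_subset_Icc_self ht)
  rw [← hv ht]
  exact (intervalIntegral.integral_hasDerivAt_right hI
    (measurable_greenDeriv 1 T hh).stronglyMeasurable.stronglyMeasurableAtFilter hc).deriv

/-- The flux of `greenPrimitive` is a primitive of `-2 |cos πα| h`. -/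
lemma fracFlux_greenPrimitive {α T B : ℝ} {h : ℝ → ℝ} (hα : 1 / 2 < α) (hα1 : α ≤ 1)
    (hT : 0 < T) (hh : Measurable h) (hB : ∀ x, |h x| ≤ B) :
    ∃ c, ∀ t ∈ Ioo 0 T, FracFluxDefined α T (greenPrimitive α T h) t ∧
      fracFlux α T (greenPrimitive α T h) t =
        c - 2 * |Real.cos (Real.pi * α)| * ∫ s in (0 : ℝ)..t, h s := by
  have hB0 : 0 ≤ B := (abs_nonneg _).trans (hB 0)
  rcases hα1.lt_or_eq with hlt | rfl
  · obtain ⟨c, hc⟩ := riesz_greenDeriv (T := T) hα hlt hh hB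
    refine ⟨c, fun t ht => ?_⟩
    have hvi := integrableOn_greenDeriv (T := T) hα hα1 hh hB
    obtain ⟨iL, iR⟩ := integrableOn_rlKernel_mul_of_weight (a := 2 * (1 - α)) hα1 (by linarith)
      (by linarith) (mul_nonneg (greenConst_nonneg hα hT) hB0) hvi
      (fun y hy => abs_greenDeriv_le hα hα1 hh hB hy) ht
    rw [← hc t ht]
    exact fracFlux_eq hlt hvi (deriv_greenPrimitive_ae hα hα1 hT hh hB) ht iL iR
  · refine ⟨2 * ∫ r in (0 : ℝ)..T, greenDensity 1 T h r, fun t ht => ?_⟩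
    refine ⟨(fracFlux_one_eq _).1, ?_⟩
    rw [(fracFlux_one_eq _).2, deriv_greenPrimitive_one hh hB ht, greenTrace_one_eq hh hB ht]
    simp
    ring

lemma absolutelyContinuous_greenPrimitive {α T B : ℝ} {h : ℝ → ℝ} (hα : 1 / 2 < α) (hα1 : α ≤ 1)
    (hT : 0 < T) (hh : Measurable h) (hB : ∀ x, |h x| ≤ B) :
    AbsolutelyContinuousOnInterval (greenPrimitive α T h) 0 T :=
  (intervalIntegrable_of_integrableOn_Ioo (integrableOn_greenDeriv hα hα1 hh hB)
    ⟨le_rfl, hT.le⟩ ⟨hT.le, le_rfl⟩).absolutelyContinuousOnInterval_intervalIntegral left_mem_uIcc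

lemma isSolution_greenPrimitive {α T B μ : ℝ} {f h : ℝ → ℝ} (hα : 1 / 2 < α) (hα1 : α ≤ 1)
    (hT : 0 < T) (hh : Measurable h) (hB : ∀ x, |h x| ≤ B) (hf : Continuous f)
    (hfix : ∀ t ∈ Ioo 0 T,
      2 * |Real.cos (Real.pi * α)| * h t = μ * f (greenPrimitive α T h t)) :
    IsSolution α T μ f (greenPrimitive α T h) := by
  have hac := absolutelyContinuous_greenPrimitive hα hα1 hT hh hB
  refine ⟨hac, intervalIntegral.integral_same, greenPrimitive_right hα hα1 hT hh hB, ?_⟩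
  obtain ⟨c, hc⟩ := fracFlux_greenPrimitive hα hα1 hT hh hB
  set κ := 2 * |Real.cos (Real.pi * α)| with hκ
  have hcu : ContinuousOn (greenPrimitive α T h) (Ioo 0 T) := by
    have := hac.continuousOn
    rw [uIcc_of_le hT.le] at this
    exact this.mono Ioo_subset_Icc_self
  rw [restrict_Icc_eq_Ioo]
  filter_upwards [ae_restrict_mem measurableSet_Ioo] with t ht
  have hnt : Ioo 0 T ∈ 𝓝 t := isOpen_Ioo.mem_nhds ht
  refine ⟨(eventually_of_mem hnt fun s hs => (hc s hs).1), -(μ * f (greenPrimitive α T h t)), ?_,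
    by ring⟩
  -- The fixed-point relation makes h continuous on (0, T), so the primitive of h, and hence the
  -- flux, is classically differentiable at every interior point.
  have hk : ContinuousAt (fun s => κ * h s) t := by
    refine ((continuousOn_const.mul (hf.comp_continuousOn hcu)).congr hfix).continuousAt hnt
  have hI : IntervalIntegrable (fun s => κ * h s) volume 0 t :=
    intervalIntegrable_of_integrableOn_Ioo
      ((integrableOn_of_bounded_measurable (T := T) hh hB).const_mul κ)
      ⟨le_rfl, hT.le⟩ (Ioo_subset_Icc_self ht)
  have hd := (intervalIntegral.integral_hasDerivAt_right hI
    (hh.const_mul κ).stronglyMeasurable.stronglyMeasurableAtFilter hk).const_sub c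
  rw [← hfix t ht]
  refine hd.congr_of_eventuallyEq (eventually_of_mem hnt fun s hs => ?_)
  simp only
  rw [(hc s hs).2, intervalIntegral.integral_const_mul]

/-- Integration by parts; the boundary values vanish, so the constant c drops out. -/
lemma integral_greenPrimitive_mul {α T B : ℝ} {h : ℝ → ℝ} (hα : 1 / 2 < α) (hα1 : α ≤ 1)
    (hT : 0 < T) (hh : Measurable h) (hB : ∀ x, |h x| ≤ B) (c κ : ℝ) :
    ∫ t in (0 : ℝ)..T, greenDeriv α T h t * (c - κ * ∫ s in (0 : ℝ)..t, h s) =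
      κ * ∫ t in (0 : ℝ)..T, greenPrimitive α T h t * h t := by
  have hvI := intervalIntegrable_of_integrableOn_Ioo
    (integrableOn_greenDeriv (T := T) hα hα1 hh hB) ⟨le_rfl, hT.le⟩ ⟨hT.le, le_rfl⟩
  have hhI := intervalIntegrable_of_integrableOn_Ioo
    (integrableOn_of_bounded_measurable (T := T) hh hB) ⟨le_rfl, hT.le⟩ ⟨hT.le, le_rfl⟩
  have hac := absolutelyContinuous_greenPrimitive hα hα1 hT hh hB
  have hH : AbsolutelyContinuousOnInterval (fun t => ∫ s in (0 : ℝ)..t, h s) 0 T :=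
    hhI.absolutelyContinuousOnInterval_intervalIntegral left_mem_uIcc
  have hg : AbsolutelyContinuousOnInterval (fun t => c - κ * ∫ s in (0 : ℝ)..t, h s) 0 T :=
    (ContDiffOn.absolutelyContinuousOnInterval contDiffOn_const).fun_sub (hH.const_mul κ)
  have e := integral_eq_sub_of_absolutelyContinuous (F' := fun t =>
    greenDeriv α T h t * (c - κ * ∫ s in (0 : ℝ)..t, h s) -
      κ * (greenPrimitive α T h t * h t)) hT.le (hac.fun_mul hg) (by
      filter_upwards [hvI.ae_hasDerivAt_integral, hhI.ae_hasDerivAt_integral] with t h1 h2 ht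
      have ht2 : t ∈ uIcc 0 T := by rw [uIcc_of_le hT.le]; exact Ioo_subset_Icc_self ht
      have k1 : HasDerivAt (greenPrimitive α T h) (greenDeriv α T h t) t := h1 ht2 0 left_mem_uIcc
      have k2 := ((h2 ht2 0 left_mem_uIcc).const_mul κ).const_sub c
      exact (k1.mul k2).congr_deriv (by ring))
  rw [greenPrimitive_right hα hα1 hT hh hB, show greenPrimitive α T h 0 = 0 from
    intervalIntegral.integral_same, zero_mul, zero_mul, sub_zero,
    intervalIntegral.integral_sub (hvI.mul_continuousOn hg.continuousOn)
      ((hhI.continuousOn_mul hac.continuousOn).const_mul κ),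
    intervalIntegral.integral_const_mul, sub_eq_zero] at e
  exact e

/-- For α < 1 adjointness makes the energy form equal to half the integral of u' times the flux, and
integration by parts moves the derivative onto the flux. For α = 1 the form is ∫ (u')². -/
lemma integral_caputo_greenPrimitive {α T B : ℝ} {h : ℝ → ℝ} (hα : 1 / 2 < α) (hα1 : α ≤ 1)
    (hT : 0 < T) (hh : Measurable h) (hB : ∀ x, |h x| ≤ B) :
    -(∫ t in (0 : ℝ)..T, caputoLeft α 0 (greenPrimitive α T h) t *
        caputoRight α T (greenPrimitive α T h) t) =
      |Real.cos (Real.pi * α)| * ∫ t in (0 : ℝ)..T, greenPrimitive α T h t * h t := by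
  have hd := deriv_greenPrimitive_ae hα hα1 hT hh hB
  have hv := (greenDeriv_sq_le (T := T) hα hα1 hh hB).1
  have key := integral_greenPrimitive_mul hα hα1 hT hh hB
  simp only [intervalIntegral.integral_of_le hT.le, integral_Ioc_eq_integral_Ioo] at key ⊢
  rcases hα1.lt_or_eq with hlt | rfl
  · have hb : 0 < 1 - α := by linarith
    obtain ⟨c, hc⟩ := riesz_greenDeriv (T := T) hα hlt hh hB
    have hL : caputoLeft α 0 (greenPrimitive α T h) =ᵐ[volume.restrict (Ioo 0 T)]
        fracL (1 - α) T (greenDeriv α T h) := by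
      have := caputoLeft_ae hα1 hd
      rwa [fracL₀, if_neg hb.ne'] at this
    set v := greenDeriv α T h with hvdef
    have e0 : -(∫ t in Ioo 0 T, caputoLeft α 0 (greenPrimitive α T h) t *
        caputoRight α T (greenPrimitive α T h) t) =
        ∫ t in Ioo 0 T, fracL (1 - α) T v t * fracR (1 - α) T v t := by
      rw [← integral_neg]
      refine integral_congr_ae ?_
      filter_upwards [hL, caputoRight_ae hlt hd] with t h1 h2
      rw [h1, h2]
      ring
    have mL := (fracL_memLp hb hv).1
    have mR := fracR_memLp hb hv
    have e1 := integral_fracL_mul hb hv mR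
    have e2 := integral_fracL_mul hb mL hv
    have e3 := key c (2 * |Real.cos (Real.pi * α)|)
    have e4 : ∫ t in Ioo 0 T, v t *
        (c - 2 * |Real.cos (Real.pi * α)| * ∫ s in (0 : ℝ)..t, h s) =
        (∫ t in Ioo 0 T, fracL (1 - α) T (fracL (1 - α) T v) t * v t) +
        ∫ t in Ioo 0 T, v t * fracR (1 - α) T (fracR (1 - α) T v) t := by
      rw [← integral_add (f := fun t => fracL (1 - α) T (fracL (1 - α) T v) t * v t)
        (g := fun t => v t * fracR (1 - α) T (fracR (1 - α) T v) t)
        (MemLp.integrable_mul (fracL_memLp hb mL).1 hv)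
        (MemLp.integrable_mul hv (fracR_memLp hb mR))]
      refine setIntegral_congr_fun measurableSet_Ioo fun t ht => ?_
      have hB0 : 0 ≤ B := (abs_nonneg _).trans (hB 0)
      have hvi := integrableOn_greenDeriv (T := T) hα hα1 hh hB
      obtain ⟨iL, iR⟩ := integrableOn_rlKernel_mul_of_weight (a := 2 * (1 - α)) hα1 (by linarith)
        (by linarith) (mul_nonneg (greenConst_nonneg hα hT) hB0) hvi
        (fun y hy => abs_greenDeriv_le hα hα1 hh hB hy) ht
      rw [two_mul] at iL iR
      have l2 := (fracL_fracL hb hb ht.2.le hvi.aestronglyMeasurable iL).2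
      have r2 := (fracR_fracR hb hb ht.1.le hvi.aestronglyMeasurable iR).2
      rw [← hc t ht, l2, r2, two_mul]
      ring
    rw [e0]
    linarith
  · have e0 : -(∫ t in Ioo 0 T, caputoLeft 1 0 (greenPrimitive 1 T h) t *
        caputoRight 1 T (greenPrimitive 1 T h) t) =
        ∫ t in Ioo 0 T, greenDeriv 1 T h t *
          ((∫ r in (0 : ℝ)..T, greenDensity 1 T h r) - 1 * ∫ s in (0 : ℝ)..t, h s) := by
      rw [← integral_neg, caputoLeft_one, caputoRight_one]
      refine integral_congr_ae ?_
      filter_upwards [hd, ae_restrict_mem measurableSet_Ioo] with t h1 ht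
      rw [one_mul, ← greenTrace_one_eq hh hB ht, ← deriv_greenPrimitive_one hh hB ht, h1]
      ring
    rw [e0, key]
    simp

/-- The solutions will have h = O(μ), so this quadratic bound gives the limit as μ → 0+. -/
lemma integral_caputoLeft_sq_le {α T : ℝ} (hα : 1 / 2 < α) (hα1 : α ≤ 1) (hT : 0 < T) :
    ∃ C, ∀ (h : ℝ → ℝ) (B : ℝ), Measurable h → (∀ x, |h x| ≤ B) →
      ∫ t in (0 : ℝ)..T, |caputoLeft α 0 (greenPrimitive α T h) t| ^ 2 ≤ C * B ^ 2 := by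
  refine ⟨(rlKernel (1 - α + 1) T ^ 2 + 1) * (greenConst α T ^ 2 *
    ∫ y in Ioo 0 T, y ^ (2 * α - 1 - 1) * (T - y) ^ (2 * α - 1 - 1)), fun h B hh hB => ?_⟩
  obtain ⟨h1, h2⟩ := greenDeriv_sq_le (T := T) hα hα1 hh hB
  have h3 := integral_fracL₀_sq_le (b := 1 - α) (by linarith) h1
  have hL := caputoLeft_ae hα1 (deriv_greenPrimitive_ae hα hα1 hT hh hB)
  rw [intervalIntegral.integral_of_le hT.le, integral_Ioc_eq_integral_Ioo]
  have e : ∫ t in Ioo 0 T, |caputoLeft α 0 (greenPrimitive α T h) t| ^ 2 =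
      ∫ t in Ioo 0 T, fracL₀ (1 - α) T (greenDeriv α T h) t ^ 2 := by
    refine integral_congr_ae ?_
    filter_upwards [hL] with t ht
    rw [ht, sq_abs]
  rw [e]
  refine h3.trans ((mul_le_mul_of_nonneg_left h2 (by positivity)).trans (le_of_eq ?_))
  ring

/-! ### Minimisation on a ball of an abstract Hilbert space. -/

section Variational

variable {E : Type*} [NormedAddCommGroup E] [InnerProductSpace ℝ E]

/-- Sequential Banach–Alaoglu, transported to E by the Riesz representation. -/
lemma exists_weak_subseq [CompleteSpace E] [TopologicalSpace.SeparableSpace E] {ρ : ℝ} {ψ : ℕ → E}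
    (hψ : ∀ n, ‖ψ n‖ ≤ ρ) :
    ∃ ψ₀ : E, ‖ψ₀‖ ≤ ρ ∧ ∃ φ : ℕ → ℕ, StrictMono φ ∧
      ∀ η, Tendsto (fun n => inner ℝ η (ψ (φ n))) atTop (𝓝 (inner ℝ η ψ₀)) := by
  obtain ⟨a, ha, φ, hφ, hlim⟩ := WeakDual.isSeqCompact_closedBall ℝ E 0 ρ
    (x := fun n => StrongDual.toWeakDual (InnerProductSpace.toDual ℝ E (ψ n))) (fun n => by
      simpa using hψ n)
  set ψ₀ := (InnerProductSpace.toDual ℝ E).symm (WeakDual.toStrongDual a) with h0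
  refine ⟨ψ₀, ?_, φ, hφ, fun η => ?_⟩
  · simpa [h0] using ha
  · have h1 := ((WeakDual.eval_continuous η).tendsto a).comp hlim
    have h2 : inner ℝ η ψ₀ = a η := by
      rw [real_inner_comm, h0, InnerProductSpace.toDual_symm_apply]
      rfl
    rw [h2]
    refine h1.congr fun n => ?_
    rw [real_inner_comm]
    rfl

/-- The functional `ψ ↦ κ ‖ψ‖² - μ ∫ F(⟪e x, ψ⟫) dν(x)`. -/
noncomputable def dualEnergy (ν : Measure ℝ) (e : ℝ → E) (κ μ : ℝ) (F : ℝ → ℝ) (ψ : E) : ℝ :=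
  κ * ‖ψ‖ ^ 2 - μ * ∫ x, F (inner ℝ (e x) ψ) ∂ν

lemma abs_inner_le_of_bound {e : ℝ → E} {K ρ : ℝ} (hK : ∀ x, ‖e x‖ ≤ K) (hK0 : 0 ≤ K) {ψ : E}
    (hψ : ‖ψ‖ ≤ ρ) (x : ℝ) : |inner ℝ (e x) ψ| ≤ K * ρ :=
  (abs_real_inner_le_norm _ _).trans (mul_le_mul (hK x) hψ (norm_nonneg _) hK0)

lemma exists_bound_comp {F : ℝ → ℝ} (hF : Continuous F) (R : ℝ) :
    ∃ M, 0 ≤ M ∧ ∀ s, |s| ≤ R → |F s| ≤ M := by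
  obtain ⟨M, hM⟩ := (isCompact_Icc (a := -R) (b := R)).exists_bound_of_continuousOn hF.continuousOn
  exact ⟨max M 0, le_max_right _ _, fun s hs =>
    (hM s (abs_le.1 hs)).trans (le_max_left _ _)⟩

variable {ν : Measure ℝ} [IsFiniteMeasure ν] {e : ℝ → E} {K : ℝ}

/-- Direct method. The nonlinear term depends on ψ only through the functionals ⟪e x, ψ⟫, so it is
weakly continuous by dominated convergence; the quadratic term is weakly lower semicontinuous. -/
lemma exists_min_dualEnergy [CompleteSpace E] [TopologicalSpace.SeparableSpace E]
    (hK : ∀ x, ‖e x‖ ≤ K) (hK0 : 0 ≤ K) (hm : ∀ ψ, Measurable fun x => inner ℝ (e x) ψ)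
    {F : ℝ → ℝ} (hF : Continuous F) {κ μ ρ : ℝ} (hκ : 0 ≤ κ) (hμ : 0 ≤ μ) (hρ : 0 ≤ ρ) :
    ∃ ψ₀ : E, ‖ψ₀‖ ≤ ρ ∧ ∀ ψ : E, ‖ψ‖ ≤ ρ → dualEnergy ν e κ μ F ψ₀ ≤ dualEnergy ν e κ μ F ψ := by
  obtain ⟨M, hM0, hM⟩ := exists_bound_comp hF (K * ρ)
  set S := dualEnergy ν e κ μ F '' {ψ | ‖ψ‖ ≤ ρ} with hS
  have hFb : ∀ ψ : E, ‖ψ‖ ≤ ρ → ∀ x, ‖F (inner ℝ (e x) ψ)‖ ≤ M := fun ψ hψ x =>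
    hM _ (abs_inner_le_of_bound hK hK0 hψ x)
  have hbdd : BddBelow S := by
    refine ⟨-(μ * (M * ν.real univ)), ?_⟩
    rintro _ ⟨ψ, hψ, rfl⟩
    have h1 := norm_integral_le_of_norm_le_const (μ := ν) (Eventually.of_forall (hFb ψ hψ))
    have h2 := mul_le_mul_of_nonneg_left ((le_abs_self _).trans h1) hμ
    have h3 : 0 ≤ κ * ‖ψ‖ ^ 2 := by positivity
    unfold dualEnergy
    linarith
  have hne : S.Nonempty := ⟨_, 0, by simpa using hρ, rfl⟩
  obtain ⟨s, -, hs, hsS⟩ := exists_seq_tendsto_sInf hne hbdd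
  choose ψ hψρ hψs using hsS
  obtain ⟨ψ₀, h0, φ, hφ, hw⟩ := exists_weak_subseq hψρ
  refine ⟨ψ₀, h0, fun η hη => ?_⟩
  refine le_trans ?_ (csInf_le hbdd ⟨η, hη, rfl⟩)
  have hΦ : Tendsto (fun n => ∫ x, F (inner ℝ (e x) (ψ (φ n))) ∂ν) atTop
      (𝓝 (∫ x, F (inner ℝ (e x) ψ₀) ∂ν)) := by
    refine tendsto_integral_of_dominated_convergence (fun _ => M) (fun n => ?_)
      (integrable_const _) (fun n => Eventually.of_forall (hFb _ (hψρ _)))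
      (Eventually.of_forall fun x => (hF.tendsto _).comp (hw (e x)))
    exact (hF.measurable.comp (hm _)).aestronglyMeasurable
  have hlow : Tendsto (fun n => κ * (2 * inner ℝ ψ₀ (ψ (φ n)) - ‖ψ₀‖ ^ 2) -
      μ * ∫ x, F (inner ℝ (e x) (ψ (φ n))) ∂ν) atTop (𝓝 (dualEnergy ν e κ μ F ψ₀)) := by
    have h1 := ((((hw ψ₀).const_mul 2).sub_const (‖ψ₀‖ ^ 2)).const_mul κ).sub (hΦ.const_mul μ)
    have e1 : 2 * inner ℝ ψ₀ ψ₀ - ‖ψ₀‖ ^ 2 = ‖ψ₀‖ ^ 2 := by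
      rw [real_inner_self_eq_norm_sq]
      ring
    rwa [e1] at h1
  refine le_of_tendsto_of_tendsto hlow (hs.comp hφ.tendsto_atTop) (Eventually.of_forall fun n => ?_)
  simp only [Function.comp]
  rw [← hψs (φ n), dualEnergy]
  -- Expanding ‖ψ₀ - ψ‖² ≥ 0 bounds the norm below by a weakly continuous affine function that is
  -- exact at ψ₀.
  have h2 : 2 * inner ℝ ψ₀ (ψ (φ n)) - ‖ψ₀‖ ^ 2 ≤ ‖ψ (φ n)‖ ^ 2 := by
    have := norm_sub_sq_real ψ₀ (ψ (φ n))
    nlinarith [sq_nonneg ‖ψ₀ - ψ (φ n)‖]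
  have := mul_le_mul_of_nonneg_left h2 hκ
  linarith

/-- Euler–Lagrange equation for an interior minimum of `dualEnergy` on a ball. -/
lemma euler_lagrange_dualEnergy (hK : ∀ x, ‖e x‖ ≤ K) (hK0 : 0 ≤ K)
    (hm : ∀ ψ, Measurable fun x => inner ℝ (e x) ψ) {f F : ℝ → ℝ} (hf : Continuous f)
    (hF : ∀ s, HasDerivAt F (f s) s) {κ μ ρ : ℝ} {ψ₀ : E} (h0 : ‖ψ₀‖ < ρ)
    (hmin : ∀ ψ : E, ‖ψ‖ ≤ ρ → dualEnergy ν e κ μ F ψ₀ ≤ dualEnergy ν e κ μ F ψ) (η : E) :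
    2 * κ * inner ℝ ψ₀ η = μ * ∫ x, f (inner ℝ (e x) ψ₀) * inner ℝ (e x) η ∂ν := by
  have hFc : Continuous F := continuous_iff_continuousAt.2 fun s => (hF s).continuousAt
  have hloc : IsLocalMin (fun t : ℝ => dualEnergy ν e κ μ F (ψ₀ + t • η)) 0 := by
    have hc : Continuous fun t : ℝ => ‖ψ₀ + t • η‖ := by fun_prop
    have : ∀ᶠ t : ℝ in 𝓝 0, ‖ψ₀ + t • η‖ < ρ := hc.continuousAt.eventually_lt_const (by simpa using h0)
    filter_upwards [this] with t ht
    simpa using hmin _ ht.le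
  set R := K * (‖ψ₀‖ + ‖η‖) with hR
  obtain ⟨M, hM0, hM⟩ := exists_bound_comp hf R
  obtain ⟨N, hN0, hN⟩ := exists_bound_comp hFc R
  have hb : ∀ t ∈ Ioo (-1 : ℝ) 1, ∀ x, |inner ℝ (e x) (ψ₀ + t • η)| ≤ R := by
    intro t ht x
    refine abs_inner_le_of_bound hK hK0 ((norm_add_le _ _).trans ?_) x
    rw [norm_smul]
    have : ‖t‖ ≤ 1 := abs_le.2 ⟨ht.1.le, ht.2.le⟩
    nlinarith [norm_nonneg η]
  have hηb : ∀ x, |inner ℝ (e x) η| ≤ K * ‖η‖ := abs_inner_le_of_bound hK hK0 le_rfl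
  have hmem : Ioo (-1 : ℝ) 1 ∈ 𝓝 (0 : ℝ) := Ioo_mem_nhds (by norm_num) (by norm_num)
  have hmF : ∀ t : ℝ, AEStronglyMeasurable (fun x => F (inner ℝ (e x) (ψ₀ + t • η))) ν := fun t =>
    (hFc.measurable.comp (hm _)).aestronglyMeasurable
  have hder := (hasDerivAt_integral_of_dominated_loc_of_deriv_le (μ := ν) (x₀ := (0 : ℝ))
    (F := fun t x => F (inner ℝ (e x) (ψ₀ + t • η)))
    (F' := fun t x => f (inner ℝ (e x) (ψ₀ + t • η)) * inner ℝ (e x) η)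
    (bound := fun _ => M * (K * ‖η‖)) hmem (Eventually.of_forall hmF)
    (Integrable.of_bound (hmF 0) N (Eventually.of_forall fun x =>
      hN _ (hb 0 (by norm_num) x)))
    (((hf.measurable.comp (hm _)).mul (hm η)).aestronglyMeasurable)
    (Eventually.of_forall fun x t ht => by
      rw [norm_mul]
      exact mul_le_mul (hM _ (hb t ht x)) (hηb x) (norm_nonneg _) hM0)
    (integrable_const _) (Eventually.of_forall fun x t _ => by
      have h1 : HasDerivAt (fun t : ℝ => inner ℝ (e x) (ψ₀ + t • η)) (inner ℝ (e x) η) t := by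
        simp only [inner_add_right, inner_smul_right]
        simpa using ((hasDerivAt_id t).mul_const (inner ℝ (e x) η)).const_add (inner ℝ (e x) ψ₀)
      exact (hF _).comp t h1)).2
  have hsq : HasDerivAt (fun t : ℝ => ‖ψ₀ + t • η‖ ^ 2) (2 * inner ℝ ψ₀ η) 0 := by
    have e1 : (fun t : ℝ => ‖ψ₀ + t • η‖ ^ 2) =
        fun t : ℝ => ‖ψ₀‖ ^ 2 + 2 * (t * inner ℝ ψ₀ η) + t ^ 2 * ‖η‖ ^ 2 := by
      ext t
      rw [norm_add_sq_real, inner_smul_right, norm_smul, mul_pow, Real.norm_eq_abs, sq_abs]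
    rw [e1]
    have h1 := ((((hasDerivAt_id (0 : ℝ)).mul_const (inner ℝ ψ₀ η)).const_mul 2).const_add
      (‖ψ₀‖ ^ 2)).add ((hasDerivAt_pow 2 (0 : ℝ)).mul_const (‖η‖ ^ 2))
    refine h1.congr_deriv ?_
    simp
  have hJ := hloc.hasDerivAt_eq_zero ((hsq.const_mul κ).sub (hder.const_mul μ))
  simp only [zero_smul, add_zero] at hJ
  linarith

/-- If `F(s) / s² → ∞` as `s → 0+`, then `dualEnergy` takes negative values near zero. -/
lemma exists_dualEnergy_neg (hK : ∀ x, ‖e x‖ ≤ K) (hK0 : 0 ≤ K)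
    (hm : ∀ ψ, Measurable fun x => inner ℝ (e x) ψ) {F : ℝ → ℝ} (hF : Continuous F)
    (hlim : ∀ L : ℝ, ∃ δ > 0, ∀ s, 0 ≤ s → s ≤ δ → L * s ^ 2 ≤ F s)
    {κ μ ρ : ℝ} (hμ : 0 < μ) (hρ : 0 < ρ) {ψ : E}
    (hψ : ∀ x, 0 ≤ inner ℝ (e x) ψ) (hψ2 : 0 < ∫ x, inner ℝ (e x) ψ ^ 2 ∂ν) :
    ∃ η : E, ‖η‖ ≤ ρ ∧ dualEnergy ν e κ μ F η < 0 := by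
  set I := ∫ x, inner ℝ (e x) ψ ^ 2 ∂ν with hI
  -- With this slope the energy of ε • ψ is at most κ ε² ‖ψ‖² - (κ ‖ψ‖² + 1) ε² = -ε².
  obtain ⟨δ, hδ, hL⟩ := hlim ((κ * ‖ψ‖ ^ 2 + 1) / (μ * I))
  set R := K * ‖ψ‖ with hR
  have hR0 : 0 ≤ R := by positivity
  have hb : ∀ x, |inner ℝ (e x) ψ| ≤ R := abs_inner_le_of_bound hK hK0 le_rfl
  set ε := min (ρ / (‖ψ‖ + 1)) (δ / (R + 1)) with hε
  have hε0 : 0 < ε := by positivity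
  have hε1 : ε * ‖ψ‖ ≤ ρ := by
    have h1 : ε * (‖ψ‖ + 1) ≤ ρ := (le_div_iff₀ (by positivity)).1 (min_le_left _ _)
    nlinarith
  have hε2 : ε * R ≤ δ := by
    have h1 : ε * (R + 1) ≤ δ := (le_div_iff₀ (by positivity)).1 (min_le_right _ _)
    nlinarith
  have hin : ∀ x, inner ℝ (e x) (ε • ψ) = ε * inner ℝ (e x) ψ := fun x => inner_smul_right _ _ _
  refine ⟨ε • ψ, by rwa [norm_smul, Real.norm_of_nonneg hε0.le], ?_⟩
  obtain ⟨N, -, hN⟩ := exists_bound_comp hF (ε * R)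
  have hFi : Integrable (fun x => F (inner ℝ (e x) (ε • ψ))) ν := by
    refine Integrable.of_bound (hF.measurable.comp (hm _)).aestronglyMeasurable N
      (Eventually.of_forall fun x => hN _ ?_)
    rw [hin, abs_mul, abs_of_pos hε0]
    exact mul_le_mul_of_nonneg_left (hb x) hε0.le
  have hsi : Integrable (fun x => inner ℝ (e x) ψ ^ 2) ν := by
    refine Integrable.of_bound ((hm ψ).pow_const 2).aestronglyMeasurable (R ^ 2)
      (Eventually.of_forall fun x => ?_)
    rw [norm_pow]
    exact pow_le_pow_left₀ (norm_nonneg _) (hb x) 2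
  have hle : (κ * ‖ψ‖ ^ 2 + 1) / (μ * I) * ε ^ 2 * I ≤ ∫ x, F (inner ℝ (e x) (ε • ψ)) ∂ν := by
    rw [hI, ← integral_const_mul]
    refine integral_mono (hsi.const_mul _) hFi fun x => ?_
    have h1 := hL (ε * inner ℝ (e x) ψ) (mul_nonneg hε0.le (hψ x))
      ((mul_le_mul_of_nonneg_left ((le_abs_self _).trans (hb x)) hε0.le).trans hε2)
    simp only
    rw [hin]
    refine le_trans (le_of_eq ?_) h1
    ring
  have h2 := mul_le_mul_of_nonneg_left hle hμ.le
  have h3 : μ * ((κ * ‖ψ‖ ^ 2 + 1) / (μ * I) * ε ^ 2 * I) = (κ * ‖ψ‖ ^ 2 + 1) * ε ^ 2 := by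
    field_simp
  rw [h3] at h2
  rw [dualEnergy, norm_smul, Real.norm_of_nonneg hε0.le, mul_pow]
  nlinarith [pow_pos hε0 2]

end Variational

/-! ### The Green operator as a Gram operator on L²(0, T). -/

/-- The kernel of the operator `ψ ↦ x^α I_-^α (τ^{-α} ψ)(x)`. -/
noncomputable def greenKernel (α x τ : ℝ) : ℝ :=
  if 0 < x then x ^ α * (τ ^ (-α) * rlKernel α (τ - x)) else 0

lemma greenKernel_nonneg {α x τ : ℝ} (hα : 0 < α) (hτ : 0 < τ) : 0 ≤ greenKernel α x τ := by
  unfold greenKernel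
  split_ifs with h
  · have := rlKernel_nonneg hα (τ - x)
    positivity
  · exact le_rfl

/-- The kernel lives on τ > x, where (x/τ)^α ≤ 1. -/
lemma greenKernel_le {α x τ : ℝ} (hα : 0 < α) (hτ : 0 < τ) :
    greenKernel α x τ ≤ rlKernel α (τ - x) := by
  have h0 := rlKernel_nonneg hα (τ - x)
  unfold greenKernel
  split_ifs with h
  · rcases le_or_gt τ x with hx | hx
    · rw [rlKernel_of_nonpos _ (by linarith)]
      simp
    · rw [← mul_assoc]
      refine mul_le_of_le_one_left h0 ?_
      rw [Real.rpow_neg hτ.le, ← div_eq_mul_inv]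
      exact (div_le_one (Real.rpow_pos_of_pos hτ _)).2 (Real.rpow_le_rpow h.le hx.le hα.le)
  · exact h0

lemma measurable_greenKernel (α x : ℝ) : Measurable (greenKernel α x) := by
  unfold greenKernel
  split_ifs
  · fun_prop
  · exact measurable_const

lemma rlKernel_sq {α : ℝ} (hα : 1 / 2 < α) (y : ℝ) :
    rlKernel α y ^ 2 = Real.Gamma (2 * α - 1) / Real.Gamma α ^ 2 * rlKernel (2 * α - 1) y := by
  have hG := (Real.Gamma_pos_of_pos (show 0 < 2 * α - 1 by linarith)).ne'
  rcases le_or_gt y 0 with hy | hy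
  · simp [rlKernel_of_nonpos _ hy]
  · rw [rlKernel_of_pos _ hy, rlKernel_of_pos _ hy, div_pow, ← Real.rpow_mul_natCast hy.le,
      show (α - 1) * ((2 : ℕ) : ℝ) = 2 * α - 1 - 1 by push_cast; ring]
    field_simp

/-- The square of the norm of the embedding of the energy space into bounded functions. -/
noncomputable def embConst (α T : ℝ) : ℝ := T ^ (2 * α - 1) / (Real.Gamma α ^ 2 * (2 * α - 1))

/-- By `rlKernel_sq` the squared kernel is a kernel of order 2α - 1 > 0, and its mass is largest
over the full length T. The extension by zero to x ≤ 0 makes the bound uniform over all real x. -/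
lemma greenKernel_memLp {α T : ℝ} (hα : 1 / 2 < α) (hT : 0 < T) (x : ℝ) :
    MemLp (greenKernel α x) 2 (volume.restrict (Ioo 0 T)) ∧
      ∫ τ in Ioo 0 T, greenKernel α x τ ^ 2 ≤ embConst α T := by
  have hα0 : 0 < α := by linarith
  have ha : 0 < 2 * α - 1 := by linarith
  have hm := (measurable_greenKernel α x).aestronglyMeasurable (μ := volume.restrict (Ioo 0 T))
  rcases le_or_gt x 0 with hx | hx
  · have e : greenKernel α x = fun _ => 0 := by
      ext τ
      exact if_neg hx.not_gt
    rw [e]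
    refine ⟨MemLp.zero, ?_⟩
    simp only [ne_eq, OfNat.ofNat_ne_zero, not_false_eq_true, zero_pow, integral_zero]
    unfold embConst
    positivity
  obtain ⟨i1, i2⟩ := integral_rlKernel_right (T := T) ha hx.le
  have i3 := i1.const_mul (Real.Gamma (2 * α - 1) / Real.Gamma α ^ 2)
  have hle : ∀ᵐ τ ∂(volume.restrict (Ioo 0 T)), greenKernel α x τ ^ 2 ≤
      Real.Gamma (2 * α - 1) / Real.Gamma α ^ 2 * rlKernel (2 * α - 1) (τ - x) := by
    filter_upwards [ae_restrict_mem measurableSet_Ioo] with τ hτ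
    rw [← rlKernel_sq hα]
    exact pow_le_pow_left₀ (greenKernel_nonneg hα0 hτ.1) (greenKernel_le hα0 hτ.1) 2
  have hsq : IntegrableOn (fun τ => greenKernel α x τ ^ 2) (Ioo 0 T) := by
    refine Integrable.mono' i3 (hm.pow 2) (hle.mono fun τ hτ => ?_)
    rwa [Real.norm_of_nonneg (sq_nonneg _)]
  refine ⟨(memLp_two_iff_integrable_sq hm).2 hsq, (integral_mono_ae hsq i3 hle).trans ?_⟩
  have hG := Real.Gamma_pos_of_pos ha
  have hGα := Real.Gamma_pos_of_pos hα0
  rw [integral_const_mul, i2]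
  have h1 : rlKernel (2 * α - 1 + 1) (T - x) ≤ rlKernel (2 * α - 1 + 1) T :=
    rlKernel_mono (by linarith) (by linarith)
  refine (mul_le_mul_of_nonneg_left h1 (by positivity)).trans (le_of_eq ?_)
  rw [rlKernel_of_pos _ hT, Real.Gamma_add_one ha.ne', embConst, add_sub_cancel_right]
  field_simp

/-- The kernel `greenKernel α x` as an element of `L²(0, T)`. -/
noncomputable def greenVec {α T : ℝ} (hα : 1 / 2 < α) (hT : 0 < T) (x : ℝ) :
    Lp ℝ 2 ((volume : Measure ℝ).restrict (Ioo 0 T)) :=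
  (greenKernel_memLp hα hT x).1.toLp

lemma inner_greenVec {α T : ℝ} (hα : 1 / 2 < α) (hT : 0 < T) (x : ℝ)
    (ψ : Lp ℝ 2 ((volume : Measure ℝ).restrict (Ioo 0 T))) :
    inner ℝ (greenVec hα hT x) ψ = ∫ τ in Ioo 0 T, greenKernel α x τ * ψ τ := by
  rw [L2.inner_def]
  refine integral_congr_ae ?_
  filter_upwards [(greenKernel_memLp hα hT x).1.coeFn_toLp] with τ hτ
  rw [greenVec, hτ]
  simp [mul_comm]

lemma norm_greenVec_le {α T : ℝ} (hα : 1 / 2 < α) (hT : 0 < T) (x : ℝ) :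
    ‖greenVec hα hT x‖ ≤ √(embConst α T) := by
  refine Real.le_sqrt_of_sq_le ?_
  rw [← real_inner_self_eq_norm_sq, inner_greenVec]
  refine le_trans (le_of_eq (integral_congr_ae ?_)) (greenKernel_memLp hα hT x).2
  filter_upwards [(greenKernel_memLp hα hT x).1.coeFn_toLp] with τ hτ
  rw [greenVec, hτ, sq]

lemma measurable_inner_greenVec {α T : ℝ} (hα : 1 / 2 < α) (hT : 0 < T)
    (ψ : Lp ℝ 2 ((volume : Measure ℝ).restrict (Ioo 0 T))) :
    Measurable fun x => inner ℝ (greenVec hα hT x) ψ := by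
  have hψ := (Lp.stronglyMeasurable ψ).measurable
  have h1 := measurable_fracR α T (v := fun τ => τ ^ (-α) * ψ τ) (by fun_prop)
  have e : (fun x => inner ℝ (greenVec hα hT x) ψ) =
      (Ioi 0).indicator fun x => x ^ α * fracR α T (fun τ => τ ^ (-α) * ψ τ) x := by
    ext x
    rw [inner_greenVec]
    by_cases hx : 0 < x
    · rw [indicator_of_mem (show x ∈ Ioi 0 from hx), fracR, ← integral_const_mul]
      refine integral_congr_ae (Eventually.of_forall fun τ => ?_)
      simp only [greenKernel, if_pos hx]
      ring
    · rw [indicator_of_notMem (show x ∉ Ioi 0 from hx)]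
      simp [greenKernel, if_neg hx]
  rw [e]
  exact Measurable.indicator (by fun_prop) measurableSet_Ioi

/-- `greenSolution` is the integral of `h` against the Gram kernel of `greenVec`. -/
lemma greenSolution_eq_inner {α T B y : ℝ} {h : ℝ → ℝ} (hα : 1 / 2 < α) (hT : 0 < T)
    (hh : Measurable h) (hB : ∀ x, |h x| ≤ B) (hy : y ∈ Ioo 0 T) :
    greenSolution α T h y =
      ∫ x in Ioo 0 T, h x * inner ℝ (greenVec hα hT x) (greenVec hα hT y) := by
  have hα0 : 0 < α := by linarith
  have hB0 : 0 ≤ B := (abs_nonneg _).trans (hB 0)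
  have e1 : ∀ x, inner ℝ (greenVec hα hT x) (greenVec hα hT y) =
      ∫ τ in Ioo 0 T, greenKernel α x τ * greenKernel α y τ := fun x => by
    rw [inner_greenVec]
    refine integral_congr_ae ?_
    filter_upwards [(greenKernel_memLp hα hT y).1.coeFn_toLp] with τ hτ
    rw [greenVec, hτ]
  have hkm : Measurable fun z : ℝ × ℝ => greenKernel α z.1 z.2 := by
    unfold greenKernel
    exact Measurable.ite (measurableSet_lt measurable_const measurable_fst) (by fun_prop)
      measurable_const
  have hint : Integrable (fun z : ℝ × ℝ => h z.1 * (greenKernel α z.1 z.2 * greenKernel α y z.2))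
      ((volume.restrict (Ioo 0 T)).prod (volume.restrict (Ioo 0 T))) := by
    have hy2 := (greenKernel_memLp hα hT y).1.integrable (by norm_num)
    have h1 := (integrable_rlKernel_prod' hα0 (T := T) (v := greenKernel α y) hy2).const_mul B
    have hmy := measurable_greenKernel α y
    refine h1.mono' (Measurable.aestronglyMeasurable (by fun_prop)) ?_
    rw [Measure.prod_restrict]
    filter_upwards [ae_restrict_mem (measurableSet_Ioo.prod measurableSet_Ioo)] with z hz
    have k1 := greenKernel_nonneg (x := z.1) hα0 hz.2.1
    have k2 := greenKernel_nonneg (x := y) hα0 hz.2.1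
    have k3 := greenKernel_le (x := z.1) hα0 hz.2.1
    rw [norm_mul, norm_mul, Real.norm_of_nonneg k1, Real.norm_of_nonneg k2]
    exact mul_le_mul (hB _) (mul_le_mul_of_nonneg_right k3 k2) (mul_nonneg k1 k2) hB0
  have hsw := integral_integral_swap
    (f := fun x τ => h x * (greenKernel α x τ * greenKernel α y τ)) hint
  simp only [integral_const_mul] at hsw
  simp only [e1]
  rw [hsw, greenSolution, fracR, ← integral_const_mul]
  refine setIntegral_congr_fun measurableSet_Ioo fun τ hτ => ?_
  have e2 : ∫ x in Ioo 0 T, h x * (greenKernel α x τ * greenKernel α y τ) =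
      greenKernel α y τ * (τ ^ (-α) * fracL α T (fun x => x ^ α * h x) τ) := by
    rw [fracL, ← integral_const_mul, ← integral_const_mul]
    refine setIntegral_congr_fun measurableSet_Ioo fun x hx => ?_
    simp only [greenKernel, if_pos hx.1]
    ring
  -- The weight τ^{-2α} is shared equally between the two kernels, which gives the operator the form
  -- A A*.
  rw [e2, greenDensity, greenKernel, if_pos hy.1, show -(2 * α) = -α + -α by ring,
    Real.rpow_add hτ.1]
  ring

/-- The constant function one satisfies the positivity hypotheses of `exists_dualEnergy_neg`. -/
lemma exists_inner_greenVec_pos {α T : ℝ} (hα : 1 / 2 < α) (hT : 0 < T) :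
    ∃ ψ : Lp ℝ 2 ((volume : Measure ℝ).restrict (Ioo 0 T)),
      (∀ x, 0 ≤ inner ℝ (greenVec hα hT x) ψ) ∧
        0 < ∫ x in Ioo 0 T, inner ℝ (greenVec hα hT x) ψ ^ 2 := by
  have hα0 : 0 < α := by linarith
  have h1 : MemLp (fun _ => (1 : ℝ)) 2 (volume.restrict (Ioo 0 T)) := memLp_const 1
  set ψ := h1.toLp with hψ
  have e : ∀ x, inner ℝ (greenVec hα hT x) ψ = ∫ τ in Ioo 0 T, greenKernel α x τ := fun x => by
    rw [inner_greenVec]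
    refine integral_congr_ae ?_
    filter_upwards [h1.coeFn_toLp] with τ hτ
    rw [hψ, hτ, mul_one]
  have hnn : ∀ x, 0 ≤ᵐ[volume.restrict (Ioo 0 T)] greenKernel α x := fun x => by
    filter_upwards [ae_restrict_mem measurableSet_Ioo] with τ hτ
    exact greenKernel_nonneg hα0 hτ.1
  have hpos : ∀ x ∈ Ioo 0 T, 0 < inner ℝ (greenVec hα hT x) ψ := fun x hx => by
    rw [e, setIntegral_pos_iff_support_of_nonneg_ae (hnn x)
      ((greenKernel_memLp hα hT x).1.integrable (by norm_num))]
    refine lt_of_lt_of_le ?_ (measure_mono (show Ioo x T ⊆ _ from fun τ hτ => ⟨?_, hx.1.trans hτ.1, hτ.2⟩))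
    · simp [hx.2]
    · have h2 : 0 < τ - x := by linarith [hτ.1]
      have h3 : 0 < τ := hx.1.trans hτ.1
      rw [Function.mem_support, greenKernel, if_pos hx.1, rlKernel_of_pos _ h2]
      have := hx.1
      have := Real.Gamma_pos_of_pos hα0
      positivity
  refine ⟨ψ, fun x => by rw [e]; exact integral_nonneg_of_ae (hnn x), ?_⟩
  rw [setIntegral_pos_iff_support_of_nonneg_ae (Eventually.of_forall fun x => sq_nonneg _)]
  · refine lt_of_lt_of_le ?_ (measure_mono (show Ioo 0 T ⊆ _ from fun x hx => ⟨?_, hx⟩))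
    · simp [hT]
    · exact (pow_pos (hpos x hx) 2).ne'
  · refine Integrable.of_bound
      ((measurable_inner_greenVec hα hT ψ).pow_const 2).aestronglyMeasurable
      ((√(embConst α T) * ‖ψ‖) ^ 2) (Eventually.of_forall fun x => ?_)
    rw [norm_pow]
    exact pow_le_pow_left₀ (norm_nonneg _)
      (abs_inner_le_of_bound (norm_greenVec_le hα hT) (Real.sqrt_nonneg _) le_rfl x) 2

/-! ### The primitive of f, admissible radii and the parameter interval. -/

/-- The primitive of `f` vanishing at zero. -/
noncomputable def potential (f : ℝ → ℝ) (s : ℝ) : ℝ := ∫ r in (0 : ℝ)..s, f r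

lemma hasDerivAt_potential {f : ℝ → ℝ} (hf : Continuous f) (s : ℝ) :
    HasDerivAt (potential f) (f s) s :=
  intervalIntegral.integral_hasDerivAt_right (hf.intervalIntegrable _ _)
    (hf.stronglyMeasurableAtFilter _ _) hf.continuousAt

lemma continuous_potential {f : ℝ → ℝ} (hf : Continuous f) : Continuous (potential f) :=
  continuous_iff_continuousAt.2 fun s => (hasDerivAt_potential hf s).continuousAt

lemma potential_zero (f : ℝ → ℝ) : potential f 0 = 0 := intervalIntegral.integral_same

lemma monotone_potential {f : ℝ → ℝ} (hf : Continuous f) (hf0 : ∀ t, 0 ≤ f t) :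
    Monotone (potential f) :=
  monotone_of_hasDerivAt_nonneg (hasDerivAt_potential hf) hf0

/-- If `f(t) / t → ∞` at `0+`, then the primitive of `f` is superquadratic at `0+`. -/
lemma potential_superquadratic {f : ℝ → ℝ} (hf : Continuous f) (hf0 : ∀ t, 0 ≤ f t)
    (hS0 : Tendsto (fun t => f t / t) (𝓝[>] 0) atTop) (L : ℝ) :
    ∃ δ > 0, ∀ s, 0 ≤ s → s ≤ δ → L * s ^ 2 ≤ potential f s := by
  obtain ⟨d, hd, hsub⟩ := mem_nhdsGT_iff_exists_Ioo_subset.1 (hS0.eventually_ge_atTop (2 * L))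
  have hd0 : 0 < d := hd
  refine ⟨d / 2, by positivity, fun s hs hsd => ?_⟩
  have e : ∫ r in (0 : ℝ)..s, 2 * L * r = L * s ^ 2 := by
    rw [intervalIntegral.integral_const_mul, integral_id]
    ring
  rw [← e]
  refine intervalIntegral.integral_mono_on hs
    (Continuous.intervalIntegrable (by fun_prop) _ _) (hf.intervalIntegrable _ _) fun r hr => ?_
  rcases hr.1.eq_or_lt with rfl | hr0
  · simpa using hf0 0
  · have : 2 * L ≤ f r / r := hsub ⟨hr0, by linarith [hr.2]⟩
    exact (le_div_iff₀ hr0).1 this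

/-- The radii `γ` for which the energy is non-negative on the boundary of the ball. -/
def admissibleRadii (C μ : ℝ) (f : ℝ → ℝ) : Set ℝ :=
  {γ | 0 < γ ∧ μ * potential f γ ≤ C * γ ^ 2}

/-- Superquadratic growth of the primitive at 0+ keeps admissible radii away from 0, so they form a
closed set bounded below by a positive number. -/
lemma sInf_mem_admissibleRadii {C μ : ℝ} {f : ℝ → ℝ} (hf : Continuous f) (hf0 : ∀ t, 0 ≤ f t)
    (hS0 : Tendsto (fun t => f t / t) (𝓝[>] 0) atTop) (hμ : 0 < μ)
    (hne : (admissibleRadii C μ f).Nonempty) :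
    sInf (admissibleRadii C μ f) ∈ admissibleRadii C μ f := by
  obtain ⟨δ, hδ, hL⟩ := potential_superquadratic hf hf0 hS0 ((C + 1) / μ)
  have hge : ∀ γ ∈ admissibleRadii C μ f, δ ≤ γ := by
    rintro γ ⟨h1, h2⟩
    by_contra! h
    have h3 := mul_le_mul_of_nonneg_left (hL γ h1.le h.le) hμ.le
    have e : μ * ((C + 1) / μ * γ ^ 2) = (C + 1) * γ ^ 2 := by field_simp
    nlinarith [pow_pos h1 2]
  have e : admissibleRadii C μ f = Ici δ ∩ {γ | μ * potential f γ ≤ C * γ ^ 2} := by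
    ext γ
    exact ⟨fun h => ⟨hge γ h, h.2⟩, fun h => ⟨hδ.trans_le h.1, h.2⟩⟩
  have hcl : IsClosed (admissibleRadii C μ f) := by
    rw [e]
    have := continuous_potential hf
    exact isClosed_Ici.inter (isClosed_le (by fun_prop) (by fun_prop))
  exact hcl.csInf_mem hne ⟨δ, hge⟩

lemma admissibleRadii_anti {C μ₁ μ₂ : ℝ} {f : ℝ → ℝ} (hf : Continuous f) (hf0 : ∀ t, 0 ≤ f t)
    (h : μ₁ ≤ μ₂) : admissibleRadii C μ₂ f ⊆ admissibleRadii C μ₁ f := fun γ hγ => by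
  refine ⟨hγ.1, le_trans ?_ hγ.2⟩
  have : 0 ≤ potential f γ := by
    rw [← potential_zero f]
    exact monotone_potential hf hf0 hγ.1.le
  gcongr

/-- This nests the balls of minimisation, on which both the monotonicity of the energy and the limit
μ → 0+ depend. -/
lemma sInf_admissibleRadii_mono {C μ₁ μ₂ : ℝ} {f : ℝ → ℝ} (hf : Continuous f) (hf0 : ∀ t, 0 ≤ f t)
    (h : μ₁ ≤ μ₂) (hne : (admissibleRadii C μ₂ f).Nonempty) :
    sInf (admissibleRadii C μ₁ f) ≤ sInf (admissibleRadii C μ₂ f) :=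
  csInf_le_csInf ⟨0, fun _ hγ => hγ.1.le⟩ hne (admissibleRadii_anti hf hf0 h)

/-- The constant `Γ(α)² |cos πα| (2α - 1) / T^{2α}`. -/
noncomputable def radiusConst (α T : ℝ) : ℝ :=
  Real.Gamma α ^ 2 * |Real.cos (Real.pi * α)| * (2 * α - 1) / T ^ (2 * α)

lemma abs_cos_pi_mul_pos {α : ℝ} (hα : 1 / 2 < α) (hα1 : α ≤ 1) :
    0 < |Real.cos (Real.pi * α)| := by
  have hpi := Real.pi_pos
  exact abs_pos.2 (Real.cos_neg_of_pi_div_two_lt_of_lt (by nlinarith) (by nlinarith)).ne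

lemma radiusConst_pos {α T : ℝ} (hα : 1 / 2 < α) (hα1 : α ≤ 1) (hT : 0 < T) :
    0 < radiusConst α T := by
  have h1 := abs_cos_pi_mul_pos hα hα1
  have h2 := Real.Gamma_pos_of_pos (show 0 < α by linarith)
  have h3 : 0 < 2 * α - 1 := by linarith
  unfold radiusConst
  positivity

lemma embConst_pos {α T : ℝ} (hα : 1 / 2 < α) (hT : 0 < T) : 0 < embConst α T := by
  have h2 := Real.Gamma_pos_of_pos (show 0 < α by linarith)
  have h3 : 0 < 2 * α - 1 := by linarith
  unfold embConst
  positivity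

lemma potential_pos {f : ℝ → ℝ} (hf : Continuous f) (hf0 : ∀ t, 0 ≤ f t)
    (hS0 : Tendsto (fun t => f t / t) (𝓝[>] 0) atTop) {γ : ℝ} (hγ : 0 < γ) :
    0 < potential f γ := by
  obtain ⟨δ, hδ, hL⟩ := potential_superquadratic hf hf0 hS0 1
  have h1 : 0 < min δ γ := lt_min hδ hγ
  have h2 := hL _ h1.le (min_le_left _ _)
  have h3 := monotone_potential hf hf0 (min_le_right δ γ)
  nlinarith [pow_pos h1 2]

/-- Lying strictly below a supremum in [0, ∞] means lying below one of its terms, and the primitive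
is positive at γ, so its denominator can be cleared. -/
lemma mem_paramInterval_iff {α T μ : ℝ} {f : ℝ → ℝ} (hα : 1 / 2 < α) (hα1 : α ≤ 1) (hT : 0 < T)
    (hf : Continuous f) (hf0 : ∀ t, 0 ≤ f t)
    (hS0 : Tendsto (fun t => f t / t) (𝓝[>] 0) atTop) :
    μ ∈ paramInterval α T f ↔
      0 < μ ∧ ∃ γ, 0 < γ ∧ μ * potential f γ < radiusConst α T * γ ^ 2 := by
  have hC := radiusConst_pos hα hα1 hT
  refine and_congr_right fun hμ => ?_
  rw [ENNReal.mul_iSup]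
  simp only [ENNReal.mul_iSup, lt_iSup_iff, exists_prop]
  refine exists_congr fun γ => and_congr_right fun hγ => ?_
  have hp := potential_pos hf hf0 hS0 hγ
  rw [← radiusConst, ← ENNReal.ofReal_mul hC.le, ENNReal.ofReal_lt_ofReal_iff_of_nonneg hμ.le,
    ← mul_div_assoc]
  exact lt_div_iff₀ hp

/-! ### From an interior minimum to a solution. -/

/-- The functional whose critical points are the solutions. -/
noncomputable def dualFunctional {α T : ℝ} (hα : 1 / 2 < α) (hT : 0 < T) (f : ℝ → ℝ) (μ : ℝ)
    (ψ : Lp ℝ 2 ((volume : Measure ℝ).restrict (Ioo 0 T))) : ℝ :=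
  dualEnergy (volume.restrict (Ioo 0 T)) (greenVec hα hT) |Real.cos (Real.pi * α)| μ (potential f) ψ

/-- On this sphere the function represented by ψ is at most γ, so the nonlinear term is at most μ T
F(γ), F being the primitive of f. As `radiusConst` equals |cos πα| / (T · `embConst`), the quadratic
term is exactly T · `radiusConst` · γ². -/
lemma dualFunctional_nonneg_of_norm_eq {α T μ γ : ℝ} {f : ℝ → ℝ} (hα : 1 / 2 < α) (hT : 0 < T)
    (hf : Continuous f) (hf0 : ∀ t, 0 ≤ f t) (hμ : 0 < μ)
    (hγ : γ ∈ admissibleRadii (radiusConst α T) μ f)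
    {ψ : Lp ℝ 2 ((volume : Measure ℝ).restrict (Ioo 0 T))}
    (hψ : ‖ψ‖ = γ / √(embConst α T)) : 0 ≤ dualFunctional hα hT f μ ψ := by
  have hE := embConst_pos hα hT
  have hs := Real.sqrt_pos.2 hE
  have hin : ∀ x, inner ℝ (greenVec hα hT x) ψ ≤ γ := fun x => by
    have := abs_inner_le_of_bound (norm_greenVec_le hα hT) hs.le hψ.le x
    rw [mul_div_cancel₀ _ hs.ne'] at this
    exact (le_abs_self _).trans this
  have hM := monotone_potential hf hf0
  have hγ0 : 0 ≤ potential f γ := by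
    rw [← potential_zero f]
    exact hM hγ.1.le
  have h1 : ∫ x in Ioo 0 T, potential f (inner ℝ (greenVec hα hT x) ψ) ≤ T * potential f γ := by
    by_cases hi : IntegrableOn (fun x => potential f (inner ℝ (greenVec hα hT x) ψ)) (Ioo 0 T)
    · refine (integral_mono hi (integrable_const (potential f γ)) fun x => hM (hin x)).trans ?_
      simp [hT.le]
    -- A non-integrable integrand would have integral 0 by convention, and the bound still holds.
    · rw [integral_undef hi]
      positivity
  have h2 : |Real.cos (Real.pi * α)| * ‖ψ‖ ^ 2 = T * (radiusConst α T * γ ^ 2) := by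
    have hG := (Real.Gamma_pos_of_pos (show 0 < α by linarith)).ne'
    have ha : 2 * α - 1 ≠ 0 := by linarith
    have hTp := (Real.rpow_pos_of_pos hT (2 * α - 1)).ne'
    rw [hψ, div_pow, Real.sq_sqrt hE.le, radiusConst, embConst,
      show T ^ (2 * α) = T ^ (2 * α - 1) * T by rw [← Real.rpow_add_one hT.ne']; ring_nf]
    generalize |Real.cos (Real.pi * α)| = κ
    field_simp
  have h3 := mul_le_mul_of_nonneg_left h1 hμ.le
  have h4 := mul_le_mul_of_nonneg_left hγ.2 hT.le
  rw [dualFunctional, dualEnergy, h2]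
  linarith

/-- For an admissible radius, the functional has a minimum in the ball, which yields a solution. -/
lemma exists_solution {α T μ γ : ℝ} {f : ℝ → ℝ} (hα : 1 / 2 < α) (hα1 : α ≤ 1) (hT : 0 < T)
    (hf : Continuous f) (hf0 : ∀ t, 0 ≤ f t)
    (hS0 : Tendsto (fun t => f t / t) (𝓝[>] 0) atTop) (hμ : 0 < μ)
    (hγ : γ ∈ admissibleRadii (radiusConst α T) μ f) :
    ∃ (ψ : Lp ℝ 2 ((volume : Measure ℝ).restrict (Ioo 0 T))) (h : ℝ → ℝ),
      ‖ψ‖ ≤ γ / √(embConst α T) ∧ dualFunctional hα hT f μ ψ < 0 ∧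
      (∀ η, ‖η‖ ≤ γ / √(embConst α T) →
        dualFunctional hα hT f μ ψ ≤ dualFunctional hα hT f μ η) ∧
      Measurable h ∧
      (∀ M, (∀ s, |s| ≤ γ → |f s| ≤ M) →
        ∀ x, |h x| ≤ μ * M / (2 * |Real.cos (Real.pi * α)|)) ∧
      IsSolution α T μ f (greenPrimitive α T h) ∧
      energy α T μ f (greenPrimitive α T h) = dualFunctional hα hT f μ ψ ∧
      ∃ t ∈ Icc 0 T, greenPrimitive α T h t ≠ 0 := by
  have hκ := abs_cos_pi_mul_pos hα hα1
  set κ := |Real.cos (Real.pi * α)| with hκd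
  have hs := Real.sqrt_pos.2 (embConst_pos hα hT)
  have hρ : 0 < γ / √(embConst α T) := div_pos hγ.1 hs
  have : Fact ((2 : ENNReal) ≠ ⊤) := ⟨by norm_num⟩
  have hK := norm_greenVec_le hα hT
  have hm := measurable_inner_greenVec hα hT
  have hFc := continuous_potential hf
  obtain ⟨ψ, hψ, hmin⟩ := exists_min_dualEnergy (ν := volume.restrict (Ioo 0 T)) hK hs.le hm hFc
    hκ.le hμ.le hρ.le
  obtain ⟨ψ₁, hψ₁, hψ₂⟩ := exists_inner_greenVec_pos hα hT
  obtain ⟨η, hη, hneg⟩ := exists_dualEnergy_neg (κ := κ) hK hs.le hm hFc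
    (potential_superquadratic hf hf0 hS0) hμ hρ hψ₁ hψ₂
  have hJ : dualFunctional hα hT f μ ψ < 0 := (hmin η hη).trans_lt hneg
  -- The functional is non-negative on the sphere and negative at the minimiser, so the minimiser is
  -- interior.
  have hlt : ‖ψ‖ < γ / √(embConst α T) := lt_of_le_of_ne hψ fun h =>
    absurd (dualFunctional_nonneg_of_norm_eq hα hT hf hf0 hμ hγ h) hJ.not_ge
  have hEL := euler_lagrange_dualEnergy hK hs.le hm hf (hasDerivAt_potential hf) hlt hmin
  set w : ℝ → ℝ := fun x => inner ℝ (greenVec hα hT x) ψ with hw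
  set h : ℝ → ℝ := fun x => μ * f (w x) / (2 * κ) with hh
  have hhm : Measurable h := ((hf.measurable.comp (hm ψ)).const_mul μ).div_const _
  have hwb : ∀ x, |w x| ≤ γ := fun x => by
    have := abs_inner_le_of_bound hK hs.le hψ x
    rwa [mul_div_cancel₀ _ hs.ne'] at this
  have hb : ∀ M, (∀ s, |s| ≤ γ → |f s| ≤ M) → ∀ x, |h x| ≤ μ * M / (2 * κ) := fun M hM x => by
    rw [hh, abs_div, abs_mul, abs_of_pos hμ, abs_of_pos (by positivity : 0 < 2 * κ)]
    gcongr
    exact hM _ (hwb x)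
  obtain ⟨M, -, hM⟩ := exists_bound_comp hf γ
  have hB := hb M hM
  have hfix : ∀ t ∈ Ioo 0 T, greenPrimitive α T h t = w t := fun t ht => by
    rw [greenPrimitive, ← greenSolution_eq_integral hα hα1 hT hhm hB (Ioo_subset_Icc_self ht),
      greenSolution_eq_inner hα hT hhm hB ht]
    -- Tested against the vector at t, the Euler–Lagrange equation expresses w(t) as the Gram
    -- integral of h, which is the Green solution.
    have e1 := hEL (greenVec hα hT t)
    rw [← integral_const_mul] at e1
    rw [hw]
    simp only
    rw [real_inner_comm, ← mul_right_inj' (by positivity : 2 * κ ≠ 0), e1, ← integral_const_mul]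
    refine setIntegral_congr_fun measurableSet_Ioo fun x _ => ?_
    simp only [hh]
    field_simp
    exact mul_comm _ _
  have hsol := isSolution_greenPrimitive hα hα1 hT hhm hB hf (μ := μ) fun t ht => by
    rw [hfix t ht, hh, ← hκd]
    field_simp
  have hen : energy α T μ f (greenPrimitive α T h) =
      κ * (∫ t in Ioo 0 T, greenPrimitive α T h t * h t) -
        μ * ∫ t in Ioo 0 T, potential f (greenPrimitive α T h t) := by
    rw [energy, integral_caputo_greenPrimitive hα hα1 hT hhm hB]
    simp only [intervalIntegral.integral_of_le hT.le, integral_Ioc_eq_integral_Ioo]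
    rfl
  have hen2 : energy α T μ f (greenPrimitive α T h) = dualFunctional hα hT f μ ψ := by
    -- Tested against ψ itself, the equation identifies the quadratic part of the energy of u with κ
    -- ‖ψ‖².
    have e1 := hEL ψ
    have e2 : ∫ t in Ioo 0 T, potential f (greenPrimitive α T h t) =
        ∫ t in Ioo 0 T, potential f (w t) :=
      setIntegral_congr_fun measurableSet_Ioo fun t ht => by simp only [hfix t ht]
    have e3 : 2 * κ * ∫ t in Ioo 0 T, greenPrimitive α T h t * h t =
        μ * ∫ t in Ioo 0 T, f (w t) * w t := by
      rw [← integral_const_mul, ← integral_const_mul]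
      refine setIntegral_congr_fun measurableSet_Ioo fun t ht => ?_
      rw [hfix t ht, hh]
      field_simp
    rw [real_inner_self_eq_norm_sq] at e1
    rw [hen, e2, dualFunctional, dualEnergy]
    have e4 : κ * (∫ t in Ioo 0 T, greenPrimitive α T h t * h t) = κ * ‖ψ‖ ^ 2 := by
      have : 2 * κ * ∫ t in Ioo 0 T, greenPrimitive α T h t * h t = 2 * κ * ‖ψ‖ ^ 2 :=
        e3.trans e1.symm
      linarith
    rw [e4]
  refine ⟨ψ, h, hψ, hJ, hmin, hhm, hb, hsol, hen2, ?_⟩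
  -- The zero function has energy 0, whereas this energy is negative.
  by_contra! hzero
  rw [← hen2, hen] at hJ
  have z1 : ∫ t in Ioo 0 T, greenPrimitive α T h t * h t = 0 := by
    exact setIntegral_eq_zero_of_forall_eq_zero fun t ht => by
      rw [hzero t (Ioo_subset_Icc_self ht), zero_mul]
  have z2 : ∫ t in Ioo 0 T, potential f (greenPrimitive α T h t) = 0 := by
    exact setIntegral_eq_zero_of_forall_eq_zero fun t ht => by
      rw [hzero t (Ioo_subset_Icc_self ht), potential_zero]
  rw [z1, z2] at hJ
  simp at hJ

/-- A negative value forces the integral multiplied by μ to be positive, so raising μ strictly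
lowers the functional. -/
lemma dualFunctional_lt {α T μ₁ μ₂ : ℝ} {f : ℝ → ℝ} (hα : 1 / 2 < α) (hT : 0 < T) (h : μ₁ < μ₂)
    (hμ : 0 < μ₁) {ψ : Lp ℝ 2 ((volume : Measure ℝ).restrict (Ioo 0 T))}
    (hψ : dualFunctional hα hT f μ₁ ψ < 0) :
    dualFunctional hα hT f μ₂ ψ < dualFunctional hα hT f μ₁ ψ := by
  unfold dualFunctional dualEnergy at *
  set I := ∫ x in Ioo 0 T, potential f (inner ℝ (greenVec hα hT x) ψ)
  have h1 : 0 ≤ |Real.cos (Real.pi * α)| * ‖ψ‖ ^ 2 := by positivity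
  have h2 : 0 < I := by
    by_contra! hI
    nlinarith
  nlinarith

end FracBVP

/-! ### Choice of the solutions, limit at 0+ and monotonicity of the energy. -/

theorem theorem1p1 (α T : ℝ) (hα : 1 / 2 < α) (hα' : α ≤ 1) (hT : 0 < T)
    (f : ℝ → ℝ) (hf : Continuous f) (hf0 : ∀ t, 0 ≤ f t)
    (hS0 : Tendsto (fun t => f t / t) (𝓝[>] 0) atTop) :
    ∃ u : ℝ → ℝ → ℝ,
      (∀ μ ∈ FracBVP.paramInterval α T f,
        FracBVP.IsSolution α T μ f (u μ) ∧
        (∃ t ∈ Icc 0 T, u μ t ≠ 0) ∧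
        u μ ∈ FracBVP.fracSpace α T ∧
        FracBVP.HasFracDeriv α T (u μ) (FracBVP.caputoLeft α 0 (u μ)) ∧
        MemLp (FracBVP.caputoRight α T (u μ)) 2 (volume.restrict (Icc 0 T))) ∧
      Tendsto (fun μ => ∫ t in (0 : ℝ)..T, |FracBVP.caputoLeft α 0 (u μ) t| ^ 2)
        (𝓝[>] 0) (𝓝 0) ∧
      (∀ μ ∈ FracBVP.paramInterval α T f, FracBVP.energy α T μ f (u μ) < 0) ∧
      StrictAntiOn (fun μ => FracBVP.energy α T μ f (u μ)) (FracBVP.paramInterval α T f) := by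
  open FracBVP in
  set S := fun μ => admissibleRadii (radiusConst α T) μ f with hS
  have hmem := fun μ => mem_paramInterval_iff (μ := μ) hα hα' hT hf hf0 hS0
  have hne : ∀ μ ∈ paramInterval α T f, (S μ).Nonempty := fun μ hμ => by
    obtain ⟨-, γ, h1, h2⟩ := (hmem μ).1 hμ
    exact ⟨γ, h1, h2.le⟩
  -- Taking the smallest admissible radius for each μ makes the radius monotone in μ.
  have hex := fun (μ : ℝ) (hμ : μ ∈ paramInterval α T f) =>
    exists_solution hα hα' hT hf hf0 hS0 hμ.1
      (sInf_mem_admissibleRadii hf hf0 hS0 hμ.1 (hne μ hμ))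
  choose! ψ h hψ hneg hmin hhm hb hsol hen hnt using hex
  have hbd : ∀ μ ∈ paramInterval α T f, ∃ B, ∀ x, |h μ x| ≤ B := fun μ hμ => by
    obtain ⟨M, -, hM⟩ := exists_bound_comp hf (sInf (S μ))
    exact ⟨_, hb μ hμ M hM⟩
  refine ⟨fun μ => greenPrimitive α T (h μ), fun μ hμ => ?_, ?_, fun μ hμ => ?_, ?_⟩
  · obtain ⟨B, hB⟩ := hbd μ hμ
    have hv := (greenDeriv_sq_le (T := T) hα hα' (hhm μ hμ) hB).1
    have hfd : HasFracDeriv α T (greenPrimitive α T (h μ))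
        (caputoLeft α 0 (greenPrimitive α T (h μ))) :=
      hasFracDeriv_integral hα' hT hv (greenPrimitive_right hα hα' hT (hhm μ hμ) hB)
    refine ⟨hsol μ hμ, hnt μ hμ, ⟨_, hfd⟩, hfd, ?_⟩
    rw [restrict_Icc_eq_Ioo]
    exact caputoRight_memLp hα' hv (deriv_greenPrimitive_ae hα hα' hT (hhm μ hμ) hB)
  · have hp := potential_pos hf hf0 hS0 one_pos
    have hC := radiusConst_pos hα hα' hT
    have hκ := abs_cos_pi_mul_pos hα hα'
    -- Half the threshold belonging to γ = 1, so that γ = 1 is strictly admissible for every μ ≤ μ₀.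
    set μ₀ := radiusConst α T / (2 * potential f 1) with hμ₀
    have hμ₀p : 0 < μ₀ := by positivity
    have hsmall : ∀ μ, 0 < μ → μ ≤ μ₀ → μ ∈ paramInterval α T f := fun μ h1 h2 => by
      refine (hmem μ).2 ⟨h1, 1, one_pos, ?_⟩
      rw [hμ₀, le_div_iff₀ (by positivity)] at h2
      nlinarith
    -- One bound for f serves all μ ≤ μ₀, since their radii do not exceed that of μ₀; hence h is
    -- O(μ) uniformly.
    obtain ⟨M, -, hM⟩ := exists_bound_comp hf (sInf (S μ₀))
    obtain ⟨C, hCb⟩ := integral_caputoLeft_sq_le hα hα' hT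
    have hlim : Tendsto (fun μ : ℝ => C * (μ * M / (2 * |Real.cos (Real.pi * α)|)) ^ 2)
        (𝓝[>] 0) (𝓝 0) := by
      have hc : Continuous fun μ : ℝ => C * (μ * M / (2 * |Real.cos (Real.pi * α)|)) ^ 2 := by
        fun_prop
      have := hc.tendsto 0
      simp only [zero_mul, zero_div, ne_eq, OfNat.ofNat_ne_zero, not_false_eq_true, zero_pow,
        mul_zero] at this
      exact this.mono_left nhdsWithin_le_nhds
    refine squeeze_zero' (Eventually.of_forall fun μ => ?_) ?_ hlim
    · exact intervalIntegral.integral_nonneg hT.le fun t _ => by positivity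
    · filter_upwards [Ioc_mem_nhdsGT hμ₀p] with μ hμ
      have hμΛ := hsmall μ hμ.1 hμ.2
      refine hCb _ _ (hhm μ hμΛ) (hb μ hμΛ M fun s hs => hM s (hs.trans ?_))
      exact sInf_admissibleRadii_mono hf hf0 hμ.2 (hne μ₀ (hsmall μ₀ hμ₀p le_rfl))
  · rw [hen μ hμ]
    exact hneg μ hμ
  · intro μ₁ h1 μ₂ h2 hlt
    simp only
    rw [hen μ₁ h1, hen μ₂ h2]
    -- The minimiser for μ₁ lies in the larger ball of μ₂ and is used as a competitor there.
    refine (hmin μ₂ h2 _ ((hψ μ₁ h1).trans ?_)).trans_lt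
      (dualFunctional_lt hα hT hlt h1.1 (hneg μ₁ h1))
    exact div_le_div_of_nonneg_right
      (sInf_admissibleRadii_mono hf hf0 hlt.le (hne μ₂ h2)) (Real.sqrt_nonneg _)
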